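/- Manifolds are $C^\infty$-smooth, Hausdorff and second countable. Let $G$ be a compact Lie group with Lie algebra $\mathfrak g$. For a $G$-manifold $N$ and $X\in\mathfrak g$, let $X^\sharp$ be the vector field $X^\sharp|_x=\frac{d}{dt}\big|_{t=0}\exp(tX)\cdot x$. A *Hamiltonian $G$-manifold* $(N,\omega,\Phi)$ is an oriented $G$-manifold $N$ with a $G$-invariant closed (possibly degenerate) $2$-form $\omega$ and a smooth $G$-equivariant map $\Phi\colon N\to\mathfrak g^*$ such that $d\langle\Phi,X\rangle=\iota(X^\sharp)\omega$ for all $X\in\mathfrak g$. A *taming map* on $N$ is a smooth $G$-equivariant map $v\colon N\to\mathfrak g$; its *localizing set* is $\{x\in N : v(x)^\sharp|_x=0\}$. The map $\Phi$ is *$v$-polarized* on a subset $Y\subseteq N$ if $\langle\Phi,v\rangle|_Y\colon Y\to\mathbb R$ is proper and bounded from below. If $\dim N=2n$ and $\Phi$ is proper, the *Duistermaat–Heckman distribution* of $(N,\omega,\Phi)$ is $$\mathrm{DH}_{(N,\omega,\Phi)}(\varphi)=\int_N(\varphi\circ\Phi)\,\frac{\omega^n}{n!},\qquad \varphi\in C_c^\infty(\mathfrak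 g^*).$$ Let $Y\subseteq N$ be closed and $G$-invariant with $\Phi|_Y$ $v$-polarized. A *$v$-polarized completion* of $(N,\omega,\Phi)$ relative to $Y$ is a Hamiltonian $G$-manifold $(N,\tilde\omega,\tilde\Phi)$ on the same oriented $G$-manifold such that $\tilde\Phi$ is $v$-polarized on $N$ and $\tilde\omega+\tilde\Phi$ agrees with $\omega+\Phi$ on $Y$: for every $k\ge1$, every open $V\subseteq\mathbb R^k$ and every smooth $p\colon V\to N$ with image in $Y$, one has $p^*\tilde\omega=p^*\omega$ and $\tilde\Phi\circ p=\Phi\circ p$. A *smooth equivariant weak deformation retraction* of a $G$-manifold $U$ to a $G$-invariant closed subset $C$ is a smooth $G$-equivariant homotopy $p_t\colon U\to U$, $0\le t\le1$, with $p_0=\mathrm{id}_U$, $p_1(U)\subseteq C$, and $p_t(C)\subseteq C$ for all $t$. **Theorem.** Let $(M,\omega,\Phi)$ be an even-dimensional Hamiltonian $G$-manifold without boundary, let $v\colon M\to\mathfrak g$ be a bounded taming map such that $\Phi$ is $v$-polarized on $M$, let $Z$ be the localizing set of $v$, and let $Z=\bigsqcup_{i\in\mathcal I}Z_i$ be its decomposition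 into connected components. Suppose that every $Z_i$ is relatively open in $Z$ and that, for every $i$, each neighbourhood of $Z_i$ contains a $G$-invariant open neighbourhood of $Z_i$ that admits a smooth equivariant weak deformation retraction to $Z_i$. For each $i$, consider the triples $(U_i,\omega_i,\Phi_i)$ in which $U_i$ is a $G$-invariant open neighbourhood of $Z_i$ with $U_i\cap Z=Z_i$ that admits a smooth equivariant weak deformation retraction to $Z_i$, and $(U_i,\omega_i,\Phi_i)$ is a $v|_{U_i}$-polarized completion of $(U_i,\omega|_{U_i},\Phi|_{U_i})$ relative to $Z_i$. Then: 1. such triples exist with $U_i$ contained in any given neighbourhood of $Z_i$, and $\mathrm{DH}_{(U_i,\omega_i,\Phi_i)}$ is the same for all of them; denote this common distribution by $\mathrm{DH}^v_{\mathrm{germ}_{Z_i}(M,\omega,\Phi)}$; 2. for every $\varphi\in C_c^\infty(\mathfrak g^*)$, only finitely many of the numbers $\mathrm{DH}^v_{\mathrm{germ}_{Z_i}(M,\omega,\Phi)}(\varphi)$ are nonzero, and $$\mathrm{DH}_{(M,\omega,\Phi)}(\varphi)=\sum_{i\in\mathcal I}\mathrm{DH}^v_{\mathrm{germ}_{Z_i}(M,\omega,\Phi)}(\varphi).$$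 -/

import Mathlib

open Set Topology MeasureTheory
open scoped Manifold ContDiff Distributions

noncomputable section

namespace HamiltonianLocalization

/-! ### Differential forms on manifolds without boundary

Throughout, `M` is a manifold modelled on `ℝᵐ = EuclideanSpace ℝ (Fin m)`.  An open submanifold
`U ⊆ M` is treated as a set: a form (or function) on `U` is represented by a section over `M`, of
which every definition below uses only the values at the points of `U`. -/

section Forms

variable {m : ℕ} {M : Type*} [TopologicalSpace M] [ChartedSpace (EuclideanSpace ℝ (Fin m)) M]

/-- (Not necessarily continuous) differential `k`-forms on `M`. -/
abbrev DiffForm (m : ℕ) (M : Type*) [TopologicalSpace M]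
    [ChartedSpace (EuclideanSpace ℝ (Fin m)) M] (k : ℕ) : Type _ :=
  ∀ x : M, TangentSpace (𝓡 m) x [⋀^Fin k]→L[ℝ] ℝ

/-- The expression of the form `σ` in the preferred chart `φ` at `x₀`, that is, the pullback of `σ`
under `φ⁻¹`; it is meaningful at the points of the target of `φ`, an open subset of `ℝᵐ`. -/
def DiffForm.inChart {k : ℕ} (σ : DiffForm m M k) (x₀ : M) (y : EuclideanSpace ℝ (Fin m)) :
    EuclideanSpace ℝ (Fin m) [⋀^Fin k]→L[ℝ] ℝ :=
  (σ ((extChartAt (𝓡 m) x₀).symm y)).compContinuousLinearMap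
    (mfderiv 𝓘(ℝ, EuclideanSpace ℝ (Fin m)) (𝓡 m) (extChartAt (𝓡 m) x₀).symm y)

/-- The part of the target of the preferred chart at `x₀` that corresponds to `U`. -/
def chartDomain (U : Set M) (x₀ : M) : Set (EuclideanSpace ℝ (Fin m)) :=
  (extChartAt (𝓡 m) x₀).target ∩ (extChartAt (𝓡 m) x₀).symm ⁻¹' U

/-- `σ` is a smooth form on the open set `U`. -/
def DiffForm.SmoothOn {k : ℕ} (σ : DiffForm m M k) (U : Set M) : Prop :=
  ∀ x₀ : M, ContDiffOn ℝ ∞ (σ.inChart x₀) (chartDomain U x₀)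

/-- `dσ = 0` on the open set `U`. -/
def DiffForm.ClosedOn {k : ℕ} (σ : DiffForm m M k) (U : Set M) : Prop :=
  ∀ x₀ : M, ∀ y ∈ chartDomain U x₀, extDeriv (σ.inChart x₀) y = 0

/-- The wedge product of two alternating forms on a vector space. -/
def wedge {V : Type*} [AddCommGroup V] [Module ℝ V] {k l : ℕ}
    (α : V [⋀^Fin k]→ₗ[ℝ] ℝ) (β : V [⋀^Fin l]→ₗ[ℝ] ℝ) : V [⋀^Fin (k + l)]→ₗ[ℝ] ℝ :=
  ((LinearMap.mul' ℝ ℝ).compAlternatingMap (α.domCoprod β)).domDomCongr finSumFinEquiv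

/-- The `n`-fold wedge product `σ ∧ ⋯ ∧ σ` of a `2`-form on a vector space. -/
def wedgePow {V : Type*} [AddCommGroup V] [Module ℝ V] (σ : V [⋀^Fin 2]→ₗ[ℝ] ℝ) :
    (n : ℕ) → V [⋀^Fin (2 * n)]→ₗ[ℝ] ℝ
  | 0 => AlternatingMap.constOfIsEmpty ℝ V (Fin 0) 1
  | n + 1 => wedge (wedgePow σ n) σ

/-! ### Orientations and integration of top-degree forms -/

/-- The sign (`1` or `-1`) of a frame `e` of an `m`-dimensional vector space with respect to an
orientation, and `0` if `e` is linearly dependent. -/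
def frameSign {V : Type*} [AddCommGroup V] [Module ℝ V] (o : Orientation ℝ V (Fin m))
    (e : Fin m → V) : ℝ :=
  SignType.sign (Module.Ray.someVector o e)

/-- The coordinate frame `∂/∂y₁, …, ∂/∂yₘ` of the preferred chart at `x₀`. -/
def chartFrame (x₀ : M) (y : EuclideanSpace ℝ (Fin m)) (i : Fin m) :
    TangentSpace (𝓡 m) ((extChartAt (𝓡 m) x₀).symm y) :=
  mfderiv 𝓘(ℝ, EuclideanSpace ℝ (Fin m)) (𝓡 m) (extChartAt (𝓡 m) x₀).symm y
    (EuclideanSpace.single i (1 : ℝ))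

/-- An orientation of the manifold `M`: orientations of the tangent spaces such that, in each
chart, the sign of the coordinate frame is locally constant. -/
structure ManifoldOrientation (m : ℕ) (M : Type*) [TopologicalSpace M]
    [ChartedSpace (EuclideanSpace ℝ (Fin m)) M] where
  orientation : ∀ x : M, Orientation ℝ (TangentSpace (𝓡 m) x) (Fin m)
  continuousOn_frameSign : ∀ x₀ : M, ContinuousOn
    (fun y => frameSign (orientation ((extChartAt (𝓡 m) x₀).symm y)) (chartFrame x₀ y))
    (extChartAt (𝓡 m) x₀).target

lemma sigmaCompactSpace_of_secondCountable (m : ℕ) (M : Type*) [TopologicalSpace M]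
    [ChartedSpace (EuclideanSpace ℝ (Fin m)) M] [SecondCountableTopology M] :
    SigmaCompactSpace M :=
  haveI := ChartedSpace.locallyCompactSpace (EuclideanSpace ℝ (Fin m)) M
  inferInstance

lemma exists_chartPartition (m : ℕ) (M : Type*) [TopologicalSpace M]
    [ChartedSpace (EuclideanSpace ℝ (Fin m)) M] [IsManifold (𝓡 m) ∞ M] [T2Space M]
    [SecondCountableTopology M] : ∃ ρ : SmoothPartitionOfUnity M (𝓡 m) M univ,
      ρ.IsSubordinate (fun x => (chartAt (EuclideanSpace ℝ (Fin m)) x).source) :=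
  haveI := sigmaCompactSpace_of_secondCountable m M
  SmoothPartitionOfUnity.exists_isSubordinate_chartAt_source (𝓡 m) M

/-- A smooth partition of unity subordinate to the cover of `M` by the domains of the preferred
charts. -/
def chartPartition (m : ℕ) (M : Type*) [TopologicalSpace M]
    [ChartedSpace (EuclideanSpace ℝ (Fin m)) M] [IsManifold (𝓡 m) ∞ M] [T2Space M]
    [SecondCountableTopology M] : SmoothPartitionOfUnity M (𝓡 m) M univ :=
  (exists_chartPartition m M).choose

/-- The integral `∫_U f η` over the open subset `U` of the oriented manifold `M`, where the
pointwise alternating maps `η` form a form of top degree on `U` such that `f η` is continuous with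
compact support in `U`: the sum, over a partition of unity, of the integrals in charts. -/
def integralForm [IsManifold (𝓡 m) ∞ M] [T2Space M] [SecondCountableTopology M]
    (o : ManifoldOrientation m M) (U : Set M) (f : M → ℝ)
    (η : ∀ x : M, TangentSpace (𝓡 m) x [⋀^Fin m]→ₗ[ℝ] ℝ) : ℝ :=
  ∑ᶠ x₀ : M, ∫ y in chartDomain U x₀,
    chartPartition m M x₀ ((extChartAt (𝓡 m) x₀).symm y) *
      (frameSign (o.orientation ((extChartAt (𝓡 m) x₀).symm y)) (chartFrame x₀ y) *
        (f ((extChartAt (𝓡 m) x₀).symm y) *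
          η ((extChartAt (𝓡 m) x₀).symm y) (chartFrame x₀ y)))

end Forms

/-! ### Hamiltonian `G`-manifolds

`G` is a Lie group of dimension `d`.  Its Lie algebra is the tangent space `T₁G`, whose underlying
vector space in Mathlib is the model space `ℝᵈ`; it is used here with the norm of `ℝᵈ`, which enters
only through topological notions (boundedness, smoothness, properness). -/

section Hamiltonian

/-- The underlying normed space of the Lie algebra `𝔤 = T₁G`. -/
abbrev LieAlg (d : ℕ) : Type := EuclideanSpace ℝ (Fin d)

/-- The underlying normed space of the dual `𝔤*`. -/
abbrev LieDual (d : ℕ) : Type := StrongDual ℝ (LieAlg d)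

variable {d m : ℕ} {G : Type*} [Group G] [TopologicalSpace G]
  [ChartedSpace (EuclideanSpace ℝ (Fin d)) G]
  {M : Type*} [TopologicalSpace M] [ChartedSpace (EuclideanSpace ℝ (Fin m)) M] [MulAction G M]

/-- The adjoint action of `g` on `𝔤`, the differential at `1` of `h ↦ g h g⁻¹`. -/
def Ad (g : G) : LieAlg d →L[ℝ] LieAlg d :=
  mfderiv (𝓡 d) (𝓡 d) (fun h : G => g * h * g⁻¹) 1

/-- The coadjoint action of `g` on `𝔤*`. -/
def coAd (g : G) (ξ : LieDual d) : LieDual d := ξ.comp (Ad g⁻¹)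

/-- The fundamental vector field `X♯` of `X ∈ 𝔤` on `M`: its value at `x` is the image of `X` under
the differential at `1` of the orbit map `g ↦ g • x`. -/
def fundamentalField (G : Type*) [Group G] [TopologicalSpace G]
    [ChartedSpace (EuclideanSpace ℝ (Fin d)) G] [MulAction G M] (X : LieAlg d) (x : M) :
    TangentSpace (𝓡 m) x :=
  (mfderiv (𝓡 d) (𝓡 m) (fun g : G => g • x) 1 : LieAlg d →L[ℝ] EuclideanSpace ℝ (Fin m)) X

/-- The subset `U` is `G`-invariant. -/
def InvariantSet (G : Type*) [Group G] [MulAction G M] (U : Set M) : Prop :=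
  ∀ g : G, ∀ x ∈ U, g • x ∈ U

/-- A taming map: a smooth `G`-equivariant map `M → 𝔤`. -/
structure IsTamingMap (G : Type*) [Group G] [TopologicalSpace G]
    [ChartedSpace (EuclideanSpace ℝ (Fin d)) G] [MulAction G M] (v : M → LieAlg d) : Prop where
  smooth : ContMDiff (𝓡 m) 𝓘(ℝ, LieAlg d) ∞ v
  equivariant : ∀ (g : G) (x : M), v (g • x) = Ad g (v x)

/-- The localizing set `{x | v♯ x = 0}`, where `v♯ x = (v x)♯ x`. -/
def localizingSet (G : Type*) [Group G] [TopologicalSpace G]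
    [ChartedSpace (EuclideanSpace ℝ (Fin d)) G] [MulAction G M] (m : ℕ)
    [ChartedSpace (EuclideanSpace ℝ (Fin m)) M] (v : M → LieAlg d) : Set M :=
  {x | fundamentalField (m := m) G (v x) x = 0}

/-- `(U, σ, Φ)` is a Hamiltonian `G`-manifold, where `U` is a `G`-invariant open subset of the
oriented `G`-manifold `M`.  The closed form `σ` may be degenerate. -/
structure IsHamiltonian (G : Type*) [Group G] [TopologicalSpace G]
    [ChartedSpace (EuclideanSpace ℝ (Fin d)) G] [MulAction G M]
    (U : Set M) (σ : DiffForm m M 2) (Φ : M → LieDual d) : Prop where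
  isOpen : IsOpen U
  invariant : InvariantSet G U
  smooth_form : σ.SmoothOn U
  closed_form : σ.ClosedOn U
  invariant_form : ∀ (g : G), ∀ x ∈ U,
    (σ (g • x)).compContinuousLinearMap (mfderiv (𝓡 m) (𝓡 m) (fun y : M => g • y) x) = σ x
  smooth_moment : ContMDiffOn (𝓡 m) 𝓘(ℝ, LieDual d) ∞ Φ U
  equivariant_moment : ∀ (g : G), ∀ x ∈ U, Φ (g • x) = coAd g (Φ x)
  hamilton : ∀ (X : LieAlg d), ∀ x ∈ U, ∀ w : TangentSpace (𝓡 m) x,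
    mfderiv (𝓡 m) 𝓘(ℝ, ℝ) (fun y => Φ y X) x w = σ x ![fundamentalField G X x, w]

/-- The restriction of `Φ` to the subset `Y` is `v`-polarized: `⟨Φ, v⟩` is proper and bounded from
below on `Y`. -/
def IsPolarizedOn (Y : Set M) (v : M → LieAlg d) (Φ : M → LieDual d) : Prop :=
  IsProperMap (Y.domRestrict fun x => Φ x (v x)) ∧ BddBelow ((fun x => Φ x (v x)) '' Y)

/-- `σ₀ + Φ₀` and `σ₁ + Φ₁` agree on the subset `Y`: they have the same pullback under every smooth
map `p : V → M` with image in `Y`, where `V` is an open subset of some `ℝᵏ` with `k` positive. -/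
def AgreeOn (Y : Set M) (σ₀ : DiffForm m M 2) (Φ₀ : M → LieDual d)
    (σ₁ : DiffForm m M 2) (Φ₁ : M → LieDual d) : Prop :=
  ∀ (k : ℕ), 0 < k → ∀ (V : Set (EuclideanSpace ℝ (Fin k))), IsOpen V →
    ∀ p : EuclideanSpace ℝ (Fin k) → M,
      ContMDiffOn 𝓘(ℝ, EuclideanSpace ℝ (Fin k)) (𝓡 m) ∞ p V → MapsTo p V Y → ∀ u ∈ V,
        (σ₀ (p u)).compContinuousLinearMap
            (mfderiv 𝓘(ℝ, EuclideanSpace ℝ (Fin k)) (𝓡 m) p u) =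
          (σ₁ (p u)).compContinuousLinearMap
            (mfderiv 𝓘(ℝ, EuclideanSpace ℝ (Fin k)) (𝓡 m) p u) ∧
        Φ₀ (p u) = Φ₁ (p u)

/-- `(U, σ', Φ')` is a `v`-polarized completion of the Hamiltonian `G`-manifold `(U, σ, Φ)` relative
to the closed invariant subset `Y` of `U`. -/
structure IsPolarizedCompletion (G : Type*) [Group G] [TopologicalSpace G]
    [ChartedSpace (EuclideanSpace ℝ (Fin d)) G] [MulAction G M] (v : M → LieAlg d)
    (U Y : Set M) (σ : DiffForm m M 2) (Φ : M → LieDual d)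
    (σ' : DiffForm m M 2) (Φ' : M → LieDual d) : Prop where
  hamiltonian : IsHamiltonian G U σ' Φ'
  polarized : IsPolarizedOn U v Φ'
  agree : AgreeOn Y σ' Φ' σ Φ

/-- The open set `U` admits a smooth equivariant weak deformation retraction
`p : [0,1] × U → U` to its invariant subset `C`. -/
def HasWeakDeformationRetraction (G : Type*) [Group G] [MulAction G M] (m : ℕ)
    [ChartedSpace (EuclideanSpace ℝ (Fin m)) M] (U C : Set M) : Prop :=
  ∃ p : ℝ → M → M,
    ContMDiffOn (𝓘(ℝ, ℝ).prod (𝓡 m)) (𝓡 m) ∞ (fun q : ℝ × M => p q.1 q.2) (Icc 0 1 ×ˢ U) ∧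
    (∀ t ∈ Icc (0 : ℝ) 1, MapsTo (p t) U U) ∧
    (∀ t ∈ Icc (0 : ℝ) 1, ∀ g : G, ∀ x ∈ U, p t (g • x) = g • p t x) ∧
    (∀ x ∈ U, p 0 x = x) ∧
    (∀ x ∈ U, p 1 x ∈ C) ∧
    (∀ t ∈ Icc (0 : ℝ) 1, MapsTo (p t) C C)

/-- `U` is a `G`-invariant open neighbourhood of the (invariant) subset `C` that admits a smooth
equivariant weak deformation retraction to `C`. -/
structure IsRetractingNhd (G : Type*) [Group G] [MulAction G M] (m : ℕ)
    [ChartedSpace (EuclideanSpace ℝ (Fin m)) M] (U C : Set M) : Prop where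
  isOpen : IsOpen U
  invariant : InvariantSet G U
  invariant_core : InvariantSet G C
  subset : C ⊆ U
  retraction : HasWeakDeformationRetraction G m U C

/-- The set of connected components of the subset `Z`. -/
def componentsOf (Z : Set M) : Set (Set M) := {C | ∃ z ∈ Z, C = connectedComponentIn Z z}

/-- `(U, σ', Φ')` is a choice of data that computes the contribution of the component `C` of the
localizing set: `U` is an invariant open neighbourhood of `C` that contains no other point of the
localizing set and admits a smooth equivariant weak deformation retraction to `C`, and
`(U, σ', Φ')` is a `v`-polarized completion of `(U, σ, Φ)` relative to `C`. -/
structure IsLocalModel (G : Type*) [Group G] [TopologicalSpace G]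
    [ChartedSpace (EuclideanSpace ℝ (Fin d)) G] [MulAction G M] (v : M → LieAlg d)
    (σ : DiffForm m M 2) (Φ : M → LieDual d) (C : Set M)
    (U : Set M) (σ' : DiffForm m M 2) (Φ' : M → LieDual d) : Prop where
  nhd : IsRetractingNhd G m U C
  isolating : U ∩ localizingSet G m v = C
  completion : IsPolarizedCompletion G v U C σ Φ σ' Φ'

end Hamiltonian

/-- The Duistermaat-Heckman distribution `φ ↦ ∫_U (φ ∘ Φ) σⁿ/n!` of the Hamiltonian `G`-manifold
`(U, σ, Φ)`, with `U` an open subset of the oriented `2n`-dimensional manifold `M`. -/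
def DH {d n : ℕ} {M : Type*} [TopologicalSpace M]
    [ChartedSpace (EuclideanSpace ℝ (Fin (2 * n))) M] [IsManifold (𝓡 (2 * n)) ∞ M] [T2Space M]
    [SecondCountableTopology M] (o : ManifoldOrientation (2 * n) M) (U : Set M)
    (σ : DiffForm (2 * n) M 2) (Φ : M → LieDual d)
    (φ : 𝓓((⊤ : TopologicalSpace.Opens (LieDual d)), ℝ)) : ℝ :=
  integralForm o U (fun x => φ (Φ x))
    (fun x => (n.factorial : ℝ)⁻¹ • wedgePow (σ x).toAlternatingMap n)

/-- `D` is the distribution attached to the germ of `(M, σ, Φ)` along the component `C` of the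
localizing set: the Duistermaat-Heckman distribution of the `v`-polarized completion relative to `C`
of a small neighbourhood of `C`, where such completions exist on arbitrarily small neighbourhoods of
`C` and all of them have the same distribution `D`. -/
structure IsGermDH {d n : ℕ} (G : Type*) [Group G] [TopologicalSpace G]
    [ChartedSpace (EuclideanSpace ℝ (Fin d)) G] {M : Type*} [TopologicalSpace M]
    [ChartedSpace (EuclideanSpace ℝ (Fin (2 * n))) M] [IsManifold (𝓡 (2 * n)) ∞ M] [T2Space M]
    [SecondCountableTopology M] [MulAction G M] (o : ManifoldOrientation (2 * n) M)
    (v : M → LieAlg d) (σ : DiffForm (2 * n) M 2) (Φ : M → LieDual d) (C : Set M)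
    (D : 𝓓((⊤ : TopologicalSpace.Opens (LieDual d)), ℝ) → ℝ) : Prop where
  exists_localModel : ∀ O : Set M, IsOpen O → C ⊆ O →
    ∃ U ⊆ O, ∃ (σ' : DiffForm (2 * n) M 2) (Φ' : M → LieDual d), IsLocalModel G v σ Φ C U σ' Φ'
  eq_DH : ∀ (U : Set M) (σ' : DiffForm (2 * n) M 2) (Φ' : M → LieDual d),
    IsLocalModel G v σ Φ C U σ' Φ' → ∀ φ, D φ = DH o U σ' Φ' φ

end HamiltonianLocalization

end

open HamiltonianLocalization

open Set Topology MeasureTheory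
open scoped Manifold ContDiff Distributions

noncomputable section

namespace HamiltonianLocalization

/-! ### Linear algebra of alternating forms: smoothness, contraction, wedge powers -/

section Alternating

/-! The engine is a cobordism principle, `DH_eq_of_exact`. Let two Hamiltonian structures on `U`
differ by `dβ` in the form and by `-β(X♯)` in the moment map. If every structure on the segment
between them keeps its moment map off the support of `φ` outside one compact subset of `U`, then
both have the same Duistermaat-Heckman integral of `φ`. Indeed, along the segment the derivative of
`φ(Φ) σⁿ/n!` is the differential of the compactly supported form `φ(Φ) β ∧ σⁿ⁻¹/(n-1)!`: expanding
this differential gives the `dβ` term, and Hamilton's equation with `ι(X♯)σ ∧ β ∧ σⁿ⁻¹/(n-1)! =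
-β(X♯) σⁿ/n!` gives the variation of `φ(Φ)`. Stokes' theorem is proved by hand in charts
(`setIntegral_fderiv_pf_extDeriv`) and globalized with a second copy of the partition of unity
(`sum_setIntegral_variation_eq_zero`). The form `σⁿ⁻¹/(n-1)!` itself never appears: wedging with it
is the derivative of the coefficient `pf σ` of `σⁿ/n!`.

Since `v` is bounded, `⟨ξ, v⟩` is bounded above by some `c₀` on the support of `φ`
(`exists_bound_of_tsupport`). So only the sublevel set `⟨Φ, v⟩ ≤ c₀` matters, and polarization makes
it compact. Raising `⟨Φ, v⟩` therefore does no harm. Off the localizing set there is an invariant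
`1`-form `θ` with `θ(v♯) > 0`, and multiples of it raise `⟨Φ, v⟩` by any prescribed invariant
function that vanishes near the localizing set.

This yields `exists_localization`. Given an invariant neighbourhood `U` of the localizing set, one
exact change lifts `⟨Φ, v⟩` above `c₀` outside `U`, so that the integral can be restricted to `U`; a
second one, on `U` alone, blows up at the frontier of `U` and makes the restriction polarized.
Neither changes the structure near the localizing set, so the result is a polarized completion with
the same integral of `φ`.

For uniqueness, two completions on the same `U` that agree on a weak deformation retract differ by
an exact change whose primitive comes from the homotopy operator, so `DH_eq_of_agreeOn` applies.
Local models on different neighbourhoods are first localized to a common smaller retracting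
neighbourhood.

Finally, `exists_localModels` localizes `M` to a disjoint union of neighbourhoods of the components.
Compactness of the sublevel set leaves finitely many nonzero terms, and additivity over the disjoint
union gives the sum. The completion so obtained depends on `φ`, but by uniqueness its contributions
do not. -/

lemma fin_one_vec {E : Type*} (v : Fin 1 → E) : v = ![v 0] := by
  ext i; fin_cases i; rfl

lemma fin_two_vec {E : Type*} (v : Fin 2 → E) : v = ![v 0, v 1] := by
  ext i; fin_cases i <;> rfl

lemma removeNth_zero_two {E : Type*} (u w : E) : (0 : Fin 2).removeNth ![u, w] = ![w] := by
  ext i; fin_cases i; rfl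

lemma removeNth_one_two {E : Type*} (u w : E) : (1 : Fin 2).removeNth ![u, w] = ![u] := by
  ext i; fin_cases i; rfl

variable {X E F H H' : Type*} [NormedAddCommGroup X] [NormedSpace ℝ X]
  [NormedAddCommGroup E] [NormedSpace ℝ E] [NormedAddCommGroup F] [NormedSpace ℝ F]
  [NormedAddCommGroup H] [NormedSpace ℝ H] [NormedAddCommGroup H'] [NormedSpace ℝ H']

/-- An injective linear map into a finite-dimensional space has a linear left inverse, which is
automatically continuous. -/
lemma contDiffOn_of_comp_injective [FiniteDimensional ℝ H'] {r : WithTop ℕ∞} {f : X → H}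
    {s : Set X} (L : H →L[ℝ] H') (hL : Function.Injective L)
    (hf : ContDiffOn ℝ r (fun x => L (f x)) s) : ContDiffOn ℝ r f s := by
  have : FiniteDimensional ℝ H :=
    Module.Finite.of_injective (L : H →ₗ[ℝ] H') hL
  obtain ⟨g, hg⟩ := LinearMap.exists_leftInverse_of_injective (L : H →ₗ[ℝ] H')
    (LinearMap.ker_eq_bot.2 hL)
  have h : f = fun x => LinearMap.toContinuousLinearMap g (L (f x)) := by
    funext x
    exact (LinearMap.congr_fun hg (f x)).symm
  rw [h]
  exact (LinearMap.toContinuousLinearMap g).contDiff.comp_contDiffOn hf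

/-- The values on tuples of basis vectors embed the alternating maps linearly into a finite product
of copies of `ℝ`. -/
lemma contDiffOn_alternating_iff [FiniteDimensional ℝ E] {k : ℕ} {r : WithTop ℕ∞}
    {f : X → E [⋀^Fin k]→L[ℝ] ℝ} {s : Set X} :
    ContDiffOn ℝ r f s ↔ ∀ v : Fin k → E, ContDiffOn ℝ r (fun x => f x v) s := by
  refine ⟨fun h v => (ContinuousAlternatingMap.apply ℝ E ℝ v).contDiff.comp_contDiffOn h,
    fun h => ?_⟩
  let b := Module.finBasis ℝ E
  let L : (E [⋀^Fin k]→L[ℝ] ℝ) →L[ℝ] ((Fin k → Fin (Module.finrank ℝ E)) → ℝ) :=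
    ContinuousLinearMap.pi fun a => ContinuousAlternatingMap.apply ℝ E ℝ fun i => b (a i)
  refine contDiffOn_of_comp_injective L (fun σ τ hστ => ?_) (contDiffOn_pi.2 fun a => h _)
  apply ContinuousAlternatingMap.toAlternatingMap_injective
  refine Module.Basis.ext_alternating b fun a _ => ?_
  exact congrFun hστ a

lemma contDiffOn_compContinuousLinearMap [FiniteDimensional ℝ E] [FiniteDimensional ℝ F] {k : ℕ}
    {r : WithTop ℕ∞} {f : X → F [⋀^Fin k]→L[ℝ] ℝ} {A : X → E →L[ℝ] F} {s : Set X}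
    (hf : ContDiffOn ℝ r f s) (hA : ContDiffOn ℝ r A s) :
    ContDiffOn ℝ r (fun x => (f x).compContinuousLinearMap (A x)) s := by
  refine contDiffOn_alternating_iff.2 fun v => ?_
  let T : ContinuousMultilinearMap ℝ (fun _ : Fin k => E →L[ℝ] F) (ContinuousMultilinearMap ℝ
      (fun _ : Fin k => F) ℝ →L[ℝ] ContinuousMultilinearMap ℝ (fun _ : Fin k => E) ℝ) :=
    ContinuousMultilinearMap.compContinuousLinearMapContinuousMultilinear ℝ _ _ _
  have hT : ContDiff ℝ r T := by apply ContinuousMultilinearMap.contDiff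
  let S : (F [⋀^Fin k]→L[ℝ] ℝ) →L[ℝ] ContinuousMultilinearMap ℝ (fun _ : Fin k => F) ℝ :=
    ContinuousAlternatingMap.toContinuousMultilinearMapCLM ℝ
  let ev : ContinuousMultilinearMap ℝ (fun _ : Fin k => E) ℝ →L[ℝ] ℝ :=
    ContinuousMultilinearMap.apply ℝ (fun _ : Fin k => E) ℝ v
  have h1 : ContDiffOn ℝ r (fun x => T fun _ => A x) s :=
    hT.comp_contDiffOn (contDiffOn_pi.2 fun _ : Fin k => hA)
  have h2 : ContDiffOn ℝ r (fun x => S (f x)) s := S.contDiff.comp_contDiffOn hf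
  exact ev.contDiff.comp_contDiffOn (h1.clm_apply h2)

/-- The wedge product of a covector and a `1`-form. -/
def covWedge (a : E →L[ℝ] ℝ) (b : E [⋀^Fin 1]→L[ℝ] ℝ) : E [⋀^Fin 2]→L[ℝ] ℝ :=
  .alternatizeUncurryFin (a.smulRight b)

lemma alternatizeUncurryFin_two_apply (f : E →L[ℝ] E [⋀^Fin 1]→L[ℝ] ℝ) (u w : E) :
    ContinuousAlternatingMap.alternatizeUncurryFin f ![u, w] = f u ![w] - f w ![u] := by
  rw [ContinuousAlternatingMap.alternatizeUncurryFin_apply, Fin.sum_univ_two, removeNth_zero_two,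
    removeNth_one_two]
  simp [sub_eq_add_neg]

lemma covWedge_apply (a : E →L[ℝ] ℝ) (b : E [⋀^Fin 1]→L[ℝ] ℝ) (u w : E) :
    covWedge a b ![u, w] = a u * b ![w] - a w * b ![u] := by
  simp [covWedge, alternatizeUncurryFin_two_apply]

lemma alternating_two_ext {σ τ : E [⋀^Fin 2]→L[ℝ] ℝ} (h : ∀ u w, σ ![u, w] = τ ![u, w]) :
    σ = τ := by
  ext v; rw [fin_two_vec v]; exact h _ _

lemma alternating_one_ext {σ τ : E [⋀^Fin 1]→L[ℝ] ℝ} (h : ∀ u, σ ![u] = τ ![u]) :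
    σ = τ := by
  ext v; rw [fin_one_vec v]; exact h _

/-- A covector viewed as a `1`-form. -/
def covForm : (E →L[ℝ] ℝ) →L[ℝ] E [⋀^Fin 1]→L[ℝ] ℝ :=
  ((ContinuousAlternatingMap.ofSubsingletonLIE (𝕜 := ℝ) (E := E) (F := ℝ) (0 : Fin 1)).toContinuousLinearEquiv :
    (E →L[ℝ] ℝ) →L[ℝ] E [⋀^Fin 1]→L[ℝ] ℝ)

lemma covForm_apply (a : E →L[ℝ] ℝ) (u : E) : covForm a ![u] = a u := rfl

/-- Contraction of a `2`-form with a vector. -/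
def contract (σ : E [⋀^Fin 2]→L[ℝ] ℝ) (Y : E) : E →L[ℝ] ℝ :=
  σ.toContinuousMultilinearMap.toContinuousLinearMap ![Y, 0] 1

lemma contract_apply (σ : E [⋀^Fin 2]→L[ℝ] ℝ) (Y w : E) : contract σ Y w = σ ![Y, w] := by
  simp only [contract]
  change σ (Function.update ![Y, 0] 1 w) = _
  congr 1
  ext i; fin_cases i <;> rfl

lemma alternating_two_swap (σ : E [⋀^Fin 2]→L[ℝ] ℝ) (u w : E) : σ ![u, w] = - σ ![w, u] := by
  have h : σ (![u, w] ∘ Equiv.swap 0 1) = -σ ![u, w] :=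
    σ.toAlternatingMap.map_swap ![u, w] (i := 0) (j := 1) (by decide)
  rw [← neg_eq_iff_eq_neg, ← h]
  congr 1
  ext i; fin_cases i <;> rfl

lemma alternating_two_self (σ : E [⋀^Fin 2]→L[ℝ] ℝ) (u : E) : σ ![u, u] = 0 :=
  σ.map_eq_zero_of_eq ![u, u] (i := 0) (j := 1) rfl (by decide)

lemma alternating_two_add_left (σ : E [⋀^Fin 2]→L[ℝ] ℝ) (u u' w : E) :
    σ ![u + u', w] = σ ![u, w] + σ ![u', w] := by
  rw [alternating_two_swap, ← contract_apply, map_add, contract_apply, contract_apply,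
    alternating_two_swap σ w u, alternating_two_swap σ w u']
  ring

lemma alternating_two_smul_left (σ : E [⋀^Fin 2]→L[ℝ] ℝ) (c : ℝ) (u w : E) :
    σ ![c • u, w] = c * σ ![u, w] := by
  rw [alternating_two_swap, ← contract_apply, map_smul, contract_apply,
    alternating_two_swap σ w u]
  simp

lemma alternating_two_add_right (σ : E [⋀^Fin 2]→L[ℝ] ℝ) (u w w' : E) :
    σ ![u, w + w'] = σ ![u, w] + σ ![u, w'] := by
  rw [← contract_apply, map_add, contract_apply, contract_apply]

lemma alternating_two_smul_right (σ : E [⋀^Fin 2]→L[ℝ] ℝ) (c : ℝ) (u w : E) :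
    σ ![u, c • w] = c * σ ![u, w] := by
  rw [← contract_apply, map_smul, contract_apply, smul_eq_mul]

lemma covWedge_add_right (a : E →L[ℝ] ℝ) (b c : E [⋀^Fin 1]→L[ℝ] ℝ) :
    covWedge a (b + c) = covWedge a b + covWedge a c :=
  alternating_two_ext fun u w => by simp [covWedge_apply]; ring

lemma covWedge_add_left (a a' : E →L[ℝ] ℝ) (b : E [⋀^Fin 1]→L[ℝ] ℝ) :
    covWedge (a + a') b = covWedge a b + covWedge a' b :=
  alternating_two_ext fun u w => by simp [covWedge_apply]; ring

lemma covWedge_smul_right (a : E →L[ℝ] ℝ) (r : ℝ) (b : E [⋀^Fin 1]→L[ℝ] ℝ) :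
    covWedge a (r • b) = r • covWedge a b :=
  alternating_two_ext fun u w => by simp [covWedge_apply]; ring

lemma covWedge_smul_left (a : E →L[ℝ] ℝ) (r : ℝ) (b : E [⋀^Fin 1]→L[ℝ] ℝ) :
    covWedge (r • a) b = r • covWedge a b :=
  alternating_two_ext fun u w => by simp [covWedge_apply]; ring

/-- `covWedge a` as a continuous linear map. -/
def covWedgeCLM (a : E →L[ℝ] ℝ) : (E [⋀^Fin 1]→L[ℝ] ℝ) →L[ℝ] E [⋀^Fin 2]→L[ℝ] ℝ :=
  (ContinuousAlternatingMap.alternatizeUncurryFinCLM ℝ E ℝ).comp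
    (ContinuousLinearMap.smulRightL ℝ E (E [⋀^Fin 1]→L[ℝ] ℝ) a)

lemma covWedgeCLM_apply (a : E →L[ℝ] ℝ) (b : E [⋀^Fin 1]→L[ℝ] ℝ) :
    covWedgeCLM a b = covWedge a b := rfl

/-- An explicit sum over shuffles, with chosen representatives of the cosets. The same
representatives occur for all forms and vectors, so naturality and polynomial dependence on the
forms can be read off term by term. -/
lemma wedge_apply {V : Type*} [AddCommGroup V] [Module ℝ V] {k l : ℕ}
    (α : V [⋀^Fin k]→ₗ[ℝ] ℝ) (β : V [⋀^Fin l]→ₗ[ℝ] ℝ) (v : Fin (k + l) → V) :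
    wedge α β v = ∑ q : Equiv.Perm.ModSumCongr (Fin k) (Fin l),
      ((Equiv.Perm.sign q.out : ℤˣ) : ℝ) *
        (α (fun i => v (finSumFinEquiv (q.out (.inl i)))) *
          β (fun i => v (finSumFinEquiv (q.out (.inr i))))) := by
  simp only [wedge, AlternatingMap.domDomCongr_apply, LinearMap.compAlternatingMap_apply,
    AlternatingMap.domCoprod_apply, sum_apply, map_sum]
  refine Finset.sum_congr rfl fun q _ => ?_
  conv_lhs => rw [← Quotient.out_eq' q]
  rw [AlternatingMap.domCoprod.summand_mk'']
  rcases Int.units_eq_one_or (Equiv.Perm.sign q.out) with h | h <;> rw [h] <;> simp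

lemma wedge_compLinearMap {V W : Type*} [AddCommGroup V] [Module ℝ V] [AddCommGroup W] [Module ℝ W]
    {k l : ℕ} (α : V [⋀^Fin k]→ₗ[ℝ] ℝ) (β : V [⋀^Fin l]→ₗ[ℝ] ℝ) (A : W →ₗ[ℝ] V) :
    wedge (α.compLinearMap A) (β.compLinearMap A) = (wedge α β).compLinearMap A := by
  ext v
  simp only [wedge_apply, AlternatingMap.compLinearMap_apply]

lemma wedgePow_compLinearMap {V W : Type*} [AddCommGroup V] [Module ℝ V] [AddCommGroup W]
    [Module ℝ W] (σ : V [⋀^Fin 2]→ₗ[ℝ] ℝ) (A : W →ₗ[ℝ] V) (n : ℕ) :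
    wedgePow (σ.compLinearMap A) n = (wedgePow σ n).compLinearMap A := by
  induction n with
  | zero => ext v; rfl
  | succ n ih => rw [wedgePow, ih, wedge_compLinearMap]; rfl

/-- By the shuffle formula, the value is a polynomial in the values of `σ`. -/
lemma contDiff_wedgePow_apply (n : ℕ) (v : Fin (2 * n) → E) :
    ContDiff ℝ ω (fun σ : E [⋀^Fin 2]→L[ℝ] ℝ => wedgePow σ.toAlternatingMap n v) := by
  induction n with
  | zero => exact contDiff_const
  | succ n ih =>
    have h : (fun σ : E [⋀^Fin 2]→L[ℝ] ℝ => wedgePow σ.toAlternatingMap (n + 1) v) = fun σ =>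
        ∑ q : Equiv.Perm.ModSumCongr (Fin (2 * n)) (Fin 2),
      ((Equiv.Perm.sign q.out : ℤˣ) : ℝ) *
        (wedgePow σ.toAlternatingMap n (fun i => v (finSumFinEquiv (q.out (.inl i)))) *
          σ (fun i => v (finSumFinEquiv (q.out (.inr i))))) := by
      funext σ
      exact wedge_apply (wedgePow σ.toAlternatingMap n) σ.toAlternatingMap v
    rw [h]
    refine ContDiff.sum fun q _ => contDiff_const.mul ((ih _).mul ?_)
    let ev : (E [⋀^Fin 2]→L[ℝ] ℝ) →L[ℝ] ℝ := ContinuousAlternatingMap.apply ℝ E ℝ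
      fun i => v (finSumFinEquiv (q.out (.inr i)))
    exact ev.contDiff

end Alternating

/-! ### The coefficient of `σⁿ/n!` and its first and second derivatives -/

section Pfaffian

variable {n : ℕ}

/-- The coefficient of `σⁿ/n!` with respect to the standard basis of `ℝ²ⁿ`. -/
def pf (σ : EuclideanSpace ℝ (Fin (2 * n)) [⋀^Fin 2]→L[ℝ] ℝ) : ℝ :=
  (n.factorial : ℝ)⁻¹ * wedgePow σ.toAlternatingMap n
    (fun i => EuclideanSpace.single i (1 : ℝ))

local notation "𝔼" => EuclideanSpace ℝ (Fin (2 * n))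

lemma contDiff_pf : ContDiff ℝ ω (pf (n := n)) :=
  contDiff_const.mul (contDiff_wedgePow_apply n _)

lemma topForm_comp {m : ℕ} (η : EuclideanSpace ℝ (Fin m) [⋀^Fin m]→ₗ[ℝ] ℝ)
    (A : EuclideanSpace ℝ (Fin m) →ₗ[ℝ] EuclideanSpace ℝ (Fin m)) :
    η (fun i => A (EuclideanSpace.single i (1 : ℝ))) =
      LinearMap.det A * η (fun i => EuclideanSpace.single i (1 : ℝ)) := by
  let e := (EuclideanSpace.basisFun (Fin m) ℝ).toBasis
  have he : (e : Fin m → EuclideanSpace ℝ (Fin m)) = fun i => EuclideanSpace.single i (1 : ℝ) := by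
    funext i; simp [e]
  have h := η.eq_smul_basis_det e
  have h2 := e.det_comp A e
  rw [e.det_self, mul_one] at h2
  rw [he] at h h2
  conv_lhs => rw [h]
  rw [AlternatingMap.smul_apply]
  have : (fun i => A (EuclideanSpace.single i (1 : ℝ))) =
    A ∘ fun i => EuclideanSpace.single i (1 : ℝ) := rfl
  rw [this, h2, smul_eq_mul, mul_comm]

/-- The formulas below for the derivatives of `pf` are all extracted from this naturality, applied
to suitable `A`, together with the smoothness of `pf`; no algebra of wedge products in higher degree
is needed. -/
lemma pf_comp (σ : 𝔼 [⋀^Fin 2]→L[ℝ] ℝ) (A : 𝔼 →L[ℝ] 𝔼) :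
    pf (σ.compContinuousLinearMap A) = A.det * pf σ := by
  have h : (σ.compContinuousLinearMap A).toAlternatingMap =
    σ.toAlternatingMap.compLinearMap (A : 𝔼 →ₗ[ℝ] 𝔼) := rfl
  rw [pf, h, wedgePow_compLinearMap, AlternatingMap.compLinearMap_apply, topForm_comp, pf]
  simp only [ContinuousLinearMap.det]
  ring

/-- The derivative at `σ` in the direction `τ` stands for the coefficient of `τ ∧ σⁿ⁻¹/(n-1)!`, so
it too transforms as a top form. Both sides come from differentiating `pf_comp` in `σ`. -/
lemma fderiv_pf_comp (σ τ : 𝔼 [⋀^Fin 2]→L[ℝ] ℝ) (A : 𝔼 →L[ℝ] 𝔼) :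
    fderiv ℝ pf (σ.compContinuousLinearMap A) (τ.compContinuousLinearMap A) =
      A.det * fderiv ℝ pf σ τ := by
  have hd := (contDiff_pf (n := n)).differentiable (by simp)
  let L := ContinuousAlternatingMap.compContinuousLinearMapCLM (ι := Fin 2) (F := ℝ) (𝕜 := ℝ) A
  have h1 : HasFDerivAt (fun ς => pf (L ς)) ((fderiv ℝ pf (L σ)).comp L) σ :=
    (hd (L σ)).hasFDerivAt.comp σ L.hasFDerivAt
  have h2 : HasFDerivAt (fun ς => A.det * pf ς) (A.det • fderiv ℝ pf σ) σ :=
    (hd σ).hasFDerivAt.const_mul A.det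
  have h3 : (fun ς => pf (L ς)) = fun ς => A.det * pf ς := funext fun ς => pf_comp ς A
  rw [h3] at h1
  exact congrArg (fun T => T τ) (h1.unique h2)

/-- The pullback of `σ` under `1 + s Y ⊗ b`. -/
lemma comp_one_add_smulRight {E : Type*} [NormedAddCommGroup E] [NormedSpace ℝ E]
    (σ : E [⋀^Fin 2]→L[ℝ] ℝ) (b : E →L[ℝ] ℝ) (Y : E) (s : ℝ) :
    σ.compContinuousLinearMap (ContinuousLinearMap.id ℝ E + s • b.smulRight Y) =
      σ + s • covWedge b (covForm (contract σ Y)) := by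
  refine alternating_two_ext fun u w => ?_
  have h : (σ.compContinuousLinearMap (ContinuousLinearMap.id ℝ E + s • b.smulRight Y)) ![u, w] =
      σ ![u + (s * b u) • Y, w + (s * b w) • Y] := by
    rw [ContinuousAlternatingMap.compContinuousLinearMap_apply]
    congr 1
    ext i; fin_cases i <;> simp [smul_smul]
  rw [h]
  simp only [alternating_two_add_left, alternating_two_add_right, alternating_two_smul_left,
    alternating_two_smul_right, alternating_two_self, ContinuousAlternatingMap.add_apply,
    ContinuousAlternatingMap.smul_apply, covWedge_apply, covForm_apply, contract_apply,
    smul_eq_mul, alternating_two_swap σ u Y]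
  ring

lemma det_one_add_smulRight (b : 𝔼 →L[ℝ] ℝ) (Y : 𝔼) (s : ℝ) :
    (ContinuousLinearMap.id ℝ 𝔼 + s • b.smulRight Y).det = 1 + s * b Y := by
  have h := LinearMap.transvection.det (s • (b : 𝔼 →ₗ[ℝ] ℝ)) Y
  simp only [ContinuousLinearMap.det]
  have e : ((ContinuousLinearMap.id ℝ 𝔼 + s • b.smulRight Y : 𝔼 →L[ℝ] 𝔼) : 𝔼 →ₗ[ℝ] 𝔼) =
      LinearMap.transvection (s • (b : 𝔼 →ₗ[ℝ] ℝ)) Y := by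
    ext x; simp [LinearMap.transvection, mul_assoc]
  rw [e, h]; rfl

lemma pf_add_covWedge_contract (σ : 𝔼 [⋀^Fin 2]→L[ℝ] ℝ) (b : 𝔼 →L[ℝ] ℝ) (Y : 𝔼) (s : ℝ) :
    pf (σ + s • covWedge b (covForm (contract σ Y))) = (1 + s * b Y) * pf σ := by
  rw [← comp_one_add_smulRight, pf_comp, det_one_add_smulRight]

/-- This is `b ∧ ι(Y)σ ∧ σⁿ⁻¹/(n-1)! = b ∧ ι(Y)(σⁿ/n!) = b(Y) σⁿ/n!`. It is obtained by
differentiating the pullback of `σ` under `1 + s Y ⊗ b`, whose determinant is `1 + s b(Y)`. -/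
lemma fderiv_pf_covWedge_contract (σ : 𝔼 [⋀^Fin 2]→L[ℝ] ℝ) (b : 𝔼 →L[ℝ] ℝ) (Y : 𝔼) :
    fderiv ℝ pf σ (covWedge b (covForm (contract σ Y))) = b Y * pf σ := by
  have hd := (contDiff_pf (n := n)).differentiable (by simp) σ
  have h1 := hd.hasFDerivAt.hasLineDerivAt (covWedge b (covForm (contract σ Y)))
  have h2 : HasLineDerivAt ℝ pf (b Y * pf σ) σ (covWedge b (covForm (contract σ Y))) := by
    rw [HasLineDerivAt]
    simp only [pf_add_covWedge_contract]
    have := (((hasDerivAt_id (0 : ℝ)).mul_const (b Y)).const_add 1).mul_const (pf σ)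
    simpa using this
  exact h1.unique h2

/-- Homogeneity makes `f` equal to its own directional derivative at the origin, and
differentiability makes that linear. -/
lemma eq_fderiv_of_homogeneous {W : Type*} [NormedAddCommGroup W] [NormedSpace ℝ W] {f : W → ℝ}
    (hf : DifferentiableAt ℝ f 0) (h : ∀ (s : ℝ) w, f (s • w) = s * f w) (w : W) :
    f w = fderiv ℝ f 0 w := by
  have h1 := hf.hasFDerivAt.hasLineDerivAt w
  have h2 : HasLineDerivAt ℝ f (f w) 0 w := by
    rw [HasLineDerivAt]
    simp only [zero_add, h]
    simpa using (hasDerivAt_id (0 : ℝ)).mul_const (f w)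
  exact h2.unique h1

/-- Because `(b ∧ c) ∧ (b ∧ c') = 0`, the polynomial `pf` has degree at most one along the subspace
`b ∧ ·`. -/
lemma exists_pf_add_covWedge (σ : 𝔼 [⋀^Fin 2]→L[ℝ] ℝ) (b : 𝔼 →L[ℝ] ℝ) :
    ∃ l : (𝔼 [⋀^Fin 1]→L[ℝ] ℝ) →L[ℝ] ℝ, ∀ c, pf (σ + covWedge b c) = pf σ + l c := by
  by_cases hb : b = 0
  · refine ⟨0, fun c => ?_⟩
    have : covWedge b c = 0 := alternating_two_ext fun u w => by simp [covWedge_apply, hb]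
    simp [this]
  obtain ⟨Y, hY⟩ : ∃ Y, b Y = 1 := by
    obtain ⟨Y, hY⟩ : ∃ Y, b Y ≠ 0 := by
      by_contra! h
      exact hb (ContinuousLinearMap.ext h)
    exact ⟨(b Y)⁻¹ • Y, by simp [hY]⟩
  -- Removing the component of `σ` along `b` gives `ι(Y)σ' = 0`. On the translate of the subspace `b
  -- ∧ ·` based at `σ'` the function `pf` is then homogeneous of degree one.
  set σ' := σ - covWedge b (covForm (contract σ Y)) with hσ'
  have hY' : contract σ' Y = 0 := by
    ext w
    simp [contract_apply, hσ', covWedge_apply, covForm_apply, hY, alternating_two_self]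
  let f : (𝔼 [⋀^Fin 1]→L[ℝ] ℝ) → ℝ := fun c => pf (σ' + covWedge b c)
  have hf : ContDiff ℝ ω f :=
    contDiff_pf.comp (contDiff_const.add (covWedgeCLM b).contDiff)
  have hfh : ∀ (s : ℝ) c, f (s • c) = s * f c := by
    intro s c
    have key : contract (σ' + covWedge b c) Y = contract (covWedge b c) Y := by
      ext w
      have := congrArg (fun T => T w) hY'
      simp only [contract_apply, zero_apply] at this
      simp [contract_apply, this]
    -- Contracting `σ' + b ∧ c` with `Y` and wedging with `b` returns `b ∧ c`. The factor `s - 1`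
    -- turns this into scaling `c` by `s`, with determinant `1 + (s - 1) = s`.
    have h := pf_add_covWedge_contract (σ' + covWedge b c) b Y (s - 1)
    have h3 : covWedge b (covForm (contract (covWedge b c) Y)) = covWedge b c :=
      alternating_two_ext fun u w => by
        simp only [covWedge_apply, covForm_apply, contract_apply, hY]; ring
    rw [key, h3, hY, add_assoc] at h
    have h4 : covWedge b c + (s - 1) • covWedge b c = covWedge b (s • c) := by
      rw [covWedge_smul_right]; module
    rw [h4] at h
    simp only [f, h]; ring
  have hlin := eq_fderiv_of_homogeneous (hf.differentiable (by simp) 0) hfh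
  refine ⟨fderiv ℝ f 0, fun c => ?_⟩
  have e1 : pf (σ + covWedge b c) = f (covForm (contract σ Y) + c) := by
    simp only [f, covWedge_add_right, hσ']; congr 1; abel
  have e2 : pf σ = f (covForm (contract σ Y)) := by
    simp only [f, hσ', sub_add_cancel]
  rw [e1, e2, hlin, hlin (covForm _), map_add]

/-- Along `b ∧ ·` the function `pf` is affine, so its derivative in such a direction is constant
along such a line. -/
lemma fderiv_fderiv_pf_covWedge_same (σ : 𝔼 [⋀^Fin 2]→L[ℝ] ℝ) (b : 𝔼 →L[ℝ] ℝ)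
    (c e : 𝔼 [⋀^Fin 1]→L[ℝ] ℝ) :
    fderiv ℝ (fderiv ℝ pf) σ (covWedge b c) (covWedge b e) = 0 := by
  have hd := (contDiff_pf (n := n)).differentiable (by simp)
  have hd2 : Differentiable ℝ (fderiv ℝ (pf (n := n))) :=
    ((contDiff_pf (n := n)).fderiv_right (m := ω) (by simp)).differentiable (by simp)
  have hconst : ∀ s : ℝ, fderiv ℝ pf (σ + s • covWedge b c) (covWedge b e) =
      fderiv ℝ pf σ (covWedge b e) := by
    intro s
    obtain ⟨l, hl⟩ := exists_pf_add_covWedge σ b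
    have h : ∀ s : ℝ, HasLineDerivAt ℝ pf (l e) (σ + s • covWedge b c) (covWedge b e) := by
      intro s
      rw [HasLineDerivAt]
      have : (fun t : ℝ => pf (σ + s • covWedge b c + t • covWedge b e)) =
          fun t => pf σ + (s * l c + t * l e) := by
        funext t
        rw [add_assoc, ← covWedge_smul_right, ← covWedge_smul_right, ← covWedge_add_right, hl]
        simp
      rw [this]
      simpa using (((hasDerivAt_id (0 : ℝ)).mul_const (l e)).const_add (s * l c)).const_add (pf σ)
    have e1 := ((hd (σ + s • covWedge b c)).hasFDerivAt.hasLineDerivAt (covWedge b e)).unique (h s)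
    have e2 := ((hd (σ + (0 : ℝ) • covWedge b c)).hasFDerivAt.hasLineDerivAt
      (covWedge b e)).unique (h 0)
    rw [zero_smul, add_zero] at e2
    rw [e1, e2]
  have h1 := ((hd2 σ).hasFDerivAt.clm_apply (hasFDerivAt_const (covWedge b e) σ)).hasLineDerivAt
    (covWedge b c)
  have h2 : HasLineDerivAt ℝ (fun ς => fderiv ℝ pf ς (covWedge b e)) 0 σ (covWedge b c) := by
    rw [HasLineDerivAt]
    simp only [hconst]
    exact hasDerivAt_const _ _
  simpa using h1.unique h2

end Pfaffian

/-! ### Stokes' theorem for `b ∧ sⁿ⁻¹` on open subsets of `ℝ²ⁿ` -/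

section ChartStokes

variable {m n : ℕ}

/-- Integration by parts against the constant function `1`. -/
lemma integral_fderiv_apply_eq_zero {g : EuclideanSpace ℝ (Fin m) → ℝ} (hg : ContDiff ℝ 1 g)
    (hc : HasCompactSupport g) (e : EuclideanSpace ℝ (Fin m)) : ∫ y, fderiv ℝ g y e = 0 := by
  have hd := hg.differentiable one_ne_zero
  have h1 : Continuous fun y => fderiv ℝ g y e :=
    (hg.continuous_fderiv one_ne_zero).clm_apply continuous_const
  have h2 : HasCompactSupport fun y => fderiv ℝ g y e := by
    refine (hc.fderiv (𝕜 := ℝ)).mono fun y hy => ?_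
    contrapose! hy
    simp only [Function.mem_support, not_not] at hy ⊢
    rw [hy]; rfl
  have h := integral_mul_fderiv_eq_neg_fderiv_mul_of_integrable (𝕜 := ℝ) (μ := volume) (v := e)
    (f := fun _ : EuclideanSpace ℝ (Fin m) => (1 : ℝ)) (g := g) (by simp)
    (by simpa using h1.integrable_of_hasCompactSupport h2)
    (by simpa using hg.continuous.integrable_of_hasCompactSupport hc)
    (fun _ _ => differentiableAt_const _) (fun y _ => hd y)
  simpa using h

lemma euclideanProj_apply (i : Fin m) (u : EuclideanSpace ℝ (Fin m)) :
    (EuclideanSpace.proj i : EuclideanSpace ℝ (Fin m) →L[ℝ] ℝ) u = u i := rfl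

lemma sum_coord_smul (u : EuclideanSpace ℝ (Fin m)) :
    ∑ i, u i • EuclideanSpace.single i (1 : ℝ) = u := by
  have := (EuclideanSpace.basisFun (Fin m) ℝ).sum_repr u
  simpa using this

lemma alternatizeUncurryFin_eq_sum_covWedge
    (f : EuclideanSpace ℝ (Fin m) →L[ℝ] EuclideanSpace ℝ (Fin m) [⋀^Fin 1]→L[ℝ] ℝ) :
    ContinuousAlternatingMap.alternatizeUncurryFin f =
      ∑ i, covWedge (EuclideanSpace.proj i) (f (EuclideanSpace.single i (1 : ℝ))) := by
  have h : ∀ u w, f u ![w] = ∑ i, u i * f (EuclideanSpace.single i (1 : ℝ)) ![w] := by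
    intro u w
    conv_lhs => rw [← sum_coord_smul u]
    simp only [map_sum, map_smul, ContinuousAlternatingMap.sum_apply,
      ContinuousAlternatingMap.smul_apply, smul_eq_mul]
  refine alternating_two_ext fun u w => ?_
  rw [alternatizeUncurryFin_two_apply, ContinuousAlternatingMap.sum_apply, h u w, h w u]
  simp only [covWedge_apply, euclideanProj_apply, Finset.sum_sub_distrib]

lemma alternatizeUncurryFin_three_apply {E : Type*} [NormedAddCommGroup E] [NormedSpace ℝ E]
    (f : E →L[ℝ] E [⋀^Fin 2]→L[ℝ] ℝ) (u w z : E) :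
    ContinuousAlternatingMap.alternatizeUncurryFin f ![u, w, z] =
      f u ![w, z] - f w ![u, z] + f z ![u, w] := by
  have e0 : (0 : Fin 3).removeNth ![u, w, z] = ![w, z] := by ext i; fin_cases i <;> rfl
  have e1 : (1 : Fin 3).removeNth ![u, w, z] = ![u, z] := by ext i; fin_cases i <;> rfl
  have e2 : (2 : Fin 3).removeNth ![u, w, z] = ![u, w] := by ext i; fin_cases i <;> rfl
  rw [ContinuousAlternatingMap.alternatizeUncurryFin_apply, Fin.sum_univ_three, e0, e1, e2]
  simp [sub_eq_add_neg]

lemma alternating_two_eq_sum (σ : EuclideanSpace ℝ (Fin m) [⋀^Fin 2]→L[ℝ] ℝ) :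
    σ = ∑ k, ∑ l, ((2 : ℝ)⁻¹ * σ ![EuclideanSpace.single k (1 : ℝ), EuclideanSpace.single l 1]) •
      covWedge (EuclideanSpace.proj k) (covForm (EuclideanSpace.proj l)) := by
  have hexp : ∀ u w, σ ![u, w] = ∑ k, ∑ l, σ ![EuclideanSpace.single k (1 : ℝ),
      EuclideanSpace.single l 1] * (u k * w l) := by
    intro u w
    conv_lhs => rw [← sum_coord_smul u]
    have h1 : ∀ w', σ ![∑ k, u k • EuclideanSpace.single k (1 : ℝ), w'] =
        ∑ k, u k * σ ![EuclideanSpace.single k (1 : ℝ), w'] := by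
      intro w'
      rw [alternating_two_swap, ← contract_apply, map_sum, ← Finset.sum_neg_distrib]
      refine Finset.sum_congr rfl fun k _ => ?_
      rw [map_smul, contract_apply, alternating_two_swap σ w']; simp
    rw [h1]
    refine Finset.sum_congr rfl fun k _ => ?_
    conv_lhs => rw [← sum_coord_smul w]
    rw [← contract_apply, map_sum, Finset.mul_sum]
    refine Finset.sum_congr rfl fun l _ => ?_
    rw [map_smul, contract_apply, smul_eq_mul]; ring
  refine alternating_two_ext fun u w => ?_
  have h2 := hexp u w
  have h3 : σ ![u, w] = - σ ![w, u] := alternating_two_swap σ u w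
  rw [hexp w u] at h3
  -- The sum runs over all pairs of indices instead of increasing ones. One half of `σ(u, w)` is
  -- expanded as it stands, the other half as `-σ(w, u)`.
  have h4 : σ ![u, w] = (2 : ℝ)⁻¹ * σ ![u, w] + (2 : ℝ)⁻¹ * σ ![u, w] := by ring
  rw [h4]
  nth_rewrite 1 [h2]
  rw [h3]
  simp only [ContinuousAlternatingMap.sum_apply, ContinuousAlternatingMap.smul_apply,
    covWedge_apply, covForm_apply, euclideanProj_apply, smul_eq_mul, Finset.mul_sum,
    ← Finset.sum_neg_distrib, ← Finset.sum_add_distrib]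
  refine Finset.sum_congr rfl fun k _ => Finset.sum_congr rfl fun l _ => ?_
  ring

lemma sum_cyclic_eq_zero {ι : Type*} [Fintype ι] (t r : ι → ι → ι → ℝ)
    (ht : ∀ i k l, t i k l + t k l i + t l i k = 0) (hr : ∀ i k l, r i k l = r k l i) :
    ∑ i, ∑ k, ∑ l, t i k l * r i k l = 0 := by
  have h1 : ∑ i, ∑ k, ∑ l, t i k l * r i k l = ∑ i, ∑ k, ∑ l, t k l i * r i k l := by
    calc ∑ i, ∑ k, ∑ l, t i k l * r i k l = ∑ k, ∑ l, ∑ i, t k l i * r k l i := rfl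
      _ = ∑ k, ∑ i, ∑ l, t k l i * r k l i := by
        refine Finset.sum_congr rfl fun k _ => Finset.sum_comm
      _ = ∑ i, ∑ k, ∑ l, t k l i * r k l i := Finset.sum_comm
      _ = _ := by simp only [← hr]
  have h2 : ∑ i, ∑ k, ∑ l, t k l i * r i k l = ∑ i, ∑ k, ∑ l, t l i k * r i k l := by
    calc ∑ i, ∑ k, ∑ l, t k l i * r i k l = ∑ k, ∑ l, ∑ i, t l i k * r k l i := rfl
      _ = ∑ k, ∑ i, ∑ l, t l i k * r k l i := by
        refine Finset.sum_congr rfl fun k _ => Finset.sum_comm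
      _ = ∑ i, ∑ k, ∑ l, t l i k * r k l i := Finset.sum_comm
      _ = _ := by simp only [← hr]
  have h3 : ∑ i, ∑ k, ∑ l, t i k l * r i k l + ∑ i, ∑ k, ∑ l, t k l i * r i k l +
      ∑ i, ∑ k, ∑ l, t l i k * r i k l = 0 := by
    simp only [← Finset.sum_add_distrib, ← add_mul, ht, zero_mul, Finset.sum_const_zero]
  linarith

local notation "𝔼" => EuclideanSpace ℝ (Fin (2 * n))

/-- With `T` the derivative of a closed form `s`, this says that `d(sⁿ⁻¹) = 0`. The second
derivative of `pf` on `a ∧ c` and `e ∧ b` is alternating in `a, c, e`, while closedness makes the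
cyclic sum of the components of `T` vanish. -/
lemma sum_fderiv_fderiv_pf_eq_zero (σ : 𝔼 [⋀^Fin 2]→L[ℝ] ℝ) (T : 𝔼 →L[ℝ] 𝔼 [⋀^Fin 2]→L[ℝ] ℝ)
    (hT : ContinuousAlternatingMap.alternatizeUncurryFin T = 0) (b : 𝔼 [⋀^Fin 1]→L[ℝ] ℝ) :
    ∑ i, fderiv ℝ (fderiv ℝ pf) σ (T (EuclideanSpace.single i 1))
      (covWedge (EuclideanSpace.proj i) b) = 0 := by
  set Q := fderiv ℝ (fderiv ℝ (pf (n := n))) σ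
  let R : (𝔼 →L[ℝ] ℝ) → (𝔼 →L[ℝ] ℝ) → (𝔼 →L[ℝ] ℝ) → ℝ := fun a c e =>
    Q (covWedge a (covForm c)) (covWedge e b)
  have hanti : ∀ a c : 𝔼 →L[ℝ] ℝ, covWedge a (covForm c) = - covWedge c (covForm a) :=
    fun a c => alternating_two_ext fun u w => by
      simp only [covWedge_apply, covForm_apply, ContinuousAlternatingMap.neg_apply]; ring
  have hR1 : ∀ a c e, R a c e = - R c a e := fun a c e => by
    simp only [R]; rw [hanti a c, map_neg]; rfl
  have hR0 : ∀ a c, R a c c = 0 := fun a c => by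
    rw [hR1]; simp only [R, Q, fderiv_fderiv_pf_covWedge_same, neg_zero]
  -- Polarization of `R a c c = 0`. The two antisymmetries together give cyclic invariance.
  have hR2 : ∀ a c e, R a c e = - R a e c := fun a c e => by
    have h := hR0 a (c + e)
    have h' : R a (c + e) (c + e) = R a c c + R a c e + R a e c + R a e e := by
      simp only [R, map_add, covWedge_add_right, covWedge_add_left, add_apply]
      ring
    rw [h', hR0, hR0] at h
    linarith
  have hcyc : ∀ a c e, R a c e = R c e a := fun a c e => by
    rw [hR1 a c e, hR2 c a e, neg_neg]
  have hexp : ∀ i, Q (T (EuclideanSpace.single i 1)) (covWedge (EuclideanSpace.proj i) b) =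
      ∑ k, ∑ l, ((2 : ℝ)⁻¹ * T (EuclideanSpace.single i 1)
        ![EuclideanSpace.single k (1 : ℝ), EuclideanSpace.single l 1]) *
        R (EuclideanSpace.proj k) (EuclideanSpace.proj l) (EuclideanSpace.proj i) := by
    intro i
    conv_lhs => rw [alternating_two_eq_sum (T (EuclideanSpace.single i 1))]
    simp only [map_sum, map_smul, sum_apply, smul_apply, smul_eq_mul, R]
  simp only [hexp]
  refine sum_cyclic_eq_zero (fun i k l => (2 : ℝ)⁻¹ * T (EuclideanSpace.single i 1)
        ![EuclideanSpace.single k (1 : ℝ), EuclideanSpace.single l 1])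
    (fun i k l => R (EuclideanSpace.proj k) (EuclideanSpace.proj l) (EuclideanSpace.proj i))
    (fun i k l => ?_) (fun i k l => hcyc _ _ _)
  have h := congrArg (fun τ => τ ![EuclideanSpace.single i (1 : ℝ), EuclideanSpace.single k 1,
    EuclideanSpace.single l 1]) hT
  simp only [alternatizeUncurryFin_three_apply] at h
  have h2 := alternating_two_swap (T (EuclideanSpace.single k 1)) (EuclideanSpace.single l 1)
    (EuclideanSpace.single i 1)
  have h0 : (0 : 𝔼 [⋀^Fin 3]→L[ℝ] ℝ) ![EuclideanSpace.single i (1 : ℝ),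
    EuclideanSpace.single k 1, EuclideanSpace.single l 1] = 0 := rfl
  rw [h0] at h
  rw [h2]
  linear_combination (2 : ℝ)⁻¹ * h

/-- The left side is the divergence of the vector field that represents `b ∧ sⁿ⁻¹/(n-1)!`. By the
product rule the derivatives that fall on `s` cancel since `s` is closed, and those that fall on `b`
assemble to `db`. -/
lemma sum_fderiv_coord_eq {s : 𝔼 → 𝔼 [⋀^Fin 2]→L[ℝ] ℝ} {b : 𝔼 → 𝔼 [⋀^Fin 1]→L[ℝ] ℝ} {y : 𝔼}
    (hs : DifferentiableAt ℝ s y) (hb : DifferentiableAt ℝ b y) (hd : extDeriv s y = 0) :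
    ∑ i, fderiv ℝ (fun z => fderiv ℝ pf (s z) (covWedge (EuclideanSpace.proj i) (b z))) y
      (EuclideanSpace.single i 1) = fderiv ℝ pf (s y) (extDeriv b y) := by
  have hd2 : Differentiable ℝ (fderiv ℝ (pf (n := n))) :=
    ((contDiff_pf (n := n)).fderiv_right (m := ω) (by simp)).differentiable (by simp)
  have h : ∀ i, fderiv ℝ (fun z => fderiv ℝ pf (s z)
      (covWedge (EuclideanSpace.proj i) (b z))) y (EuclideanSpace.single i 1) =
      fderiv ℝ (fderiv ℝ pf) (s y) (fderiv ℝ s y (EuclideanSpace.single i 1))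
        (covWedge (EuclideanSpace.proj i) (b y)) +
      fderiv ℝ pf (s y) (covWedge (EuclideanSpace.proj i)
        (fderiv ℝ b y (EuclideanSpace.single i 1))) := by
    intro i
    have h1 : HasFDerivAt (fun z => fderiv ℝ pf (s z))
      ((fderiv ℝ (fderiv ℝ pf) (s y)).comp (fderiv ℝ s y)) y :=
      HasFDerivAt.comp (g := fderiv ℝ pf) y (hd2 (s y)).hasFDerivAt hs.hasFDerivAt
    have h2 : HasFDerivAt (fun z => covWedge (EuclideanSpace.proj i) (b z))
      ((covWedgeCLM (EuclideanSpace.proj i)).comp (fderiv ℝ b y)) y :=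
      (covWedgeCLM (EuclideanSpace.proj i)).hasFDerivAt.comp y hb.hasFDerivAt
    rw [(h1.clm_apply h2).fderiv]
    simp [covWedgeCLM_apply, add_comm]
  simp only [h, Finset.sum_add_distrib]
  rw [sum_fderiv_fderiv_pf_eq_zero _ _ hd, zero_add, ← map_sum,
    ← alternatizeUncurryFin_eq_sum_covWedge]
  rfl

lemma contDiff_of_contDiffOn_of_eq_zero {X : Type*} [NormedAddCommGroup X] [NormedSpace ℝ X]
    {r : WithTop ℕ∞} {g : X → ℝ} {V K : Set X} (hV : IsOpen V) (hK : IsClosed K) (hKV : K ⊆ V)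
    (hg : ContDiffOn ℝ r g V) (h0 : ∀ y ∉ K, g y = 0) : ContDiff ℝ r g := by
  rw [contDiff_iff_contDiffAt]
  intro y
  by_cases hy : y ∈ V
  · exact hg.contDiffAt (hV.mem_nhds hy)
  · refine (contDiffAt_const (c := (0 : ℝ))).congr_of_eventuallyEq ?_
    filter_upwards [hK.isOpen_compl.mem_nhds fun h => hy (hKV h)] with z hz using h0 z hz

/-- Stokes' theorem for `d(b ∧ sⁿ⁻¹)` with `s` closed and `b` compactly supported. -/
lemma setIntegral_fderiv_pf_extDeriv {V K : Set 𝔼} (hV : IsOpen V) (hK : IsCompact K)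
    (hKV : K ⊆ V) {s : 𝔼 → 𝔼 [⋀^Fin 2]→L[ℝ] ℝ} {b : 𝔼 → 𝔼 [⋀^Fin 1]→L[ℝ] ℝ}
    (hs : ContDiffOn ℝ ∞ s V) (hsd : ∀ y ∈ V, extDeriv s y = 0)
    (hb : ContDiffOn ℝ ∞ b V) (hbK : ∀ y ∈ V, y ∉ K → b y = 0) :
    ∫ y in V, fderiv ℝ pf (s y) (extDeriv b y) = 0 := by
  -- The components of that vector field, extended by zero from `V`. They are smooth everywhere
  -- because they vanish off the compact set `K ⊆ V`.
  let W : Fin (2 * n) → 𝔼 → ℝ := fun i =>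
    V.indicator fun z => fderiv ℝ pf (s z) (covWedge (EuclideanSpace.proj i) (b z))
  have hWK : ∀ i, ∀ y ∉ K, W i y = 0 := by
    intro i y hy
    by_cases h : y ∈ V
    · simp only [W, indicator_of_mem h]
      rw [hbK y h hy]
      have : covWedge (EuclideanSpace.proj i : 𝔼 →L[ℝ] ℝ) 0 = 0 :=
        alternating_two_ext fun u w => by simp [covWedge_apply]
      rw [this, map_zero]
    · simp only [W, indicator_of_notMem h]
  have hpf : ContDiff ℝ ∞ (fderiv ℝ (pf (n := n))) :=
    (contDiff_pf (n := n)).fderiv_right (m := ∞) (by simp)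
  have hW : ∀ i, ContDiff ℝ 1 (W i) := by
    intro i
    refine contDiff_of_contDiffOn_of_eq_zero hV hK.isClosed hKV ?_ (hWK i)
    have h1 : ContDiffOn ℝ 1
        (fun z => fderiv ℝ pf (s z) (covWedge (EuclideanSpace.proj i) (b z))) V :=
      ((hpf.comp_contDiffOn hs).clm_apply
        ((covWedgeCLM (EuclideanSpace.proj i)).contDiff.comp_contDiffOn hb)).of_le (by simp)
    exact h1.congr fun y hy => by simp [W, hy]
  have hWc : ∀ i, HasCompactSupport (W i) := fun i =>
    HasCompactSupport.intro hK fun y hy => hWK i y hy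
  have hWi : ∀ i, Integrable fun y => fderiv ℝ (W i) y (EuclideanSpace.single i 1) := by
    intro i
    refine Continuous.integrable_of_hasCompactSupport
      (((hW i).continuous_fderiv one_ne_zero).clm_apply continuous_const) ?_
    refine ((hWc i).fderiv (𝕜 := ℝ)).mono fun y hy => ?_
    contrapose! hy
    simp only [Function.mem_support, not_not] at hy ⊢
    rw [hy]; rfl
  have hV1 : ∀ y ∈ V, fderiv ℝ pf (s y) (extDeriv b y) =
      ∑ i, fderiv ℝ (W i) y (EuclideanSpace.single i 1) := by
    intro y hy
    rw [← sum_fderiv_coord_eq ((hs.contDiffAt (hV.mem_nhds hy)).differentiableAt (by simp))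
      ((hb.contDiffAt (hV.mem_nhds hy)).differentiableAt (by simp)) (hsd y hy)]
    refine Finset.sum_congr rfl fun i _ => ?_
    congr 1
    refine Filter.EventuallyEq.fderiv_eq ?_
    filter_upwards [hV.mem_nhds hy] with z hz
    simp [W, hz]
  rw [setIntegral_congr_fun hV.measurableSet hV1,
    setIntegral_eq_integral_of_forall_compl_eq_zero, integral_finsetSum _ fun i _ => hWi i]
  · exact Finset.sum_eq_zero fun i _ => integral_fderiv_apply_eq_zero (hW i) (hWc i) _
  · intro y hy
    refine Finset.sum_eq_zero fun i _ => ?_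
    have : W i =ᶠ[𝓝 y] fun _ => 0 := by
      filter_upwards [hK.isClosed.isOpen_compl.mem_nhds fun h => hy (hKV h)] with z hz
        using hWK i z hz
    rw [this.fderiv_eq]; simp

end ChartStokes

/-! ### Differentiation under the integral sign over a compact parameter space -/

section Parametric

variable {X : Type*} [TopologicalSpace X] {P F H : Type} [NormedAddCommGroup P] [NormedSpace ℝ P]
  [NormedAddCommGroup F] [NormedSpace ℝ F] [NormedAddCommGroup H] [NormedSpace ℝ H]

/-- Near each point of `C ×ˢ V`, the function `Θ` is a smooth function of the second variable and
of a continuous function, with values in `P`, of the first one. -/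
def IsSmoothFamily (P : Type) [NormedAddCommGroup P] [NormedSpace ℝ P] (C : Set X) (V : Set F)
    (Θ : X → F → H) : Prop :=
  ∀ x₀ ∈ C, ∀ y₀ ∈ V, ∃ (c : X → P) (T : P × F → H) (O : Set (P × F)), ContinuousAt c x₀ ∧
    IsOpen O ∧ (c x₀, y₀) ∈ O ∧ ContDiffOn ℝ ∞ T O ∧
    ∀ᶠ q : X × F in 𝓝 (x₀, y₀), Θ q.1 q.2 = T (c q.1, q.2)

lemma IsSmoothFamily.of_contDiffOn {C : Set P} {V : Set F} {O : Set (P × F)} (hO : IsOpen O)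
    (hCV : C ×ˢ V ⊆ O) {Θ : P → F → H} (hΘ : ContDiffOn ℝ ∞ (fun q : P × F => Θ q.1 q.2) O) :
    IsSmoothFamily P C V Θ := fun _ hx _ hy =>
  ⟨id, fun q => Θ q.1 q.2, O, continuousAt_id, hO, hCV ⟨hx, hy⟩, hΘ, Filter.Eventually.of_forall
    fun _ => rfl⟩

lemma IsSmoothFamily.exists_hasFDerivAt {C : Set X} {V : Set F} {Θ : X → F → H}
    (h : IsSmoothFamily P C V Θ) {x₀ : X} (hx : x₀ ∈ C) {y₀ : F} (hy : y₀ ∈ V) :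
    ∃ (c : X → P) (T : P × F → H) (O : Set (P × F)), ContinuousAt c x₀ ∧
    IsOpen O ∧ (c x₀, y₀) ∈ O ∧ ContDiffOn ℝ ∞ T O ∧
    ∀ᶠ q : X × F in 𝓝 (x₀, y₀), Θ q.1 q.2 = T (c q.1, q.2) ∧
      HasFDerivAt (Θ q.1) ((fderiv ℝ T (c q.1, q.2)).comp (ContinuousLinearMap.inr ℝ P F)) q.2 := by
  obtain ⟨c, T, O, hc, hO, hm, hT, hΘ⟩ := h x₀ hx y₀ hy
  refine ⟨c, T, O, hc, hO, hm, hT, ?_⟩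
  have hc' : ContinuousAt (fun q : X × F => (c q.1, q.2)) (x₀, y₀) :=
    (hc.comp (x := (x₀, y₀)) continuousAt_fst).prodMk continuousAt_snd
  filter_upwards [hΘ.eventually_nhds, hc' (hO.mem_nhds hm)] with q hq hqO
  refine ⟨hq.self_of_nhds, ?_⟩
  have h1 : HasFDerivAt T (fderiv ℝ T (c q.1, q.2)) (c q.1, q.2) :=
    ((hT.contDiffAt (hO.mem_nhds hqO)).differentiableAt (by simp)).hasFDerivAt
  have h2 : HasFDerivAt (fun y => T (c q.1, y))
      ((fderiv ℝ T (c q.1, q.2)).comp (ContinuousLinearMap.inr ℝ P F)) q.2 :=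
    h1.comp q.2 (hasFDerivAt_prodMk_right (c q.1) q.2)
  refine h2.congr_of_eventuallyEq ?_
  have h3 : ContinuousAt (fun y : F => (q.1, y)) q.2 := by fun_prop
  exact h3.eventually hq

/-- Differentiating the local model `T` in its second variable gives a local model with the same `c`
and `O`. This stability drives the induction in `IsSmoothFamily.contDiffOn_integral`; the parameter
space itself, for instance a compact group, needs no linear structure. -/
lemma IsSmoothFamily.derivative {C : Set X} {V : Set F} {Θ : X → F → H}
    (h : IsSmoothFamily P C V Θ) : IsSmoothFamily P C V fun x => fderiv ℝ (Θ x) := by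
  intro x₀ hx y₀ hy
  obtain ⟨c, T, O, hc, hO, hm, hT, hΘ⟩ := h.exists_hasFDerivAt hx hy
  refine ⟨c, fun p => (fderiv ℝ T p).comp (ContinuousLinearMap.inr ℝ P F), O, hc, hO, hm, ?_, ?_⟩
  · exact (hT.fderiv_of_isOpen hO (m := ∞) (by simp)).clm_comp contDiffOn_const
  · filter_upwards [hΘ] with q hq using hq.2.fderiv

lemma IsSmoothFamily.hasFDerivAt {C : Set X} {V : Set F} {Θ : X → F → H}
    (h : IsSmoothFamily P C V Θ) {x : X} (hx : x ∈ C) {y : F} (hy : y ∈ V) :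
    HasFDerivAt (Θ x) (fderiv ℝ (Θ x) y) y := by
  obtain ⟨c, T, O, hc, hO, hm, hT, hΘ⟩ := h.exists_hasFDerivAt hx hy
  exact hΘ.self_of_nhds.2.differentiableAt.hasFDerivAt

lemma IsSmoothFamily.continuousAt {C : Set X} {V : Set F} {Θ : X → F → H}
    (h : IsSmoothFamily P C V Θ) {x : X} (hx : x ∈ C) {y : F} (hy : y ∈ V) :
    ContinuousAt (fun q : X × F => Θ q.1 q.2) (x, y) := by
  obtain ⟨c, T, O, hc, hO, hm, hT, hΘ⟩ := h x hx y hy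
  have hc' : ContinuousAt (fun q : X × F => (c q.1, q.2)) (x, y) :=
    (hc.comp (x := (x, y)) continuousAt_fst).prodMk continuousAt_snd
  have h1 : ContinuousAt T (c x, y) := (hT.contDiffAt (hO.mem_nhds hm)).continuousAt
  exact (ContinuousAt.comp (x := (x, y)) (f := fun q : X × F => (c q.1, q.2)) h1 hc').congr_of_eventuallyEq hΘ

lemma IsSmoothFamily.continuousOn {C : Set X} {V : Set F} {Θ : X → F → H}
    (h : IsSmoothFamily P C V Θ) {y : F} (hy : y ∈ V) : ContinuousOn (fun x => Θ x y) C :=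
  fun x hx => ((h.continuousAt hx hy).comp (f := fun x => (x, y)) (by fun_prop)).continuousWithinAt

variable [MeasurableSpace X] [OpensMeasurableSpace X] [T2Space X] {μ : Measure X}
  [IsFiniteMeasureOnCompacts μ]

lemma IsSmoothFamily.integrableOn {C : Set X} (hC : IsCompact C) {V : Set F} {Θ : X → F → H}
    (h : IsSmoothFamily P C V Θ) {y : F} (hy : y ∈ V) : IntegrableOn (fun x => Θ x y) C μ :=
  (h.continuousOn hy).integrableOn_compact hC

lemma IsSmoothFamily.hasFDerivAt_integral {C : Set X} (hC : IsCompact C) {V : Set F}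
    (hV : IsOpen V) {Θ : X → F → H} (h : IsSmoothFamily P C V Θ) {y : F} (hy : y ∈ V) :
    HasFDerivAt (fun z => ∫ x in C, Θ x z ∂μ) (∫ x in C, fderiv ℝ (Θ x) y ∂μ) y := by
  have h' := h.derivative
  obtain ⟨B, hB⟩ := hC.exists_bound_of_continuousOn (h'.continuousOn hy)
  -- The bound `B` at the single point `y` persists nearby, up to `1`, uniformly over the compact
  -- set `C`. This gives the constant dominating function.
  have hev : ∀ᶠ z in 𝓝 y, ∀ x ∈ C, ‖fderiv ℝ (Θ x) z‖ < B + 1 := by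
    refine hC.eventually_forall_of_forall_eventually fun x hx => ?_
    have h1 : ContinuousAt (fun q : F × X => ‖fderiv ℝ (Θ q.2) q.1‖) (y, x) :=
      ((h'.continuousAt hx hy).comp (f := Prod.swap) (x := (y, x))
        continuous_swap.continuousAt).norm
    exact h1.eventually_lt_const (by have := hB x hx; simp only; linarith)
  have hs := Filter.inter_mem hev (hV.mem_nhds hy)
  have hae : ∀ᵐ x ∂μ.restrict C, x ∈ C := ae_restrict_mem hC.measurableSet
  have hfin : IsFiniteMeasure (μ.restrict C) :=
    ⟨by rw [Measure.restrict_apply_univ]; exact hC.measure_lt_top⟩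
  refine hasFDerivAt_integral_of_dominated_of_fderiv_le (𝕜 := ℝ) (F := fun z x => Θ x z)
    (F' := fun z x => fderiv ℝ (Θ x) z) (bound := fun _ => B + 1) hs ?_
    (h.integrableOn hC hy) (h'.integrableOn hC hy).aestronglyMeasurable ?_
    (integrable_const _) ?_
  · filter_upwards [hV.mem_nhds hy] with z hz using (h.integrableOn hC hz).aestronglyMeasurable
  · filter_upwards [hae] with x hx z hz using (hz.1 x hx).le
  · filter_upwards [hae] with x hx z hz using h.hasFDerivAt hx hz.2

lemma IsSmoothFamily.contDiffOn_integral {C : Set X} (hC : IsCompact C) {V : Set F}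
    (hV : IsOpen V) {Θ : X → F → H} (h : IsSmoothFamily P C V Θ) :
    ContDiffOn ℝ ∞ (fun z => ∫ x in C, Θ x z ∂μ) V := by
  rw [contDiffOn_infty]
  intro k
  -- All target spaces are treated at once, because the derivative takes values in `F →L[ℝ] H`.
  induction k generalizing H with
  | zero =>
    exact contDiffOn_zero.2 fun y hy =>
      (h.hasFDerivAt_integral (μ := μ) hC hV hy).continuousAt.continuousWithinAt
  | succ k ih =>
    have hc : ((k + 1 : ℕ) : WithTop ℕ∞) = (k : WithTop ℕ∞) + 1 := by push_cast; rfl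
    rw [hc, contDiffOn_succ_iff_fderiv_of_isOpen hV]
    refine ⟨fun y hy => (h.hasFDerivAt_integral (μ := μ) hC hV hy).differentiableAt.differentiableWithinAt,
      by simp, ?_⟩
    exact (ih h.derivative).congr fun y hy => (h.hasFDerivAt_integral (μ := μ) hC hV hy).fderiv

end Parametric

/-! ### Pullback and exterior derivative of forms on the manifold -/

section PullBack

variable {m : ℕ} {M : Type*} [TopologicalSpace M] [ChartedSpace (EuclideanSpace ℝ (Fin m)) M]
  {F : Type} [NormedAddCommGroup F] [NormedSpace ℝ F]

/-- The pullback of a differential form on `M` under a map from a vector space. -/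
def DiffForm.pull {k : ℕ} (σ : DiffForm m M k) (f : F → M) (y : F) : F [⋀^Fin k]→L[ℝ] ℝ :=
  (σ (f y)).compContinuousLinearMap (mfderiv 𝓘(ℝ, F) (𝓡 m) f y)

lemma isOpen_extTarget (x₀ : M) : IsOpen (extChartAt (𝓡 m) x₀).target :=
  isOpen_extChartAt_target x₀

lemma isOpen_chartDomain {U : Set M} (hU : IsOpen U) (x₀ : M) :
    IsOpen (chartDomain (m := m) U x₀) :=
  (continuousOn_extChartAt_symm x₀).isOpen_inter_preimage (isOpen_extTarget x₀) hU

/-- The exterior derivative of a form on `M`. -/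
def dForm {k : ℕ} (β : DiffForm m M k) : DiffForm m M (k + 1) := fun x =>
  (extDeriv (β.inChart x) (extChartAt (𝓡 m) x x) :
    EuclideanSpace ℝ (Fin m) [⋀^Fin (k + 1)]→L[ℝ] ℝ)

/-- The tangent space at a point is identified with the model space through the preferred chart at
that same point. For this reason `dForm` may be read off in that chart with no further
transformation. -/
lemma mfderiv_eq_fderiv_extChartAt {f : F → M} {y : F} (hf : MDifferentiableAt 𝓘(ℝ, F) (𝓡 m) f y) :
    mfderiv 𝓘(ℝ, F) (𝓡 m) f y = fderiv ℝ (extChartAt (𝓡 m) (f y) ∘ f) y := by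
  refine hf.mfderiv.trans ?_
  simp [writtenInExtChartAt, Function.comp_def, chartAt_self_eq]
  rfl

/-- A point of `W` has a neighbourhood in `W` that `f` maps into the chart domain of `x₀`. -/
lemma exists_nhd_chart {f : F → M} {W : Set F} {U : Set M} {y : F} {x₀ : M} (hW : IsOpen W)
    (hy : y ∈ W) (hf : ContMDiffOn 𝓘(ℝ, F) (𝓡 m) ∞ f W) (hWU : MapsTo f W U)
    (hx : f y ∈ (extChartAt (𝓡 m) x₀).source) :
    ∃ W' ⊆ W, IsOpen W' ∧ y ∈ W' ∧ MapsTo f W' (extChartAt (𝓡 m) x₀).source ∧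
      MapsTo (extChartAt (𝓡 m) x₀ ∘ f) W' (chartDomain U x₀) := by
  refine ⟨W ∩ f ⁻¹' (extChartAt (𝓡 m) x₀).source, inter_subset_left,
    hf.continuousOn.isOpen_inter_preimage hW (isOpen_extChartAt_source x₀), ⟨hy, hx⟩,
    fun z hz => hz.2, fun z hz => ⟨(extChartAt (𝓡 m) x₀).map_source hz.2, ?_⟩⟩
  rw [mem_preimage, Function.comp_apply, (extChartAt (𝓡 m) x₀).left_inv hz.2]
  exact hWU hz.1

lemma mdifferentiableAt_of_contMDiffOn {f : F → M} {W : Set F} {y : F}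
    (hf : ContMDiffOn 𝓘(ℝ, F) (𝓡 m) ∞ f W) (hW : IsOpen W) (hy : y ∈ W) :
    MDifferentiableAt 𝓘(ℝ, F) (𝓡 m) f y :=
  (hf.contMDiffAt (hW.mem_nhds hy)).mdifferentiableAt (by simp)

lemma minSmoothness_two_le_infty : minSmoothness ℝ 2 ≤ (∞ : WithTop ℕ∞) := by
  rw [minSmoothness_of_isRCLikeNormedField]
  exact WithTop.coe_le_coe.2 (le_top : (2 : ℕ∞) ≤ ⊤)

variable [IsManifold (𝓡 m) ∞ M]

lemma mdifferentiableAt_extChartAt_symm {x₀ : M} {y : EuclideanSpace ℝ (Fin m)}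
    (hy : y ∈ (extChartAt (𝓡 m) x₀).target) :
    MDifferentiableAt 𝓘(ℝ, EuclideanSpace ℝ (Fin m)) (𝓡 m) (extChartAt (𝓡 m) x₀).symm y :=
  ((contMDiffOn_extChartAt_symm (n := ∞) x₀).contMDiffAt
    ((isOpen_extTarget x₀).mem_nhds hy)).mdifferentiableAt (by simp)

lemma contMDiffAt_extChartAt_of_mem {x₀ x : M} (hx : x ∈ (extChartAt (𝓡 m) x₀).source) :
    ContMDiffAt (𝓡 m) 𝓘(ℝ, EuclideanSpace ℝ (Fin m)) ∞ (extChartAt (𝓡 m) x₀) x :=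
  contMDiffAt_extChartAt' (by simpa using hx)

lemma mfderiv_eq_comp {f : F → M} {y : F} {x₀ : M} (hf : MDifferentiableAt 𝓘(ℝ, F) (𝓡 m) f y)
    (hx : f y ∈ (extChartAt (𝓡 m) x₀).source) :
    mfderiv 𝓘(ℝ, F) (𝓡 m) f y =
      (mfderiv 𝓘(ℝ, EuclideanSpace ℝ (Fin m)) (𝓡 m) (extChartAt (𝓡 m) x₀).symm
        (extChartAt (𝓡 m) x₀ (f y)) : EuclideanSpace ℝ (Fin m) →L[ℝ] EuclideanSpace ℝ (Fin m)).comp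
        (fderiv ℝ (extChartAt (𝓡 m) x₀ ∘ f) y) := by
  have h1 : f =ᶠ[𝓝 y] (extChartAt (𝓡 m) x₀).symm ∘ (extChartAt (𝓡 m) x₀ ∘ f) := by
    filter_upwards [hf.continuousAt ((isOpen_extChartAt_source x₀).mem_nhds hx)] with z hz
    exact ((extChartAt (𝓡 m) x₀).left_inv hz).symm
  have h2 : MDifferentiableAt 𝓘(ℝ, F) 𝓘(ℝ, EuclideanSpace ℝ (Fin m))
      (extChartAt (𝓡 m) x₀ ∘ f) y :=
    ((contMDiffAt_extChartAt_of_mem hx).mdifferentiableAt (by simp)).comp y hf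
  have h3 := mdifferentiableAt_extChartAt_symm ((extChartAt (𝓡 m) x₀).map_source hx)
  rw [h1.mfderiv_eq]
  refine (mfderiv_comp y h3 h2).trans ?_
  rw [mfderiv_eq_fderiv]
  rfl

lemma DiffForm.pull_eq {k : ℕ} (σ : DiffForm m M k) {f : F → M} {y : F} {x₀ : M}
    (hf : MDifferentiableAt 𝓘(ℝ, F) (𝓡 m) f y) (hx : f y ∈ (extChartAt (𝓡 m) x₀).source) :
    σ.pull f y = (σ.inChart x₀ (extChartAt (𝓡 m) x₀ (f y))).compContinuousLinearMap
      (fderiv ℝ (extChartAt (𝓡 m) x₀ ∘ f) y) := by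
  -- The two base points are equal only by the inverse property of the chart, and the type of the
  -- form depends on the base point, so the identity is proved for a variable point first. The same
  -- device recurs below.
  have key : ∀ (x : M) (hx' : x = f y) (A : EuclideanSpace ℝ (Fin m) →L[ℝ] EuclideanSpace ℝ (Fin m))
      (B : F →L[ℝ] EuclideanSpace ℝ (Fin m)),
      ((σ (f y) : EuclideanSpace ℝ (Fin m) [⋀^Fin k]→L[ℝ] ℝ).compContinuousLinearMap (A.comp B)) =
      ((σ x : EuclideanSpace ℝ (Fin m) [⋀^Fin k]→L[ℝ] ℝ).compContinuousLinearMap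
        A).compContinuousLinearMap B := by
    rintro x rfl A B; rfl
  rw [DiffForm.pull, mfderiv_eq_comp hf hx]
  exact key _ ((extChartAt (𝓡 m) x₀).left_inv hx) _ _

lemma contDiffOn_extChartAt_comp {f : F → M} {W : Set F} {x₀ : M}
    (hf : ContMDiffOn 𝓘(ℝ, F) (𝓡 m) ∞ f W) (hW : MapsTo f W (extChartAt (𝓡 m) x₀).source) :
    ContDiffOn ℝ ∞ (extChartAt (𝓡 m) x₀ ∘ f) W :=
  contMDiffOn_iff_contDiffOn.1
    ((contMDiffOn_extChartAt (n := ∞)).comp hf fun y hy => by simpa using hW hy)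

lemma DiffForm.SmoothOn.pull [FiniteDimensional ℝ F] {k : ℕ} {σ : DiffForm m M k} {U : Set M}
    (hσ : σ.SmoothOn U) {f : F → M} {W : Set F} (hW : IsOpen W)
    (hf : ContMDiffOn 𝓘(ℝ, F) (𝓡 m) ∞ f W) (hWU : MapsTo f W U) :
    ContDiffOn ℝ ∞ (σ.pull f) W := by
  intro y hy
  obtain ⟨W', hW'W, hW'o, hy', hs, ht⟩ := exists_nhd_chart hW hy hf hWU (mem_extChartAt_source (f y))
  have h1 := contDiffOn_extChartAt_comp (hf.mono hW'W) hs
  have h2 : ContDiffOn ℝ ∞ (fun z => (σ.inChart (f y)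
      ((extChartAt (𝓡 m) (f y) ∘ f) z)).compContinuousLinearMap
      (fderiv ℝ (extChartAt (𝓡 m) (f y) ∘ f) z)) W' :=
    contDiffOn_compContinuousLinearMap ((hσ (f y)).comp h1 ht)
      (h1.fderiv_of_isOpen hW'o (by simp))
  have h3 := h2.congr fun z hz => σ.pull_eq (mdifferentiableAt_of_contMDiffOn hf hW (hW'W hz)) (hs hz)
  exact (h3.contDiffAt (hW'o.mem_nhds hy')).contDiffWithinAt

/-- Near `y` the pullback factors through the chart at `x₀`, and the exterior derivative on vector
spaces commutes with pullback. As `x₀` is arbitrary, this contains the independence of `d` from the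
chart. -/
lemma DiffForm.SmoothOn.extDeriv_pull {k : ℕ} {σ : DiffForm m M k} {U : Set M} (hU : IsOpen U)
    (hσ : σ.SmoothOn U) {f : F → M} {W : Set F} (hW : IsOpen W)
    (hf : ContMDiffOn 𝓘(ℝ, F) (𝓡 m) ∞ f W) (hWU : MapsTo f W U) {y : F} (hy : y ∈ W) {x₀ : M}
    (hx : f y ∈ (extChartAt (𝓡 m) x₀).source) :
    extDeriv (σ.pull f) y = (extDeriv (σ.inChart x₀)
      (extChartAt (𝓡 m) x₀ (f y))).compContinuousLinearMap
        (fderiv ℝ (extChartAt (𝓡 m) x₀ ∘ f) y) := by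
  obtain ⟨W', hW'W, hW'o, hy', hs, ht⟩ := exists_nhd_chart hW hy hf hWU hx
  have h1 := contDiffOn_extChartAt_comp (hf.mono hW'W) hs
  have h2 : σ.pull f =ᶠ[𝓝 y] fun z => (σ.inChart x₀
      ((extChartAt (𝓡 m) x₀ ∘ f) z)).compContinuousLinearMap
      (fderiv ℝ (extChartAt (𝓡 m) x₀ ∘ f) z) := by
    filter_upwards [hW'o.mem_nhds hy'] with z hz
    exact σ.pull_eq (mdifferentiableAt_of_contMDiffOn hf hW (hW'W hz)) (hs hz)
  rw [h2.extDeriv_eq]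
  exact extDeriv_pullback (r := ∞) (((hσ x₀).contDiffAt
    ((isOpen_chartDomain hU x₀).mem_nhds (ht hy'))).differentiableAt (by simp))
    (h1.contDiffAt (hW'o.mem_nhds hy')) minSmoothness_two_le_infty

lemma DiffForm.ClosedOn.extDeriv_pull {k : ℕ} {σ : DiffForm m M k} {U : Set M} (hU : IsOpen U)
    (hσ : σ.SmoothOn U) (hc : σ.ClosedOn U) {f : F → M} {W : Set F} (hW : IsOpen W)
    (hf : ContMDiffOn 𝓘(ℝ, F) (𝓡 m) ∞ f W) (hWU : MapsTo f W U) {y : F} (hy : y ∈ W) :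
    extDeriv (σ.pull f) y = 0 := by
  rw [hσ.extDeriv_pull hU hW hf hWU hy (mem_extChartAt_source (f y)), hc (f y)]
  · ext v; rfl
  · exact ⟨mem_extChartAt_target (f y), by simpa using hWU hy⟩

lemma DiffForm.SmoothOn.pull_dForm {k : ℕ} {β : DiffForm m M k} {U : Set M} (hU : IsOpen U)
    (hβ : β.SmoothOn U) {f : F → M} {W : Set F} (hW : IsOpen W)
    (hf : ContMDiffOn 𝓘(ℝ, F) (𝓡 m) ∞ f W) (hWU : MapsTo f W U) {y : F} (hy : y ∈ W) :
    (dForm β).pull f y = extDeriv (β.pull f) y := by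
  rw [hβ.extDeriv_pull hU hW hf hWU hy (mem_extChartAt_source (f y)), DiffForm.pull,
    mfderiv_eq_fderiv_extChartAt (mdifferentiableAt_of_contMDiffOn hf hW hy)]
  rfl

lemma contMDiffOn_extChartAt_symm_chartDomain (U : Set M) (x₀ : M) :
    ContMDiffOn 𝓘(ℝ, EuclideanSpace ℝ (Fin m)) (𝓡 m) ∞ (extChartAt (𝓡 m) x₀).symm
      (chartDomain U x₀) :=
  (contMDiffOn_extChartAt_symm x₀).mono inter_subset_left

lemma DiffForm.SmoothOn.inChart_dForm {k : ℕ} {β : DiffForm m M k} {U : Set M} (hU : IsOpen U)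
    (hβ : β.SmoothOn U) {x₀ : M} {y : EuclideanSpace ℝ (Fin m)} (hy : y ∈ chartDomain U x₀) :
    (dForm β).inChart x₀ y = extDeriv (β.inChart x₀) y :=
  hβ.pull_dForm hU (isOpen_chartDomain hU x₀) (contMDiffOn_extChartAt_symm_chartDomain U x₀)
    (fun _ hz => hz.2) hy

lemma contDiffOn_comp_symm {H : Type*} [NormedAddCommGroup H] [NormedSpace ℝ H] {f : M → H}
    {U : Set M} (hf : ContMDiffOn (𝓡 m) 𝓘(ℝ, H) ∞ f U) (j : M) :
    ContDiffOn ℝ ∞ (f ∘ (extChartAt (𝓡 m) j).symm) (chartDomain U j) :=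
  contMDiffOn_iff_contDiffOn.1 (hf.comp (contMDiffOn_extChartAt_symm_chartDomain U j)
    fun _ hy => hy.2)

lemma exists_chart_point {U : Set M} {x : M} (hx : x ∈ U) :
    ∃ j : M, ∃ y ∈ chartDomain (m := m) U j, (extChartAt (𝓡 m) j).symm y = x := by
  have h := (extChartAt (𝓡 m) x).left_inv (mem_extChartAt_source x)
  refine ⟨x, extChartAt (𝓡 m) x x, ⟨mem_extChartAt_target x, ?_⟩, h⟩
  rw [mem_preimage, h]
  exact hx

lemma contMDiffOn_of_comp_symm {H : Type*} [NormedAddCommGroup H] [NormedSpace ℝ H] {f : M → H}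
    {U : Set M} (hU : IsOpen U)
    (hf : ∀ j : M, ContDiffOn ℝ ∞ (f ∘ (extChartAt (𝓡 m) j).symm) (chartDomain U j)) :
    ContMDiffOn (𝓡 m) 𝓘(ℝ, H) ∞ f U := by
  intro x hx
  have hy : extChartAt (𝓡 m) x x ∈ chartDomain U x := by
    refine ⟨mem_extChartAt_target x, ?_⟩
    rw [mem_preimage, (extChartAt (𝓡 m) x).left_inv (mem_extChartAt_source x)]
    exact hx
  have h1 := ((hf x).contDiffAt ((isOpen_chartDomain hU x).mem_nhds hy)).contMDiffAt
  have h2 := h1.comp x (contMDiffAt_extChartAt_of_mem (mem_extChartAt_source x))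
  refine ContMDiffAt.contMDiffWithinAt (h2.congr_of_eventuallyEq ?_)
  filter_upwards [(isOpen_extChartAt_source x).mem_nhds (mem_extChartAt_source (I := 𝓡 m) x)]
    with z hz
  simp only [Function.comp_apply, (extChartAt (𝓡 m) x).left_inv hz]

lemma contDiffOn_extDeriv {E : Type*} [NormedAddCommGroup E] [NormedSpace ℝ E] {k : ℕ}
    {b : E → E [⋀^Fin k]→L[ℝ] ℝ} {W : Set E} (hW : IsOpen W) (hb : ContDiffOn ℝ ∞ b W) :
    ContDiffOn ℝ ∞ (extDeriv b) W := by
  let L : (E →L[ℝ] E [⋀^Fin k]→L[ℝ] ℝ) →L[ℝ] E [⋀^Fin (k + 1)]→L[ℝ] ℝ :=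
    ContinuousAlternatingMap.alternatizeUncurryFinCLM ℝ E ℝ
  exact L.contDiff.comp_contDiffOn (hb.fderiv_of_isOpen hW (m := ∞) (by simp))

lemma DiffForm.SmoothOn.dForm {k : ℕ} {β : DiffForm m M k} {U : Set M} (hU : IsOpen U)
    (hβ : β.SmoothOn U) : (dForm β).SmoothOn U := fun x₀ =>
  (contDiffOn_extDeriv (isOpen_chartDomain hU x₀) (hβ x₀)).congr fun _ hy =>
    hβ.inChart_dForm hU hy

lemma DiffForm.SmoothOn.closedOn_dForm {k : ℕ} {β : DiffForm m M k} {U : Set M} (hU : IsOpen U)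
    (hβ : β.SmoothOn U) : (HamiltonianLocalization.dForm β).ClosedOn U := by
  intro x₀ y hy
  have h : (HamiltonianLocalization.dForm β).inChart x₀ =ᶠ[𝓝 y] extDeriv (β.inChart x₀) := by
    filter_upwards [(isOpen_chartDomain hU x₀).mem_nhds hy] with z hz
      using hβ.inChart_dForm hU hz
  rw [h.extDeriv_eq]
  exact extDeriv_extDeriv_apply ((hβ x₀).contDiffAt ((isOpen_chartDomain hU x₀).mem_nhds hy))
    minSmoothness_two_le_infty

/-- Smoothness of a form can be checked in one chart at each point. -/
lemma DiffForm.smoothOn_of_forall_exists {k : ℕ} {σ : DiffForm m M k} {U : Set M}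
    (h : ∀ x ∈ U, ∃ x₀ : M, x ∈ (extChartAt (𝓡 m) x₀).source ∧ ∃ W : Set (EuclideanSpace ℝ (Fin m)),
      IsOpen W ∧ extChartAt (𝓡 m) x₀ x ∈ W ∧ ContDiffOn ℝ ∞ (σ.inChart x₀) W) : σ.SmoothOn U := by
  intro x₁ y hy
  obtain ⟨x₀, hx₀, W, hW, hxW, hσ⟩ := h _ hy.2
  set f := (extChartAt (𝓡 m) x₁).symm with hf
  have hfs := contMDiffOn_extChartAt_symm (I := 𝓡 m) (n := ∞) x₁
  obtain ⟨W', hW'W, hW'o, hy', hs, -⟩ := exists_nhd_chart (U := univ) (isOpen_extTarget x₁) hy.1 hfs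
    (mapsTo_univ _ _) hx₀
  have h1 := contDiffOn_extChartAt_comp (hfs.mono hW'W) hs
  have hO := h1.continuousOn.isOpen_inter_preimage hW'o hW
  set O := W' ∩ (extChartAt (𝓡 m) x₀ ∘ f) ⁻¹' W
  have h1' := h1.mono (inter_subset_left : O ⊆ W')
  have h2 : ContDiffOn ℝ ∞ (fun z => (σ.inChart x₀
      ((extChartAt (𝓡 m) x₀ ∘ f) z)).compContinuousLinearMap
      (fderiv ℝ (extChartAt (𝓡 m) x₀ ∘ f) z)) O :=
    contDiffOn_compContinuousLinearMap (hσ.comp h1' fun z hz => hz.2)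
      (h1'.fderiv_of_isOpen hO (by simp))
  have h3 := h2.congr fun z hz =>
    σ.pull_eq (mdifferentiableAt_of_contMDiffOn hfs (isOpen_extTarget x₁) (hW'W hz.1)) (hs hz.1)
  exact (h3.contDiffAt (hO.mem_nhds ⟨hy', hxW⟩)).contDiffWithinAt

/-- The coordinates of a tangent vector. -/
def chartVec (x₀ x : M) (w : TangentSpace (𝓡 m) x) : EuclideanSpace ℝ (Fin m) :=
  mfderiv (𝓡 m) 𝓘(ℝ, EuclideanSpace ℝ (Fin m)) (extChartAt (𝓡 m) x₀) x w

lemma mfderiv_symm_chartVec {x₀ x : M} (hx : x ∈ (extChartAt (𝓡 m) x₀).source)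
    (w : TangentSpace (𝓡 m) x) :
    (mfderiv 𝓘(ℝ, EuclideanSpace ℝ (Fin m)) (𝓡 m) (extChartAt (𝓡 m) x₀).symm
      (extChartAt (𝓡 m) x₀ x) (chartVec x₀ x w) : EuclideanSpace ℝ (Fin m)) = w := by
  have h1 : (extChartAt (𝓡 m) x₀).symm ∘ extChartAt (𝓡 m) x₀ =ᶠ[𝓝 x] id := by
    filter_upwards [(isOpen_extChartAt_source x₀).mem_nhds hx] with z hz
    exact (extChartAt (𝓡 m) x₀).left_inv hz
  have h2 := mfderiv_comp x (mdifferentiableAt_extChartAt_symm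
    ((extChartAt (𝓡 m) x₀).map_source hx))
    ((contMDiffAt_extChartAt_of_mem hx).mdifferentiableAt (by simp))
  rw [h1.mfderiv_eq, mfderiv_id] at h2
  exact (congrArg (fun T : EuclideanSpace ℝ (Fin m) →L[ℝ] EuclideanSpace ℝ (Fin m) => T w) h2).symm

lemma chartVec_mfderiv_symm {x₀ : M} {y : EuclideanSpace ℝ (Fin m)}
    (hy : y ∈ (extChartAt (𝓡 m) x₀).target) (w : EuclideanSpace ℝ (Fin m)) :
    chartVec x₀ ((extChartAt (𝓡 m) x₀).symm y)
      (mfderiv 𝓘(ℝ, EuclideanSpace ℝ (Fin m)) (𝓡 m) (extChartAt (𝓡 m) x₀).symm y w) = w := by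
  have h1 : extChartAt (𝓡 m) x₀ ∘ (extChartAt (𝓡 m) x₀).symm =ᶠ[𝓝 y] id := by
    filter_upwards [(isOpen_extTarget x₀).mem_nhds hy] with z hz
    exact (extChartAt (𝓡 m) x₀).right_inv hz
  have h2 := mfderiv_comp y
    ((contMDiffAt_extChartAt_of_mem ((extChartAt (𝓡 m) x₀).map_target hy)).mdifferentiableAt
      (by simp)) (mdifferentiableAt_extChartAt_symm hy)
  rw [h1.mfderiv_eq, mfderiv_id] at h2
  exact (congrArg (fun T : EuclideanSpace ℝ (Fin m) →L[ℝ] EuclideanSpace ℝ (Fin m) => T w) h2).symm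

end PullBack

/-! ### Variation of the Duistermaat-Heckman density in one chart -/

section ChartVariation

variable {d n : ℕ}

local notation "𝔼" => EuclideanSpace ℝ (Fin (2 * n))

/-- Reflexivity of `𝔤`: the differential of `φ` at a point of `𝔤*` is evaluation at some element of
`𝔤`, to which Hamilton's equation can be applied. -/
lemma exists_eval_eq (T : LieDual d →L[ℝ] ℝ) : ∃ X : LieAlg d, ∀ ξ : LieDual d, T ξ = ξ X := by
  let T' : Module.Dual ℝ (Module.Dual ℝ (LieAlg d)) :=
    (T : LieDual d →ₗ[ℝ] ℝ).comp
      (LinearMap.toContinuousLinearMap : (LieAlg d →ₗ[ℝ] ℝ) ≃ₗ[ℝ] (LieAlg d →L[ℝ] ℝ)).toLinearMap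
  obtain ⟨X, hX⟩ := (Module.bijective_dual_eval ℝ (LieAlg d)).2 T'
  refine ⟨X, fun ξ => ?_⟩
  have h := LinearMap.congr_fun hX (ξ : LieAlg d →ₗ[ℝ] ℝ)
  exact h.symm

lemma fderiv_pf_covWedge_contract_left (σ : 𝔼 [⋀^Fin 2]→L[ℝ] ℝ) (b : 𝔼 [⋀^Fin 1]→L[ℝ] ℝ) (Y : 𝔼) :
    fderiv ℝ pf σ (covWedge (contract σ Y) b) = - b ![Y] * pf σ := by
  let b' : 𝔼 →L[ℝ] ℝ := (ContinuousAlternatingMap.ofSubsingleton ℝ 𝔼 ℝ (0 : Fin 1)).symm b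
  have hb' : ∀ w, b' w = b ![w] := fun w => by
    simp only [b']
    change b (fun _ => w) = _
    congr 1; ext i; fin_cases i; rfl
  have h : covWedge (contract σ Y) b = - covWedge b' (covForm (contract σ Y)) :=
    alternating_two_ext fun u w => by
      simp only [covWedge_apply, ContinuousAlternatingMap.neg_apply, covForm_apply, hb']; ring
  rw [h, map_neg, fderiv_pf_covWedge_contract, hb', neg_mul]

lemma extDeriv_smul_form {h : 𝔼 → ℝ} {b : 𝔼 → 𝔼 [⋀^Fin 1]→L[ℝ] ℝ} {y : 𝔼}
    (hh : DifferentiableAt ℝ h y) (hb : DifferentiableAt ℝ b y) :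
    extDeriv (fun z => h z • b z) y = h y • extDeriv b y + covWedge (fderiv ℝ h y) (b y) := by
  rw [extDeriv, (hh.hasFDerivAt.fun_smul hb.hasFDerivAt).fderiv]
  refine alternating_two_ext fun u w => ?_
  rw [ContinuousAlternatingMap.add_apply, ContinuousAlternatingMap.smul_apply, extDeriv,
    covWedge_apply, alternatizeUncurryFin_two_apply, alternatizeUncurryFin_two_apply]
  simp only [add_apply, smul_apply, ContinuousLinearMap.smulRight_apply,
    ContinuousAlternatingMap.add_apply, ContinuousAlternatingMap.smul_apply, smul_eq_mul]
  ring

/-- The derivative of `φ(F) pf(s)` in the direction `(Fd, τ)`. -/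
def variation (φ : LieDual d → ℝ) (F Fd : 𝔼 → LieDual d) (s τ : 𝔼 → 𝔼 [⋀^Fin 2]→L[ℝ] ℝ)
    (y : 𝔼) : ℝ :=
  fderiv ℝ φ (F y) (Fd y) * pf (s y) + φ (F y) * fderiv ℝ pf (s y) (τ y)

lemma notMem_tsupport_apply {φ : LieDual d → ℝ} {ξ : LieDual d} (h : ξ ∉ tsupport φ) :
    φ ξ = 0 ∧ fderiv ℝ φ ξ = 0 :=
  ⟨image_eq_zero_of_notMem_tsupport h, fderiv_of_notMem_tsupport (𝕜 := ℝ) h⟩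

variable {V K : Set (EuclideanSpace ℝ (Fin (2 * n)))} {φ : LieDual d → ℝ} {F Fd : EuclideanSpace ℝ (Fin (2 * n)) → LieDual d}
  {s τ : EuclideanSpace ℝ (Fin (2 * n)) → EuclideanSpace ℝ (Fin (2 * n)) [⋀^Fin 2]→L[ℝ] ℝ} {b : EuclideanSpace ℝ (Fin (2 * n)) → EuclideanSpace ℝ (Fin (2 * n)) [⋀^Fin 1]→L[ℝ] ℝ} {h : EuclideanSpace ℝ (Fin (2 * n)) → ℝ}

lemma contDiff_infty_pf : ContDiff ℝ ∞ (pf (n := n)) := (contDiff_pf (n := n)).of_le le_top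

lemma contDiff_infty_fderiv_pf : ContDiff ℝ ∞ (fderiv ℝ (pf (n := n))) :=
  (contDiff_pf (n := n)).fderiv_right (m := ∞) (by simp)

/-- Stokes' theorem for the `1`-form `h φ(F) b`. Its differential has three terms: `db` and `dφ(F)`
together produce `h` times the variation, and `dh` produces the remaining term. The moment map
condition turns `dφ(F)` into `ι(Y)s`. -/
lemma setIntegral_variation_eq_zero (hV : IsOpen V) (hK : IsCompact K) (hKV : K ⊆ V)
    (hφ : ContDiff ℝ ∞ φ) (hF : ContDiffOn ℝ ∞ F V)
    (hs : ContDiffOn ℝ ∞ s V) (hsd : ∀ y ∈ V, extDeriv s y = 0) (hb : ContDiffOn ℝ ∞ b V)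
    (hh : ContDiffOn ℝ ∞ h V) (h0 : ∀ y ∈ V, y ∉ K → h y = 0 ∨ F y ∉ tsupport φ)
    (hham : ∀ y ∈ V, ∀ X : LieAlg d, ∃ Y : 𝔼, (∀ w, fderiv ℝ F y w X = s y ![Y, w]) ∧
      Fd y X = - b y ![Y]) :
    ∫ y in V, (h y * variation φ F Fd s (extDeriv b) y +
      φ (F y) * fderiv ℝ pf (s y) (covWedge (fderiv ℝ h y) (b y))) = 0 := by
  have hφF : ContDiffOn ℝ ∞ (fun y => φ (F y)) V := hφ.comp_contDiffOn hF
  rw [← setIntegral_fderiv_pf_extDeriv hV hK hKV hs hsd (b := fun y => (h y * φ (F y)) • b y)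
    ((hh.mul hφF).smul hb) fun y hy hyK => ?_]
  · refine setIntegral_congr_fun hV.measurableSet fun y hy => ?_
    have dh := (hh.contDiffAt (hV.mem_nhds hy)).differentiableAt (by simp)
    have dF := (hF.contDiffAt (hV.mem_nhds hy)).differentiableAt (by simp)
    have dφ := (hφ.differentiable (by simp)) (F y)
    have db := (hb.contDiffAt (hV.mem_nhds hy)).differentiableAt (by simp)
    have hd : HasFDerivAt (fun z => h z * φ (F z))
        (h y • (fderiv ℝ φ (F y)).comp (fderiv ℝ F y) + φ (F y) • fderiv ℝ h y) y :=
      dh.hasFDerivAt.mul (dφ.hasFDerivAt.comp y dF.hasFDerivAt)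
    -- The vector `X` is the differential of `φ` at `F y`, and `Y` is its fundamental vector in
    -- coordinates. Wedging `ι(Y)s` with `b` contributes `-b(Y) pf s`, which is `X` paired with
    -- `Fd`, times `pf s`.
    obtain ⟨X, hX⟩ := exists_eval_eq (fderiv ℝ φ (F y))
    obtain ⟨Y, hY, hYb⟩ := hham y hy X
    have hc : (fderiv ℝ φ (F y)).comp (fderiv ℝ F y) = contract (s y) Y := by
      ext w
      rw [contract_apply, ← hY, ContinuousLinearMap.comp_apply, hX]
    simp only [variation]
    rw [extDeriv_smul_form hd.differentiableAt db, hd.fderiv, hc, covWedge_add_left,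
      covWedge_smul_left, covWedge_smul_left, map_add, map_add, map_smul, map_smul, map_smul,
      fderiv_pf_covWedge_contract_left, hX, hYb]
    simp only [smul_eq_mul]
    ring
  · rcases h0 y hy hyK with h | h
    · simp [h]
    · simp [(notMem_tsupport_apply h).1]

lemma contDiffOn_variation (hφ : ContDiff ℝ ∞ φ) (hF : ContDiffOn ℝ ∞ F V)
    (hFd : ContDiffOn ℝ ∞ Fd V) (hs : ContDiffOn ℝ ∞ s V) (hτ : ContDiffOn ℝ ∞ τ V) :
    ContDiffOn ℝ ∞ (variation φ F Fd s τ) V :=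
  ((((hφ.fderiv_right (m := ∞) (by simp)).comp_contDiffOn hF).clm_apply hFd).mul
    (contDiff_infty_pf.comp_contDiffOn hs)).add ((hφ.comp_contDiffOn hF).mul
      ((contDiff_infty_fderiv_pf.comp_contDiffOn hs).clm_apply hτ))

lemma integrableOn_of_contDiffOn (hV : IsOpen V) (hK : IsCompact K) (hKV : K ⊆ V)
    (hh : ContDiffOn ℝ ∞ h V) (h0 : ∀ y ∈ V, y ∉ K → h y = 0) : IntegrableOn h V := by
  have h1 : IntegrableOn h K := (hh.continuousOn.mono hKV).integrableOn_compact hK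
  refine h1.of_forall_sdiff_eq_zero hV.measurableSet fun y hy => h0 y hy.1 hy.2

/-- For every `t` the integrand vanishes on `V` off `K`, so the integral may be taken over the
compact set `K` and differentiated under the integral sign. -/
lemma hasDerivAt_setIntegral_variation (hV : IsOpen V) (hK : IsCompact K) (hKV : K ⊆ V)
    (hφ : ContDiff ℝ ∞ φ) (hF : ContDiffOn ℝ ∞ F V) (hFd : ContDiffOn ℝ ∞ Fd V)
    (hs : ContDiffOn ℝ ∞ s V) (hτ : ContDiffOn ℝ ∞ τ V) (hh : ContDiffOn ℝ ∞ h V)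
    {c : ℝ → ℝ} (hc : ContDiff ℝ ∞ c)
    (h0 : ∀ y ∈ V, y ∉ K → h y = 0 ∨ ∀ t, F y + c t • Fd y ∉ tsupport φ) (t : ℝ) :
    HasDerivAt (fun t => ∫ y in V, h y * (φ (F y + c t • Fd y) * pf (s y + c t • τ y)))
      (deriv c t * ∫ y in V, h y * variation φ (fun y => F y + c t • Fd y) Fd
        (fun y => s y + c t • τ y) τ y) t := by
  let Θ : 𝔼 → ℝ → ℝ := fun y t => h y * (φ (F y + c t • Fd y) * pf (s y + c t • τ y))
  have hfst : ∀ {H : Type} [NormedAddCommGroup H] [NormedSpace ℝ H] {f : 𝔼 → H},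
      ContDiffOn ℝ ∞ f V → ContDiffOn ℝ ∞ (fun q : 𝔼 × ℝ => f q.1) (V ×ˢ univ) :=
    fun hf => hf.comp contDiffOn_fst fun q hq => hq.1
  have hc2 : ContDiffOn ℝ ∞ (fun q : 𝔼 × ℝ => c q.2) (V ×ˢ univ) :=
    (hc.comp contDiff_snd).contDiffOn
  have hΘ : ContDiffOn ℝ ∞ (fun q : 𝔼 × ℝ => Θ q.1 q.2) (V ×ˢ univ) :=
    (hfst hh).mul ((hφ.comp_contDiffOn ((hfst hF).add (hc2.smul (hfst hFd)))).mul
      (contDiff_infty_pf.comp_contDiffOn ((hfst hs).add (hc2.smul (hfst hτ)))))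
  have hfam : IsSmoothFamily 𝔼 K (univ : Set ℝ) Θ :=
    IsSmoothFamily.of_contDiffOn (hV.prod isOpen_univ) (prod_mono hKV Subset.rfl) hΘ
  have hderiv : ∀ y ∈ V, HasDerivAt (Θ y) (deriv c t * (h y * variation φ
      (fun y => F y + c t • Fd y) Fd (fun y => s y + c t • τ y) τ y)) t := by
    intro y _
    have dc : HasDerivAt c (deriv c t) t := (hc.differentiable (by simp) t).hasDerivAt
    have e1 : HasDerivAt (fun t => F y + c t • Fd y) (deriv c t • Fd y) t :=
      (dc.smul_const (Fd y)).const_add (F y)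
    have e2 : HasDerivAt (fun t => s y + c t • τ y) (deriv c t • τ y) t :=
      (dc.smul_const (τ y)).const_add (s y)
    have e3 := (hφ.differentiable (by simp) (F y + c t • Fd y)).hasFDerivAt.comp_hasDerivAt t e1
    have e4 := (contDiff_infty_pf.differentiable (by simp)
      (s y + c t • τ y)).hasFDerivAt.comp_hasDerivAt t e2
    have e5 := (e3.mul e4).const_mul (h y)
    refine e5.congr_deriv ?_
    simp only [variation, Function.comp_apply, map_smul, smul_eq_mul]
    ring
  have hI := (hfam.hasFDerivAt_integral (μ := volume) hK isOpen_univ (mem_univ t)).hasDerivAt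
  have hVK : ∀ g : 𝔼 → ℝ, (∀ y ∈ V, y ∉ K → g y = 0) → ∫ y in V, g y = ∫ y in K, g y :=
    fun g hg => setIntegral_eq_of_subset_of_forall_sdiff_eq_zero hV.measurableSet hKV
      fun y hy => hg y hy.1 hy.2
  have e1 : (fun t => ∫ y in V, h y * (φ (F y + c t • Fd y) * pf (s y + c t • τ y))) =
      fun t => ∫ y in K, Θ y t := by
    funext t
    refine hVK _ fun y hy hyK => ?_
    rcases h0 y hy hyK with h | h
    · simp [h]
    · simp [(notMem_tsupport_apply (h t)).1]
  have e2 : deriv c t * ∫ y in V, h y * variation φ (fun y => F y + c t • Fd y) Fd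
        (fun y => s y + c t • τ y) τ y = (∫ y in K, fderiv ℝ (Θ y) t) 1 := by
    rw [ContinuousLinearMap.integral_apply (hfam.derivative.integrableOn hK (mem_univ t)),
      ← integral_const_mul, hVK]
    · refine setIntegral_congr_fun hK.measurableSet fun y hy => ?_
      rw [(hderiv y (hKV hy)).hasFDerivAt.fderiv]
      simp
    · intro y hy hyK
      rcases h0 y hy hyK with h | h
      · simp [h]
      · simp [variation, (notMem_tsupport_apply (h t)).1, (notMem_tsupport_apply (h t)).2]
  rw [e1, e2]
  exact hI

end ChartVariation

/-! ### Orientation signs, changes of charts, and the partition of unity -/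

section Density

variable {m : ℕ} {M : Type*} [TopologicalSpace M] [ChartedSpace (EuclideanSpace ℝ (Fin m)) M]

/-- The sign of the coordinate frame of the chart at `j`. -/
def chartSign (o : ManifoldOrientation m M) (j : M) (y : EuclideanSpace ℝ (Fin m)) : ℝ :=
  frameSign (o.orientation ((extChartAt (𝓡 m) j).symm y)) (chartFrame j y)

/-- The coordinate change from the chart at `j` to the chart at `i`. -/
def chartChange (j i : M) : EuclideanSpace ℝ (Fin m) → EuclideanSpace ℝ (Fin m) :=
  extChartAt (𝓡 m) i ∘ (extChartAt (𝓡 m) j).symm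

lemma abs_signType_sub (a b : SignType) (h : |((a : ℝ) - b)| < 1) : a = b := by
  rcases a with _ | _ | _ <;> rcases b with _ | _ | _ <;>
    first | rfl | (exfalso; norm_num at h)

/-- A continuous function with values in `{-1, 0, 1}` is locally constant. Thus the sign is smooth
with zero derivative and passes through differentiation. -/
lemma eventually_chartSign_eq (o : ManifoldOrientation m M) {j : M} {y : EuclideanSpace ℝ (Fin m)}
    (hy : y ∈ (extChartAt (𝓡 m) j).target) : ∀ᶠ z in 𝓝 y, chartSign o j z = chartSign o j y := by
  have hc : ContinuousAt (chartSign o j) y :=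
    (o.continuousOn_frameSign j).continuousAt ((isOpen_extChartAt_target j).mem_nhds hy)
  filter_upwards [Metric.tendsto_nhds.1 hc 1 one_pos] with z hz
  exact congrArg (fun s : SignType => (s : ℝ)) (abs_signType_sub _ _ hz)

lemma contDiffOn_chartSign (o : ManifoldOrientation m M) (j : M) :
    ContDiffOn ℝ ∞ (chartSign o j) (extChartAt (𝓡 m) j).target := fun y hy =>
  ((contDiffAt_const (c := chartSign o j y)).congr_of_eventuallyEq
    (eventually_chartSign_eq o hy)).contDiffWithinAt

lemma hasFDerivAt_chartSign (o : ManifoldOrientation m M) {j : M} {y : EuclideanSpace ℝ (Fin m)}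
    (hy : y ∈ (extChartAt (𝓡 m) j).target) :
    HasFDerivAt (chartSign o j) (0 : EuclideanSpace ℝ (Fin m) →L[ℝ] ℝ) y :=
  (hasFDerivAt_const (chartSign o j y) y).congr_of_eventuallyEq (eventually_chartSign_eq o hy)

variable [IsManifold (𝓡 m) ∞ M]

/-- Both signs are those of one top-degree form evaluated on two frames that differ by the Jacobian
matrix, whose determinant is therefore the ratio of the two values. -/
lemma chartSign_chartChange (o : ManifoldOrientation m M) {i j : M} {y : EuclideanSpace ℝ (Fin m)}
    (hy : y ∈ (extChartAt (𝓡 m) j).target)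
    (hi : (extChartAt (𝓡 m) j).symm y ∈ (extChartAt (𝓡 m) i).source) :
    chartSign o j y = SignType.sign (fderiv ℝ (chartChange j i) y).det *
      chartSign o i (chartChange j i y) := by
  set x := (extChartAt (𝓡 m) j).symm y with hx
  have hA := mfderiv_eq_comp (mdifferentiableAt_extChartAt_symm hy) hi
  set A := fderiv ℝ (chartChange j i) y with hA'
  let T : EuclideanSpace ℝ (Fin m) →L[ℝ] EuclideanSpace ℝ (Fin m) :=
    mfderiv 𝓘(ℝ, EuclideanSpace ℝ (Fin m)) (𝓡 m) (extChartAt (𝓡 m) i).symm (extChartAt (𝓡 m) i x)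
  have h1 : chartFrame j y = fun a => T (A (EuclideanSpace.single a 1)) := by
    funext a
    exact congrArg (fun B : EuclideanSpace ℝ (Fin m) →L[ℝ] EuclideanSpace ℝ (Fin m) =>
      B (EuclideanSpace.single a 1)) hA
  have key : ∀ (x' : M) (_ : x' = x) (v : Fin m → EuclideanSpace ℝ (Fin m)),
      frameSign (V := EuclideanSpace ℝ (Fin m)) (o.orientation x') v =
        frameSign (V := EuclideanSpace ℝ (Fin m)) (o.orientation x) v := by
    rintro x' rfl v; rfl
  have h2 : chartSign o i (chartChange j i y) = frameSign (V := EuclideanSpace ℝ (Fin m))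
      (o.orientation x) fun a => T (EuclideanSpace.single a 1) :=
    key _ ((extChartAt (𝓡 m) i).left_inv hi) _
  rw [h2, chartSign, h1]
  let η : TangentSpace (𝓡 m) x [⋀^Fin m]→ₗ[ℝ] ℝ := Module.Ray.someVector (o.orientation x)
  have h3 := topForm_comp ((show EuclideanSpace ℝ (Fin m) [⋀^Fin m]→ₗ[ℝ] ℝ from η).compLinearMap
      (T : EuclideanSpace ℝ (Fin m) →ₗ[ℝ] EuclideanSpace ℝ (Fin m)))
    (A : EuclideanSpace ℝ (Fin m) →ₗ[ℝ] EuclideanSpace ℝ (Fin m))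
  rw [AlternatingMap.compLinearMap_apply, AlternatingMap.compLinearMap_apply] at h3
  have h4 := congrArg (fun r : ℝ => ((SignType.sign r : SignType) : ℝ)) h3
  simp only [sign_mul, SignType.coe_mul] at h4
  exact h4

lemma contDiffAt_chartChange {i j : M} {y : EuclideanSpace ℝ (Fin m)}
    (hy : y ∈ (extChartAt (𝓡 m) j).target)
    (hi : (extChartAt (𝓡 m) j).symm y ∈ (extChartAt (𝓡 m) i).source) :
    ContDiffAt ℝ ∞ (chartChange j i) y :=
  contMDiffAt_iff_contDiffAt.1 ((contMDiffAt_extChartAt_of_mem hi).comp y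
    ((contMDiffOn_extChartAt_symm (n := ∞) j).contMDiffAt ((isOpen_extTarget j).mem_nhds hy)))

lemma setIntegral_chartChange {U : Set M} (hU : IsOpen U) (i j : M)
    (h : EuclideanSpace ℝ (Fin m) → ℝ) :
    ∫ y in chartDomain (U ∩ (extChartAt (𝓡 m) j).source) i, h y =
      ∫ y in chartDomain (U ∩ (extChartAt (𝓡 m) i).source) j,
        |(fderiv ℝ (chartChange j i) y).det| * h (chartChange j i y) := by
  have himage : chartDomain (m := m) (U ∩ (extChartAt (𝓡 m) j).source) i =
      chartChange j i '' chartDomain (U ∩ (extChartAt (𝓡 m) i).source) j := by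
    ext z
    constructor
    · rintro ⟨hz, hzU, hzj⟩
      refine ⟨extChartAt (𝓡 m) j ((extChartAt (𝓡 m) i).symm z),
        ⟨(extChartAt (𝓡 m) j).map_source hzj, ?_⟩, ?_⟩
      · rw [mem_preimage, (extChartAt (𝓡 m) j).left_inv hzj]
        exact ⟨hzU, (extChartAt (𝓡 m) i).map_target hz⟩
      · simp only [chartChange, Function.comp_apply]
        rw [(extChartAt (𝓡 m) j).left_inv hzj, (extChartAt (𝓡 m) i).right_inv hz]
    · rintro ⟨y, ⟨hy, hyU, hyi⟩, rfl⟩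
      refine ⟨(extChartAt (𝓡 m) i).map_source hyi, ?_⟩
      simp only [chartChange, Function.comp_apply, mem_preimage]
      rw [(extChartAt (𝓡 m) i).left_inv hyi]
      exact ⟨hyU, (extChartAt (𝓡 m) j).map_target hy⟩
  have hmeas : MeasurableSet (chartDomain (m := m) (U ∩ (extChartAt (𝓡 m) i).source) j) :=
    (isOpen_chartDomain (hU.inter (isOpen_extChartAt_source i)) j).measurableSet
  rw [himage, integral_image_eq_integral_abs_det_fderiv_smul volume hmeas
    (f' := fun y => fderiv ℝ (chartChange j i) y)]
  · rfl
  · intro y hy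
    exact ((contDiffAt_chartChange hy.1 hy.2.2).differentiableAt
      (by simp)).hasFDerivAt.hasFDerivWithinAt
  · intro y hy y' hy' hyy
    have h1 := (extChartAt (𝓡 m) i).injOn hy.2.2 hy'.2.2 hyy
    exact (extChartAt (𝓡 m) j).symm.injOn hy.1 hy'.1 h1

/-- A density that is supported in the chart at `i` can be integrated in that chart. -/
lemma sum_setIntegral_density (o : ManifoldOrientation m M) {U : Set M} (hU : IsOpen U)
    {S : Finset M} {ρ : M → M → ℝ} (hρ : ∀ j x, x ∉ (extChartAt (𝓡 m) j).source → ρ j x = 0)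
    {δ : M → EuclideanSpace ℝ (Fin m) → ℝ} {i : M}
    (htrans : ∀ j, ∀ y ∈ chartDomain (U ∩ (extChartAt (𝓡 m) i).source) j,
      δ j y = (fderiv ℝ (chartChange j i) y).det * δ i (chartChange j i y))
    (hsupp : ∀ j, ∀ y ∈ chartDomain U j,
      (extChartAt (𝓡 m) j).symm y ∉ (extChartAt (𝓡 m) i).source → δ j y = 0)
    (hS : ∀ y ∈ chartDomain U i, δ i y = 0 ∨ ∑ j ∈ S, ρ j ((extChartAt (𝓡 m) i).symm y) = 1)
    (hint : ∀ j ∈ S, IntegrableOn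
      (fun y => ρ j ((extChartAt (𝓡 m) i).symm y) * (chartSign o i y * δ i y))
      (chartDomain U i)) :
    ∑ j ∈ S, ∫ y in chartDomain U j,
        ρ j ((extChartAt (𝓡 m) j).symm y) * (chartSign o j y * δ j y) =
      ∫ y in chartDomain U i, chartSign o i y * δ i y := by
  have hmeas : ∀ j, MeasurableSet (chartDomain (m := m) U j) := fun j =>
    (isOpen_chartDomain hU j).measurableSet
  have h1 : ∀ j, ∫ y in chartDomain U j,
        ρ j ((extChartAt (𝓡 m) j).symm y) * (chartSign o j y * δ j y) =
      ∫ y in chartDomain U i, ρ j ((extChartAt (𝓡 m) i).symm y) * (chartSign o i y * δ i y) := by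
    intro j
    have e1 : ∫ y in chartDomain U j,
        ρ j ((extChartAt (𝓡 m) j).symm y) * (chartSign o j y * δ j y) =
        ∫ y in chartDomain (U ∩ (extChartAt (𝓡 m) i).source) j,
          ρ j ((extChartAt (𝓡 m) j).symm y) * (chartSign o j y * δ j y) := by
      refine setIntegral_eq_of_subset_of_forall_sdiff_eq_zero (hmeas j)
        (fun y hy => ⟨hy.1, hy.2.1⟩) fun y hy => ?_
      rw [hsupp j y hy.1 fun h => hy.2 ⟨hy.1.1, hy.1.2, h⟩]
      ring
    have e2 : ∫ y in chartDomain U i,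
        ρ j ((extChartAt (𝓡 m) i).symm y) * (chartSign o i y * δ i y) =
        ∫ y in chartDomain (U ∩ (extChartAt (𝓡 m) j).source) i,
          ρ j ((extChartAt (𝓡 m) i).symm y) * (chartSign o i y * δ i y) := by
      refine setIntegral_eq_of_subset_of_forall_sdiff_eq_zero (hmeas i)
        (fun y hy => ⟨hy.1, hy.2.1⟩) fun y hy => ?_
      rw [hρ j _ fun h => hy.2 ⟨hy.1.1, hy.1.2, h⟩]
      ring
    rw [e1, e2, setIntegral_chartChange hU i j]
    refine setIntegral_congr_fun
      (isOpen_chartDomain (hU.inter (isOpen_extChartAt_source i)) j).measurableSet fun y hy => ?_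
    have e3 : (extChartAt (𝓡 m) i).symm (chartChange j i y) = (extChartAt (𝓡 m) j).symm y :=
      (extChartAt (𝓡 m) i).left_inv hy.2.2
    -- The orientation contributes the sign of the Jacobian determinant and the density contributes
    -- the determinant; their product is the absolute value in the change of variables formula.
    rw [e3, chartSign_chartChange o hy.1 hy.2.2, htrans j y hy, ← sign_mul_self]
    ring
  rw [Finset.sum_congr rfl fun j _ => h1 j, ← integral_finset_sum S hint]
  refine setIntegral_congr_fun (hmeas i) fun y hy => ?_
  rw [← Finset.sum_mul]
  rcases hS y hy with h | h
  · rw [h]; ring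
  · rw [h, one_mul]

variable [T2Space M] [SecondCountableTopology M]

lemma tsupport_chartPartition_subset (j : M) :
    tsupport (chartPartition m M j) ⊆ (extChartAt (𝓡 m) j).source := by
  rw [extChartAt_source]
  exact (exists_chartPartition m M).choose_spec j

lemma finite_tsupport_chartPartition_inter {K : Set M} (hK : IsCompact K) :
    {j : M | (tsupport (chartPartition m M j) ∩ K).Nonempty}.Finite :=
  (chartPartition m M).locallyFinite.closure.finite_nonempty_inter_compact hK

/-- The supports of the functions left out of `S` form a locally finite family, so their union is
closed, and it misses `K`. The identity holds on a neighbourhood and hence can be differentiated: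
the differentials of the functions in `S` sum to zero on `K`. -/
lemma eventually_sum_chartPartition {K : Set M} {S : Finset M}
    (hS : ∀ j, (tsupport (chartPartition m M j) ∩ K).Nonempty → j ∈ S) {x : M} (hx : x ∈ K) :
    ∀ᶠ z in 𝓝 x, ∑ j ∈ S, chartPartition m M j z = 1 := by
  have hlf : LocallyFinite fun j : {j : M // j ∉ S} => tsupport (chartPartition m M j) :=
    (chartPartition m M).locallyFinite.closure.comp_injective Subtype.val_injective
  have hcl := hlf.isClosed_iUnion fun j => isClosed_tsupport _
  have hxn : x ∉ ⋃ j : {j : M // j ∉ S}, tsupport (chartPartition m M j) := by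
    rw [mem_iUnion]
    rintro ⟨j, hj⟩
    exact j.2 (hS j ⟨x, hj, hx⟩)
  filter_upwards [hcl.isOpen_compl.mem_nhds hxn] with z hz
  rw [← (chartPartition m M).sum_eq_one (mem_univ z), eq_comm]
  refine finsum_eq_sum_of_support_subset _ fun j hj => ?_
  by_contra hjS
  exact hz (mem_iUnion.2 ⟨⟨j, hjS⟩, subset_tsupport _ hj⟩)

end Density

/-! ### The cut-off variation as a density, and Hamilton's equation in charts -/

section Cobordism

variable {d n : ℕ} {M : Type*} [TopologicalSpace M]
  [ChartedSpace (EuclideanSpace ℝ (Fin (2 * n))) M] [IsManifold (𝓡 (2 * n)) ∞ M]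

local notation "𝔼" => EuclideanSpace ℝ (Fin (2 * n))

lemma covWedge_comp {E E' : Type*} [NormedAddCommGroup E] [NormedSpace ℝ E]
    [NormedAddCommGroup E'] [NormedSpace ℝ E'] (a : E →L[ℝ] ℝ) (b : E [⋀^Fin 1]→L[ℝ] ℝ)
    (A : E' →L[ℝ] E) :
    covWedge (a.comp A) (b.compContinuousLinearMap A) =
      (covWedge a b).compContinuousLinearMap A := by
  refine alternating_two_ext fun u w => ?_
  have h1 : ∀ u, b.compContinuousLinearMap A ![u] = b ![A u] := fun u => by
    rw [ContinuousAlternatingMap.compContinuousLinearMap_apply]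
    congr 1; ext i; fin_cases i; rfl
  have h2 : (covWedge a b).compContinuousLinearMap A ![u, w] = covWedge a b ![A u, A w] := by
    rw [ContinuousAlternatingMap.compContinuousLinearMap_apply]
    congr 1; ext i; fin_cases i <;> rfl
  rw [h2, covWedge_apply, covWedge_apply, h1, h1]
  rfl

lemma contDiffOn_covWedge {X E : Type*} [NormedAddCommGroup X] [NormedSpace ℝ X]
    [NormedAddCommGroup E] [NormedSpace ℝ E] {a : X → E →L[ℝ] ℝ} {b : X → E [⋀^Fin 1]→L[ℝ] ℝ}
    {V : Set X} (ha : ContDiffOn ℝ ∞ a V) (hb : ContDiffOn ℝ ∞ b V) :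
    ContDiffOn ℝ ∞ (fun y => covWedge (a y) (b y)) V := by
  let L : (E →L[ℝ] E [⋀^Fin 1]→L[ℝ] ℝ) →L[ℝ] E [⋀^Fin 2]→L[ℝ] ℝ :=
    ContinuousAlternatingMap.alternatizeUncurryFinCLM ℝ E ℝ
  exact L.contDiff.comp_contDiffOn (ha.smulRight hb)

/-- The variation of the Duistermaat-Heckman density in the direction `(χ Ψ, d(χ β))`, in the chart
at `j`. -/
def cutoffVariation (φ : LieDual d → ℝ) (Φ Ψ : M → LieDual d) (σ τ : DiffForm (2 * n) M 2)
    (β : DiffForm (2 * n) M 1) (χ : M → ℝ) (j : M) (y : 𝔼) : ℝ :=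
  χ ((extChartAt (𝓡 (2 * n)) j).symm y) *
      variation φ (Φ ∘ (extChartAt (𝓡 (2 * n)) j).symm) (Ψ ∘ (extChartAt (𝓡 (2 * n)) j).symm)
        (σ.inChart j) (τ.inChart j) y +
    φ (Φ ((extChartAt (𝓡 (2 * n)) j).symm y)) * fderiv ℝ pf (σ.inChart j y)
      (covWedge (fderiv ℝ (χ ∘ (extChartAt (𝓡 (2 * n)) j).symm) y) (β.inChart j y))

/-- All the forms involved are pulled back by the coordinate change, and `pf` and its derivative
each pick up one factor of the Jacobian determinant. -/
lemma cutoffVariation_chartChange {φ : LieDual d → ℝ} {Φ Ψ : M → LieDual d}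
    {σ τ : DiffForm (2 * n) M 2} {β : DiffForm (2 * n) M 1} {χ : M → ℝ}
    (hχ : ContMDiff (𝓡 (2 * n)) 𝓘(ℝ, ℝ) ∞ χ) {i j : M} {y : 𝔼}
    (hy : y ∈ (extChartAt (𝓡 (2 * n)) j).target)
    (hi : (extChartAt (𝓡 (2 * n)) j).symm y ∈ (extChartAt (𝓡 (2 * n)) i).source) :
    cutoffVariation φ Φ Ψ σ τ β χ j y = (fderiv ℝ (chartChange j i) y).det *
      cutoffVariation φ Φ Ψ σ τ β χ i (chartChange j i y) := by
  have e0 : (extChartAt (𝓡 (2 * n)) i).symm (chartChange j i y) =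
      (extChartAt (𝓡 (2 * n)) j).symm y := (extChartAt (𝓡 (2 * n)) i).left_inv hi
  have e1 : ∀ {k : ℕ} (ς : DiffForm (2 * n) M k), ς.inChart j y =
      (ς.inChart i (chartChange j i y)).compContinuousLinearMap
        (fderiv ℝ (chartChange j i) y) := fun ς =>
    ς.pull_eq (mdifferentiableAt_extChartAt_symm hy) hi
  have e2 : fderiv ℝ (χ ∘ (extChartAt (𝓡 (2 * n)) j).symm) y =
      (fderiv ℝ (χ ∘ (extChartAt (𝓡 (2 * n)) i).symm) (chartChange j i y)).comp
        (fderiv ℝ (chartChange j i) y) := by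
    have hκ := (contDiffAt_chartChange hy hi).differentiableAt (by simp)
    have hχi : DifferentiableAt ℝ (χ ∘ (extChartAt (𝓡 (2 * n)) i).symm) (chartChange j i y) := by
      have h := (hχ.contMDiffAt (x := (extChartAt (𝓡 (2 * n)) i).symm (chartChange j i y))).comp
        (chartChange j i y) ((contMDiffOn_extChartAt_symm (n := ∞) i).contMDiffAt
          ((isOpen_extTarget i).mem_nhds ((extChartAt (𝓡 (2 * n)) i).map_source hi)))
      exact (contMDiffAt_iff_contDiffAt.1 h).differentiableAt (by simp)
    rw [← fderiv_comp y hχi hκ]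
    refine Filter.EventuallyEq.fderiv_eq ?_
    have hc := ((contMDiffOn_extChartAt_symm (I := 𝓡 (2 * n)) (n := ∞) j).contMDiffAt
      ((isOpen_extTarget j).mem_nhds hy)).continuousAt
    filter_upwards [hc ((isOpen_extChartAt_source i).mem_nhds hi)] with z hz
    simp only [Function.comp_apply, chartChange]
    rw [(extChartAt (𝓡 (2 * n)) i).left_inv hz]
  simp only [cutoffVariation, variation, Function.comp_apply, e0]
  rw [e2, e1 σ, e1 τ, e1 β, covWedge_comp, fderiv_pf_comp, fderiv_pf_comp, pf_comp]
  ring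

variable {G : Type*} [Group G] [TopologicalSpace G] [ChartedSpace (EuclideanSpace ℝ (Fin d)) G]
  [MulAction G M]

/-- The moment map equation in a chart. -/
lemma IsHamiltonian.fderiv_comp_symm {U : Set M} {σ : DiffForm (2 * n) M 2} {Φ : M → LieDual d}
    (h : IsHamiltonian G U σ Φ) {j : M} {y : 𝔼} (hy : y ∈ chartDomain U j) (X : LieAlg d) (w : 𝔼) :
    fderiv ℝ (Φ ∘ (extChartAt (𝓡 (2 * n)) j).symm) y w X = σ.inChart j y
      ![chartVec j ((extChartAt (𝓡 (2 * n)) j).symm y)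
        (fundamentalField G X ((extChartAt (𝓡 (2 * n)) j).symm y)), w] := by
  set x := (extChartAt (𝓡 (2 * n)) j).symm y with hx
  have hyV := isOpen_chartDomain h.isOpen j |>.mem_nhds hy
  have hxs : x ∈ (extChartAt (𝓡 (2 * n)) j).source := (extChartAt (𝓡 (2 * n)) j).map_target hy.1
  have hyx : extChartAt (𝓡 (2 * n)) j x = y := (extChartAt (𝓡 (2 * n)) j).right_inv hy.1
  have hΦd : DifferentiableAt ℝ (Φ ∘ (extChartAt (𝓡 (2 * n)) j).symm) y :=
    ((contDiffOn_comp_symm h.smooth_moment j).contDiffAt hyV).differentiableAt (by simp)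
  have hΦx : MDifferentiableAt (𝓡 (2 * n)) 𝓘(ℝ, LieDual d) Φ x :=
    (h.smooth_moment.contMDiffAt (h.isOpen.mem_nhds hy.2)).mdifferentiableAt (by simp)
  let ev : LieDual d →L[ℝ] ℝ := ContinuousLinearMap.apply ℝ ℝ X
  have hΦX : MDifferentiableAt (𝓡 (2 * n)) 𝓘(ℝ, ℝ) (fun z => Φ z X) x :=
    (ev.differentiableAt.mdifferentiableAt).comp x hΦx
  have e1 : fderiv ℝ (Φ ∘ (extChartAt (𝓡 (2 * n)) j).symm) y w X =
      fderiv ℝ ((fun z => Φ z X) ∘ (extChartAt (𝓡 (2 * n)) j).symm) y w := by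
    have := (ev.hasFDerivAt.comp y hΦd.hasFDerivAt).fderiv
    exact (congrArg (fun T => T w) this).symm
  have e2 : (fderiv ℝ ((fun z => Φ z X) ∘ (extChartAt (𝓡 (2 * n)) j).symm) y w : ℝ) =
      mfderiv (𝓡 (2 * n)) 𝓘(ℝ, ℝ) (fun z => Φ z X) x
        (mfderiv 𝓘(ℝ, 𝔼) (𝓡 (2 * n)) (extChartAt (𝓡 (2 * n)) j).symm y w) := by
    rw [← mfderiv_eq_fderiv]
    have := mfderiv_comp y hΦX (mdifferentiableAt_extChartAt_symm hy.1)
    exact congrArg (fun T : 𝔼 →L[ℝ] ℝ => T w) this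
  rw [e1, e2, h.hamilton X x hy.2]
  have e3 := mfderiv_symm_chartVec hxs (fundamentalField G X x)
  rw [hyx] at e3
  have e4 : σ.inChart j y ![chartVec j x (fundamentalField G X x), w] = σ x
      ((mfderiv 𝓘(ℝ, 𝔼) (𝓡 (2 * n)) (extChartAt (𝓡 (2 * n)) j).symm y : 𝔼 →L[ℝ] 𝔼) ∘
        ![chartVec j x (fundamentalField G X x), w]) := rfl
  rw [e4]
  congr 1
  ext i
  fin_cases i
  · exact e3.symm
  · rfl

lemma inChart_chartVec {β : DiffForm (2 * n) M 1} {j : M} {y : 𝔼}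
    (hy : y ∈ (extChartAt (𝓡 (2 * n)) j).target)
    (w : TangentSpace (𝓡 (2 * n)) ((extChartAt (𝓡 (2 * n)) j).symm y)) :
    β.inChart j y ![chartVec j ((extChartAt (𝓡 (2 * n)) j).symm y) w] =
      β ((extChartAt (𝓡 (2 * n)) j).symm y) ![w] := by
  have e3 := mfderiv_symm_chartVec ((extChartAt (𝓡 (2 * n)) j).map_target hy) w
  rw [(extChartAt (𝓡 (2 * n)) j).right_inv hy] at e3
  have e4 : β.inChart j y ![chartVec j ((extChartAt (𝓡 (2 * n)) j).symm y) w] =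
      β ((extChartAt (𝓡 (2 * n)) j).symm y)
      ((mfderiv 𝓘(ℝ, 𝔼) (𝓡 (2 * n)) (extChartAt (𝓡 (2 * n)) j).symm y : 𝔼 →L[ℝ] 𝔼) ∘
        ![chartVec j ((extChartAt (𝓡 (2 * n)) j).symm y) w]) := rfl
  rw [e4]
  congr 1
  ext i
  fin_cases i
  exact e3

variable [T2Space M] [SecondCountableTopology M]

/-- The Duistermaat-Heckman integral as a finite sum of integrals in charts. -/
lemma DH_eq_sum (o : ManifoldOrientation (2 * n) M) {U K : Set M} {S : Finset M}
    (hS : ∀ j, (tsupport (chartPartition (2 * n) M j) ∩ K).Nonempty → j ∈ S)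
    (σ : DiffForm (2 * n) M 2) (Φ : M → LieDual d)
    (φ : 𝓓((⊤ : TopologicalSpace.Opens (LieDual d)), ℝ))
    (h0 : ∀ x ∈ U, x ∉ K → φ (Φ x) = 0) :
    DH o U σ Φ φ = ∑ j ∈ S, ∫ y in chartDomain U j,
      (chartPartition (2 * n) M j ((extChartAt (𝓡 (2 * n)) j).symm y) * chartSign o j y) *
        (φ (Φ ((extChartAt (𝓡 (2 * n)) j).symm y)) * pf (σ.inChart j y)) := by
  have hpf : ∀ (j : M) (y : 𝔼), ((n.factorial : ℝ)⁻¹ •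
      wedgePow (σ ((extChartAt (𝓡 (2 * n)) j).symm y)).toAlternatingMap n) (chartFrame j y) =
      pf (σ.inChart j y) := by
    intro j y
    let A : 𝔼 →L[ℝ] 𝔼 := mfderiv 𝓘(ℝ, 𝔼) (𝓡 (2 * n)) (extChartAt (𝓡 (2 * n)) j).symm y
    have h1 : (σ.inChart j y).toAlternatingMap =
      (show 𝔼 [⋀^Fin 2]→L[ℝ] ℝ from σ ((extChartAt (𝓡 (2 * n)) j).symm
        y)).toAlternatingMap.compLinearMap (A : 𝔼 →ₗ[ℝ] 𝔼) := rfl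
    rw [pf, h1, wedgePow_compLinearMap]
    rfl
  have h1 : DH o U σ Φ φ = ∑ᶠ j : M, ∫ y in chartDomain U j,
      (chartPartition (2 * n) M j ((extChartAt (𝓡 (2 * n)) j).symm y) * chartSign o j y) *
        (φ (Φ ((extChartAt (𝓡 (2 * n)) j).symm y)) * pf (σ.inChart j y)) := by
    rw [DH, integralForm]
    simp only [hpf, mul_assoc]
    rfl
  rw [h1]
  refine finsum_eq_sum_of_support_subset _ fun j hj => ?_
  by_contra hjS
  refine hj ?_
  refine setIntegral_eq_zero_of_forall_eq_zero fun y hy => ?_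
  by_cases hK : (extChartAt (𝓡 (2 * n)) j).symm y ∈ K
  · have : chartPartition (2 * n) M j ((extChartAt (𝓡 (2 * n)) j).symm y) = 0 := by
      by_contra hne
      exact hjS (hS j ⟨_, subset_tsupport _ hne, hK⟩)
    rw [this]; ring
  · rw [h0 _ hy.2 hK]; ring

end Cobordism

/-! ### Invariance of the Duistermaat-Heckman integral under exact changes -/

section KeyLemma

variable {d n : ℕ} {M : Type*} [TopologicalSpace M]
  [ChartedSpace (EuclideanSpace ℝ (Fin (2 * n))) M] [IsManifold (𝓡 (2 * n)) ∞ M]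
  [T2Space M] [SecondCountableTopology M]

local notation "𝔼" => EuclideanSpace ℝ (Fin (2 * n))

/-- The part of the compact set `K` that meets the support of the `j`-th partition function, in the
chart at `j`. -/
def chartCompact (m : ℕ) {M : Type*} [TopologicalSpace M]
    [ChartedSpace (EuclideanSpace ℝ (Fin m)) M] [IsManifold (𝓡 m) ∞ M] [T2Space M]
    [SecondCountableTopology M] (K : Set M) (j : M) : Set (EuclideanSpace ℝ (Fin m)) :=
  extChartAt (𝓡 m) j '' (K ∩ tsupport (chartPartition m M j))

lemma isCompact_chartCompact {K : Set M} (hK : IsCompact K) (j : M) :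
    IsCompact (chartCompact (2 * n) K j) :=
  (hK.inter_right (isClosed_tsupport _)).image_of_continuousOn
    ((continuousOn_extChartAt j).mono (inter_subset_right.trans (tsupport_chartPartition_subset j)))

lemma chartCompact_subset {U K : Set M} (hKU : K ⊆ U) (j : M) :
    chartCompact (2 * n) K j ⊆ chartDomain U j := by
  rintro _ ⟨x, hx, rfl⟩
  have hs := tsupport_chartPartition_subset j hx.2
  refine ⟨(extChartAt (𝓡 (2 * n)) j).map_source hs, ?_⟩
  rw [mem_preimage, (extChartAt (𝓡 (2 * n)) j).left_inv hs]
  exact hKU hx.1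

lemma notMem_chartCompact {K : Set M} {j : M} {y : 𝔼} (hy : y ∈ (extChartAt (𝓡 (2 * n)) j).target)
    (h : y ∉ chartCompact (2 * n) K j) : (extChartAt (𝓡 (2 * n)) j).symm y ∉ K ∨
      (extChartAt (𝓡 (2 * n)) j).symm y ∉ tsupport (chartPartition (2 * n) M j) := by
  by_contra! hc
  exact h ⟨_, hc, (extChartAt (𝓡 (2 * n)) j).right_inv hy⟩

lemma cutoffVariation_eq_zero_of_notMem {φ : LieDual d → ℝ} {Φ Ψ : M → LieDual d}
    {σ τ : DiffForm (2 * n) M 2} {β : DiffForm (2 * n) M 1} {χ : M → ℝ} {j : M} {y : 𝔼}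
    (h : Φ ((extChartAt (𝓡 (2 * n)) j).symm y) ∉ tsupport φ) :
    cutoffVariation φ Φ Ψ σ τ β χ j y = 0 := by
  obtain ⟨h1, h2⟩ := notMem_tsupport_apply h
  simp only [cutoffVariation, variation, Function.comp_apply, h1, h2]
  simp

lemma cutoffVariation_eq_zero_of_tsupport {φ : LieDual d → ℝ} {Φ Ψ : M → LieDual d}
    {σ τ : DiffForm (2 * n) M 2} {β : DiffForm (2 * n) M 1} {χ : M → ℝ} {j : M} {y : 𝔼}
    (hy : y ∈ (extChartAt (𝓡 (2 * n)) j).target)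
    (h : (extChartAt (𝓡 (2 * n)) j).symm y ∉ tsupport χ) :
    cutoffVariation φ Φ Ψ σ τ β χ j y = 0 := by
  have hc := ((contMDiffOn_extChartAt_symm (I := 𝓡 (2 * n)) (n := ∞) j).contMDiffAt
      ((isOpen_extTarget j).mem_nhds hy)).continuousAt
  have h1 : χ ∘ (extChartAt (𝓡 (2 * n)) j).symm =ᶠ[𝓝 y] fun _ => (0 : ℝ) := by
    filter_upwards [hc ((isClosed_tsupport χ).isOpen_compl.mem_nhds h)] with z hz
    exact image_eq_zero_of_notMem_tsupport (f := χ) hz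
  have h2 : fderiv ℝ (χ ∘ (extChartAt (𝓡 (2 * n)) j).symm) y = 0 := by
    rw [h1.fderiv_eq]; simp
  have h3 : ∀ b : 𝔼 [⋀^Fin 1]→L[ℝ] ℝ, covWedge (0 : 𝔼 →L[ℝ] ℝ) b = 0 := fun b =>
    alternating_two_ext fun u w => by simp [covWedge_apply]
  simp only [cutoffVariation]
  rw [h2, h3, image_eq_zero_of_notMem_tsupport h]
  simp

variable {U K : Set M} {φ : LieDual d → ℝ} {Φ Ψ : M → LieDual d} {σ : DiffForm (2 * n) M 2}
  {β : DiffForm (2 * n) M 1}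

lemma contDiffOn_cutoffVariation (hU : IsOpen U) (hφ : ContDiff ℝ ∞ φ)
    (hΦ : ContMDiffOn (𝓡 (2 * n)) 𝓘(ℝ, LieDual d) ∞ Φ U)
    (hΨ : ContMDiffOn (𝓡 (2 * n)) 𝓘(ℝ, LieDual d) ∞ Ψ U) (hσ : σ.SmoothOn U) (hβ : β.SmoothOn U)
    {χ : M → ℝ} (hχ : ContMDiff (𝓡 (2 * n)) 𝓘(ℝ, ℝ) ∞ χ) (j : M) :
    ContDiffOn ℝ ∞ (cutoffVariation φ Φ Ψ σ (dForm β) β χ j) (chartDomain U j) := by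
  have hχj := contDiffOn_comp_symm (hχ.contMDiffOn (s := U)) j
  refine (hχj.mul (contDiffOn_variation hφ (contDiffOn_comp_symm hΦ j) (contDiffOn_comp_symm hΨ j)
    (hσ j) (hβ.dForm hU j))).add ((hφ.comp_contDiffOn (contDiffOn_comp_symm hΦ j)).mul
    ((contDiff_infty_fderiv_pf.comp_contDiffOn (hσ j)).clm_apply
      (contDiffOn_covWedge ?_ (hβ j))))
  exact hχj.fderiv_of_isOpen (isOpen_chartDomain hU j) (by simp)

/-- The `i`-th partition function localizes `β` to the chart at `i`, where Stokes' theorem applies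
with cutoff equal to the orientation sign times that function. A point off the compact set used
there is either outside `K`, where `Φ` avoids the support of `φ`, or outside the support of the
cutoff. -/
lemma setIntegral_cutoffVariation_eq_zero (o : ManifoldOrientation (2 * n) M) (hU : IsOpen U)
    (hK : IsCompact K) (hKU : K ⊆ U) (hφ : ContDiff ℝ ∞ φ)
    (hΦ : ContMDiffOn (𝓡 (2 * n)) 𝓘(ℝ, LieDual d) ∞ Φ U) (hσ : σ.SmoothOn U)
    (hσc : σ.ClosedOn U) (hβ : β.SmoothOn U) (h0 : ∀ x ∈ U, x ∉ K → Φ x ∉ tsupport φ) (i : M)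
    (hham : ∀ y ∈ chartDomain U i, ∀ X : LieAlg d, ∃ Y : 𝔼,
      (∀ w, fderiv ℝ (Φ ∘ (extChartAt (𝓡 (2 * n)) i).symm) y w X = σ.inChart i y ![Y, w]) ∧
        Ψ ((extChartAt (𝓡 (2 * n)) i).symm y) X = - β.inChart i y ![Y]) :
    ∫ y in chartDomain U i, chartSign o i y *
      cutoffVariation φ Φ Ψ σ (dForm β) β (chartPartition (2 * n) M i) i y = 0 := by
  have hV := isOpen_chartDomain (m := 2 * n) hU i
  have hχ := contDiffOn_comp_symm ((chartPartition (2 * n) M i).contMDiff.contMDiffOn (s := U)) i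
  have hsg := (contDiffOn_chartSign o i).mono (inter_subset_left (t :=
    (extChartAt (𝓡 (2 * n)) i).symm ⁻¹' U))
  have key := setIntegral_variation_eq_zero (Fd := Ψ ∘ (extChartAt (𝓡 (2 * n)) i).symm) hV
    (isCompact_chartCompact hK i) (chartCompact_subset hKU i) hφ (contDiffOn_comp_symm hΦ i) (hσ i)
    (hσc i) (hβ i) (hsg.mul hχ) (fun y hy hyK => ?_) hham
  · rw [← key]
    refine setIntegral_congr_fun hV.measurableSet fun y hy => ?_
    have hd : fderiv ℝ (fun y => chartSign o i y *
        (chartPartition (2 * n) M i ∘ (extChartAt (𝓡 (2 * n)) i).symm) y) y =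
        chartSign o i y • fderiv ℝ (chartPartition (2 * n) M i ∘
          (extChartAt (𝓡 (2 * n)) i).symm) y := by
      refine ((hasFDerivAt_chartSign o hy.1).mul ((hχ.contDiffAt
        (hV.mem_nhds hy)).differentiableAt (by simp)).hasFDerivAt).fderiv.trans ?_
      simp
    have hv : variation φ (Φ ∘ (extChartAt (𝓡 (2 * n)) i).symm)
        (Ψ ∘ (extChartAt (𝓡 (2 * n)) i).symm) (σ.inChart i) (extDeriv (β.inChart i)) y =
        variation φ (Φ ∘ (extChartAt (𝓡 (2 * n)) i).symm)
        (Ψ ∘ (extChartAt (𝓡 (2 * n)) i).symm) (σ.inChart i) ((dForm β).inChart i) y := by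
      rw [variation, variation, hβ.inChart_dForm hU hy]
    rw [hd, hv, covWedge_smul_left, map_smul, cutoffVariation]
    simp only [Function.comp_apply, smul_eq_mul]
    ring
  · rcases notMem_chartCompact hy.1 hyK with h | h
    · exact Or.inr (h0 _ hy.2 h)
    · refine Or.inl ?_
      simp only [Function.comp_apply, image_eq_zero_of_notMem_tsupport h, mul_zero]

/-- The variation weighted by `ρ j` is not exact in the chart at `j`. So `β` is split as the sum of
the `ρ i β`: for each fixed `i`, the sum over `j` only reassembles the integral of a density
supported in the chart at `i`, and that integral vanishes by Stokes' theorem. -/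
lemma sum_setIntegral_variation_eq_zero (o : ManifoldOrientation (2 * n) M) (hU : IsOpen U)
    (hK : IsCompact K) (hKU : K ⊆ U) (hφ : ContDiff ℝ ∞ φ)
    (hΦ : ContMDiffOn (𝓡 (2 * n)) 𝓘(ℝ, LieDual d) ∞ Φ U)
    (hΨ : ContMDiffOn (𝓡 (2 * n)) 𝓘(ℝ, LieDual d) ∞ Ψ U) (hσ : σ.SmoothOn U)
    (hσc : σ.ClosedOn U) (hβ : β.SmoothOn U) (h0 : ∀ x ∈ U, x ∉ K → Φ x ∉ tsupport φ)
    (hham : ∀ i : M, ∀ y ∈ chartDomain U i, ∀ X : LieAlg d, ∃ Y : 𝔼,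
      (∀ w, fderiv ℝ (Φ ∘ (extChartAt (𝓡 (2 * n)) i).symm) y w X = σ.inChart i y ![Y, w]) ∧
        Ψ ((extChartAt (𝓡 (2 * n)) i).symm y) X = - β.inChart i y ![Y]) {S : Finset M}
    (hS : ∀ j, (tsupport (chartPartition (2 * n) M j) ∩ K).Nonempty → j ∈ S) :
    ∑ j ∈ S, ∫ y in chartDomain U j,
      (chartPartition (2 * n) M j ((extChartAt (𝓡 (2 * n)) j).symm y) * chartSign o j y) *
        variation φ (Φ ∘ (extChartAt (𝓡 (2 * n)) j).symm) (Ψ ∘ (extChartAt (𝓡 (2 * n)) j).symm)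
          (σ.inChart j) ((dForm β).inChart j) y = 0 := by
  set ρ := chartPartition (2 * n) M with hρ
  have hsm : ∀ i j : M, ContDiffOn ℝ ∞ (fun y => ρ j ((extChartAt (𝓡 (2 * n)) i).symm y) *
      (chartSign o i y * cutoffVariation φ Φ Ψ σ (dForm β) β (ρ j) i y)) (chartDomain U i) := fun i j =>
    (contDiffOn_comp_symm ((ρ j).contMDiff.contMDiffOn (s := U)) i).mul
      (((contDiffOn_chartSign o i).mono inter_subset_left).mul
        (contDiffOn_cutoffVariation hU hφ hΦ hΨ hσ hβ (ρ j).contMDiff i))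
  have hint : ∀ i k l : M, (k = i ∨ l = i) → IntegrableOn
      (fun y => ρ k ((extChartAt (𝓡 (2 * n)) i).symm y) *
      (chartSign o i y * cutoffVariation φ Φ Ψ σ (dForm β) β (ρ l) i y)) (chartDomain U i) := by
    intro i k l hkl
    refine integrableOn_of_contDiffOn (isOpen_chartDomain hU i) (isCompact_chartCompact hK i)
      (chartCompact_subset hKU i) ((contDiffOn_comp_symm ((ρ k).contMDiff.contMDiffOn (s := U)) i).mul
      (((contDiffOn_chartSign o i).mono inter_subset_left).mul
        (contDiffOn_cutoffVariation hU hφ hΦ hΨ hσ hβ (ρ l).contMDiff i))) fun y hy hyK => ?_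
    rcases notMem_chartCompact hy.1 hyK with h | h
    · simp only [cutoffVariation_eq_zero_of_notMem (h0 _ hy.2 h), mul_zero]
    · rcases hkl with rfl | rfl
      · simp only [Function.comp_apply, hρ, image_eq_zero_of_notMem_tsupport h, zero_mul]
      · simp only [hρ, cutoffVariation_eq_zero_of_tsupport hy.1 h, mul_zero]
  have h1 : ∀ j ∈ S, ∫ y in chartDomain U j,
      (ρ j ((extChartAt (𝓡 (2 * n)) j).symm y) * chartSign o j y) *
        variation φ (Φ ∘ (extChartAt (𝓡 (2 * n)) j).symm) (Ψ ∘ (extChartAt (𝓡 (2 * n)) j).symm)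
          (σ.inChart j) ((dForm β).inChart j) y =
      ∑ i ∈ S, ∫ y in chartDomain U j, ρ j ((extChartAt (𝓡 (2 * n)) j).symm y) *
        (chartSign o j y * cutoffVariation φ Φ Ψ σ (dForm β) β (ρ i) j y) := by
    intro j hj
    rw [← integral_finset_sum _ fun i _ => hint j j i (Or.inl rfl)]
    refine setIntegral_congr_fun (isOpen_chartDomain hU j).measurableSet fun y hy => ?_
    simp only [← Finset.mul_sum, mul_assoc]
    congr 2
    by_cases hyK : (extChartAt (𝓡 (2 * n)) j).symm y ∈ K
    · have hc := ((contMDiffOn_extChartAt_symm (I := 𝓡 (2 * n)) (n := ∞) j).contMDiffAt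
        ((isOpen_extTarget j).mem_nhds hy.1)).continuousAt
      have hev := eventually_sum_chartPartition hS hyK
      have hone : ∑ i ∈ S, ρ i ((extChartAt (𝓡 (2 * n)) j).symm y) = 1 := hev.self_of_nhds
      -- The extra terms with `dρ i`, which make each summand exact, cancel in the sum because the
      -- functions add up to `1` near the point.
      have hd : ∑ i ∈ S, fderiv ℝ (ρ i ∘ (extChartAt (𝓡 (2 * n)) j).symm) y = 0 := by
        rw [← fderiv_fun_sum fun i _ => ((contDiffOn_comp_symm ((ρ i).contMDiff.contMDiffOn
          (s := U)) j).contDiffAt ((isOpen_chartDomain hU j).mem_nhds hy)).differentiableAt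
          (by simp)]
        have : (fun z => ∑ i ∈ S, (ρ i ∘ (extChartAt (𝓡 (2 * n)) j).symm) z) =ᶠ[𝓝 y]
            fun _ => (1 : ℝ) := by
          filter_upwards [hc.eventually hev] with z hz
          exact hz
        rw [this.fderiv_eq]; simp
      let T : (𝔼 →L[ℝ] ℝ) →ₗ[ℝ] ℝ :=
        { toFun := fun a => fderiv ℝ pf (σ.inChart j y) (covWedge a (β.inChart j y))
          map_add' := fun a b => by simp only [covWedge_add_left, map_add]
          map_smul' := fun r a => by simp only [covWedge_smul_left, map_smul]; rfl }
      have hT : ∑ i ∈ S, fderiv ℝ pf (σ.inChart j y) (covWedge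
          (fderiv ℝ (ρ i ∘ (extChartAt (𝓡 (2 * n)) j).symm) y) (β.inChart j y)) = 0 := by
        have := map_sum T (fun i => fderiv ℝ (ρ i ∘ (extChartAt (𝓡 (2 * n)) j).symm) y) S
        rw [hd, map_zero] at this
        exact this.symm
      simp only [cutoffVariation]
      rw [Finset.sum_add_distrib, ← Finset.sum_mul, ← Finset.mul_sum, hone, hT]
      ring
    · rw [Finset.sum_eq_zero fun i _ => cutoffVariation_eq_zero_of_notMem (h0 _ hy.2 hyK)]
      obtain ⟨h1, h2⟩ := notMem_tsupport_apply (h0 _ hy.2 hyK)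
      simp only [variation, Function.comp_apply, h1, h2]
      simp
  rw [Finset.sum_congr rfl h1, Finset.sum_comm]
  refine Finset.sum_eq_zero fun i _ => ?_
  rw [sum_setIntegral_density o hU (ρ := fun j => ρ j)
    (δ := cutoffVariation φ Φ Ψ σ (dForm β) β (ρ i)) (i := i)]
  · exact setIntegral_cutoffVariation_eq_zero o hU hK hKU hφ hΦ hσ hσc hβ h0 i (hham i)
  · exact fun j x hx => image_eq_zero_of_notMem_tsupport
      fun h => hx (tsupport_chartPartition_subset j h)
  · exact fun j y hy => cutoffVariation_chartChange (ρ i).contMDiff hy.1 hy.2.2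
  · exact fun j y hy h => cutoffVariation_eq_zero_of_tsupport hy.1
      fun h' => h (tsupport_chartPartition_subset i h')
  · intro y hy
    by_cases hyK : (extChartAt (𝓡 (2 * n)) i).symm y ∈ K
    · exact Or.inr (eventually_sum_chartPartition hS hyK).self_of_nhds
    · exact Or.inl (cutoffVariation_eq_zero_of_notMem (h0 _ hy.2 hyK))
  · exact fun j _ => hint i j i (Or.inr rfl)

variable {G : Type*} [Group G] [TopologicalSpace G] [ChartedSpace (EuclideanSpace ℝ (Fin d)) G]
  [MulAction G M]

/-- An exact change `(dβ, -β(·♯))` of a Hamiltonian structure that keeps the moment map off the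
support of `φ` outside a compact set does not change the Duistermaat-Heckman integral of `φ`. -/
theorem DH_eq_of_exact (o : ManifoldOrientation (2 * n) M) {σ₀ σ₁ : DiffForm (2 * n) M 2}
    {Φ₀ Φ₁ : M → LieDual d} (hK : IsCompact K) (hKU : K ⊆ U) (H₀ : IsHamiltonian G U σ₀ Φ₀)
    (H₁ : IsHamiltonian G U σ₁ Φ₁) (hβ : β.SmoothOn U)
    (hσ : ∀ x ∈ U, σ₁ x = σ₀ x + dForm β x)
    (hΦ : ∀ x ∈ U, ∀ X : LieAlg d, Φ₁ x X - Φ₀ x X = - β x ![fundamentalField G X x])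
    (φ : 𝓓((⊤ : TopologicalSpace.Opens (LieDual d)), ℝ))
    (hφ : ∀ x ∈ U, x ∉ K → ∀ r ∈ Icc (0 : ℝ) 1, Φ₀ x + r • (Φ₁ x - Φ₀ x) ∉ tsupport φ) :
    DH o U σ₀ Φ₀ φ = DH o U σ₁ Φ₁ φ := by
  have hU := H₀.isOpen
  have hφs : ContDiff ℝ ∞ φ := φ.contDiff
  set ρ := chartPartition (2 * n) M with hρ
  set S : Finset M := (finite_tsupport_chartPartition_inter (m := 2 * n) hK).toFinset with hSdef
  have hS : ∀ j, (tsupport (ρ j) ∩ K).Nonempty → j ∈ S := fun j hj => by simpa [hSdef] using hj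
  set Ψ : M → LieDual d := fun x => Φ₁ x - Φ₀ x with hΨdef
  have hΨ : ContMDiffOn (𝓡 (2 * n)) 𝓘(ℝ, LieDual d) ∞ Ψ U := H₁.smooth_moment.sub H₀.smooth_moment
  -- A smooth parameter with values in `[0, 1]` for every real `t`. The support condition, known
  -- only on the segment, then holds for all times, and `J` can be differentiated on the whole line.
  set c : ℝ → ℝ := Real.smoothTransition with hc
  have hcs : ContDiff ℝ ∞ c := Real.smoothTransition.contDiff
  have hc01 : ∀ t, c t ∈ Icc (0 : ℝ) 1 := fun t =>
    ⟨Real.smoothTransition.nonneg t, Real.smoothTransition.le_one t⟩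
  let J : ℝ → ℝ := fun t => ∑ j ∈ S, ∫ y in chartDomain U j,
      (ρ j ((extChartAt (𝓡 (2 * n)) j).symm y) * chartSign o j y) *
        (φ (Φ₀ ((extChartAt (𝓡 (2 * n)) j).symm y) + c t • Ψ ((extChartAt (𝓡 (2 * n)) j).symm y)) *
          pf (σ₀.inChart j y + c t • (dForm β).inChart j y))
  have hφ0 : ∀ x ∈ U, x ∉ K → ∀ t, Φ₀ x + c t • Ψ x ∉ tsupport φ := fun x hx hxK t =>
    hφ x hx hxK _ (hc01 t)
  have hder : ∀ t, HasDerivAt J 0 t := by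
    intro t
    have h1 : ∀ j ∈ S, HasDerivAt (fun t => ∫ y in chartDomain U j,
        (ρ j ((extChartAt (𝓡 (2 * n)) j).symm y) * chartSign o j y) *
        (φ (Φ₀ ((extChartAt (𝓡 (2 * n)) j).symm y) + c t • Ψ ((extChartAt (𝓡 (2 * n)) j).symm y)) *
          pf (σ₀.inChart j y + c t • (dForm β).inChart j y))) _ t := fun j _ =>
      hasDerivAt_setIntegral_variation
        (h := fun y => ρ j ((extChartAt (𝓡 (2 * n)) j).symm y) * chartSign o j y)
        (F := Φ₀ ∘ (extChartAt (𝓡 (2 * n)) j).symm)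
        (Fd := Ψ ∘ (extChartAt (𝓡 (2 * n)) j).symm)
        (isOpen_chartDomain hU j) (isCompact_chartCompact hK j) (chartCompact_subset hKU j) hφs
        (contDiffOn_comp_symm H₀.smooth_moment j) (contDiffOn_comp_symm hΨ j) (H₀.smooth_form j)
        (hβ.dForm hU j) ((contDiffOn_comp_symm ((ρ j).contMDiff.contMDiffOn (s := U)) j).mul
          ((contDiffOn_chartSign o j).mono inter_subset_left)) hcs (fun y hy hyK => by
            rcases notMem_chartCompact hy.1 hyK with h | h
            · exact Or.inr (hφ0 _ hy.2 h)
            · exact Or.inl (by simp only [hρ, image_eq_zero_of_notMem_tsupport h, zero_mul])) t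
    have h2 := HasDerivAt.fun_sum h1
    rw [← Finset.mul_sum] at h2
    -- Each intermediate structure is closed and, by linearity, satisfies Hamilton's equation, so
    -- the vanishing of the variation applies at every time.
    have hcl : DiffForm.ClosedOn (fun x => σ₀ x + c t • dForm β x : DiffForm (2 * n) M 2) U := by
      intro j y hy
      have hV := (isOpen_chartDomain hU j).mem_nhds hy
      have e : DiffForm.inChart (fun x => σ₀ x + c t • dForm β x : DiffForm (2 * n) M 2) j =
          σ₀.inChart j + c t • (dForm β).inChart j := rfl
      rw [e, extDeriv_add (((H₀.smooth_form j).contDiffAt hV).differentiableAt (by simp))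
        ((((hβ.dForm hU j).contDiffAt hV).differentiableAt (by simp)).const_smul _),
        extDeriv_smul, H₀.closed_form j y hy, hβ.closedOn_dForm hU j y hy]
      simp
    have hΨc : ContMDiffOn (𝓡 (2 * n)) 𝓘(ℝ, LieDual d) ∞ (fun x => c t • Ψ x) U :=
      (contMDiffOn_const (I' := 𝓘(ℝ, ℝ)) (c := c t)).smul hΨ
    have hsum := sum_setIntegral_variation_eq_zero (φ := φ) (Ψ := Ψ)
      (Φ := fun x => Φ₀ x + c t • Ψ x)
      (σ := fun x => σ₀ x + c t • dForm β x) o hU hK hKU hφs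
      (H₀.smooth_moment.add hΨc) hΨ
      (fun j => (H₀.smooth_form j).add ((hβ.dForm hU j).const_smul (c t))) hcl hβ
      (fun x hx hxK => hφ0 x hx hxK t) (fun i y hy X => ?_) hS
    · simp only [Function.comp_def] at h2 hsum
      have hz : deriv c t * _ = 0 := mul_eq_zero_of_right _ hsum
      exact hz ▸ h2
    · refine ⟨chartVec i ((extChartAt (𝓡 (2 * n)) i).symm y)
        (fundamentalField G X ((extChartAt (𝓡 (2 * n)) i).symm y)), fun w => ?_, ?_⟩
      · have hV := (isOpen_chartDomain hU i).mem_nhds hy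
        have d0 := ((contDiffOn_comp_symm H₀.smooth_moment i).contDiffAt hV).differentiableAt
          (by simp)
        have d1 := ((contDiffOn_comp_symm H₁.smooth_moment i).contDiffAt hV).differentiableAt
          (by simp)
        have e := (d0.hasFDerivAt.add ((d1.hasFDerivAt.sub d0.hasFDerivAt).const_smul (c t))).fderiv
        have e' : fderiv ℝ ((fun x => Φ₀ x + c t • Ψ x) ∘ (extChartAt (𝓡 (2 * n)) i).symm) y = _ := e
        have es : σ₁.inChart i y = σ₀.inChart i y + (dForm β).inChart i y := by
          rw [DiffForm.inChart, hσ _ hy.2]; rfl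
        have es' : DiffForm.inChart (fun x => σ₀ x + c t • dForm β x : DiffForm (2 * n) M 2) i y =
          σ₀.inChart i y + c t • (dForm β).inChart i y := rfl
        rw [e', es']
        have k0 := H₀.fderiv_comp_symm hy X w
        have k1 := H₁.fderiv_comp_symm hy X w
        rw [es] at k1
        simp only [add_apply, smul_apply, sub_apply, ContinuousAlternatingMap.add_apply,
          ContinuousAlternatingMap.smul_apply, smul_eq_mul] at k0 k1 ⊢
        rw [k0, k1]; ring
      · rw [inChart_chartVec hy.1, ← hΦ _ hy.2 X]
        rfl
  have hJ : J 0 = J 1 :=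
    is_const_of_deriv_eq_zero (fun t => (hder t).differentiableAt) (fun t => (hder t).deriv) 0 1
  have hφz : ∀ x ∈ U, x ∉ K → ∀ r ∈ Icc (0 : ℝ) 1, φ (Φ₀ x + r • (Φ₁ x - Φ₀ x)) = 0 :=
    fun x hx hxK r hr => image_eq_zero_of_notMem_tsupport (hφ x hx hxK r hr)
  rw [DH_eq_sum o hS σ₀ Φ₀ φ (fun x hx hxK => by simpa using hφz x hx hxK 0 (by simp)),
    DH_eq_sum o hS σ₁ Φ₁ φ (fun x hx hxK => by simpa using hφz x hx hxK 1 (by simp))]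
  have c0 : c 0 = 0 := Real.smoothTransition.zero_of_nonpos le_rfl
  have c1 : c 1 = 1 := Real.smoothTransition.one_of_one_le le_rfl
  have J0 : J 0 = ∑ j ∈ S, ∫ y in chartDomain U j,
      (ρ j ((extChartAt (𝓡 (2 * n)) j).symm y) * chartSign o j y) *
        (φ (Φ₀ ((extChartAt (𝓡 (2 * n)) j).symm y)) * pf (σ₀.inChart j y)) := by
    simp only [J, c0, zero_smul, add_zero]
  rw [← J0, hJ]
  refine Finset.sum_congr rfl fun j _ => setIntegral_congr_fun
    (isOpen_chartDomain hU j).measurableSet fun y hy => ?_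
  have es : σ₁.inChart j y = σ₀.inChart j y + (dForm β).inChart j y := by
    rw [DiffForm.inChart, hσ _ hy.2]; rfl
  simp only [c1, one_smul, hΨdef, es, add_sub_cancel, hρ]

end KeyLemma

/-! ### The action in charts and the fundamental vector fields -/

section Action

variable {d m : ℕ} {G : Type*} [Group G] [TopologicalSpace G]
  [ChartedSpace (EuclideanSpace ℝ (Fin d)) G] [LieGroup (𝓡 d) ∞ G]
  {M : Type*} [TopologicalSpace M] [ChartedSpace (EuclideanSpace ℝ (Fin m)) M]
  [IsManifold (𝓡 m) ∞ M] [MulAction G M] [ContMDiffSMul (𝓡 d) (𝓡 m) ∞ G M]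

local notation "𝔼" => EuclideanSpace ℝ (Fin m)
local notation "𝔾" => EuclideanSpace ℝ (Fin d)

/-- The action in the charts at `g₀` and `j`. -/
def actChart (d m : ℕ) {G : Type*} [Group G] [TopologicalSpace G]
    [ChartedSpace (EuclideanSpace ℝ (Fin d)) G] {M : Type*} [TopologicalSpace M]
    [ChartedSpace (EuclideanSpace ℝ (Fin m)) M] [MulAction G M] (g₀ : G) (j : M)
    (q : EuclideanSpace ℝ (Fin d) × EuclideanSpace ℝ (Fin m)) : M :=
  (extChartAt (𝓡 d) g₀).symm q.1 • (extChartAt (𝓡 m) j).symm q.2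

lemma isOpen_prod_chartDomain {d m : ℕ} {G : Type*} [TopologicalSpace G]
    [ChartedSpace (EuclideanSpace ℝ (Fin d)) G] {M : Type*} [TopologicalSpace M]
    [ChartedSpace (EuclideanSpace ℝ (Fin m)) M] {U : Set M} (hU : IsOpen U) (g₀ : G) (j : M) :
    IsOpen ((extChartAt (𝓡 d) g₀).target ×ˢ chartDomain (m := m) U j) :=
  (isOpen_extTarget g₀).prod (isOpen_chartDomain hU j)

lemma contMDiff_smul_const (x : M) : ContMDiff (𝓡 d) (𝓡 m) ∞ fun g : G => g • x :=
  ContMDiff.smul (I' := 𝓡 m) contMDiff_id contMDiff_const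

lemma contMDiff_const_smul' (d : ℕ) {m : ℕ} {G : Type*} [Group G] [TopologicalSpace G]
    [ChartedSpace (EuclideanSpace ℝ (Fin d)) G] {M : Type*} [TopologicalSpace M]
    [ChartedSpace (EuclideanSpace ℝ (Fin m)) M] [MulAction G M]
    [ContMDiffSMul (𝓡 d) (𝓡 m) ∞ G M] (g : G) :
    ContMDiff (𝓡 m) (𝓡 m) ∞ fun x : M => g • x :=
  ContMDiff.smul (I := 𝓡 d) (I' := 𝓡 m) contMDiff_const contMDiff_id

lemma mdifferentiableAt_const_smul (d : ℕ) {m : ℕ} {G : Type*} [Group G] [TopologicalSpace G]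
    [ChartedSpace (EuclideanSpace ℝ (Fin d)) G] {M : Type*} [TopologicalSpace M]
    [ChartedSpace (EuclideanSpace ℝ (Fin m)) M] [MulAction G M]
    [ContMDiffSMul (𝓡 d) (𝓡 m) ∞ G M] (g : G) (x : M) :
    MDifferentiableAt (𝓡 m) (𝓡 m) (fun y : M => g • y) x :=
  ((contMDiff_const_smul' d g).contMDiffAt (x := x)).mdifferentiableAt (by simp)

lemma mdifferentiableAt_smul_const (g : G) (x : M) :
    MDifferentiableAt (𝓡 d) (𝓡 m) (fun h : G => h • x) g :=
  ((contMDiff_smul_const (m := m) x).contMDiffAt (x := g)).mdifferentiableAt (by simp)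

lemma contMDiffOn_actChart (U : Set M) (g₀ : G) (j : M) :
    ContMDiffOn 𝓘(ℝ, 𝔾 × 𝔼) (𝓡 m) ∞ (actChart d m g₀ j)
      ((extChartAt (𝓡 d) g₀).target ×ˢ chartDomain U j) := by
  have h1 : ContMDiffOn 𝓘(ℝ, 𝔾 × 𝔼) (𝓡 d) ∞ (fun q : 𝔾 × 𝔼 => (extChartAt (𝓡 d) g₀).symm q.1)
      ((extChartAt (𝓡 d) g₀).target ×ˢ chartDomain U j) :=
    (contMDiffOn_extChartAt_symm (I := 𝓡 d) (n := ∞) g₀).comp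
      (contDiff_fst.contMDiff.contMDiffOn) fun q hq => hq.1
  have h2 : ContMDiffOn 𝓘(ℝ, 𝔾 × 𝔼) (𝓡 m) ∞ (fun q : 𝔾 × 𝔼 => (extChartAt (𝓡 m) j).symm q.2)
      ((extChartAt (𝓡 d) g₀).target ×ˢ chartDomain U j) :=
    (contMDiffOn_extChartAt_symm (I := 𝓡 m) (n := ∞) j).comp
      (contDiff_snd.contMDiff.contMDiffOn) fun q hq => hq.2.1
  exact h1.smul h2

lemma mapsTo_actChart {U : Set M} (hU : InvariantSet G U) (g₀ : G) (j : M) :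
    MapsTo (actChart d m g₀ j) ((extChartAt (𝓡 d) g₀).target ×ˢ chartDomain U j) U :=
  fun _ hq => hU _ _ hq.2.2

lemma mdifferentiableAt_actChart {g₀ : G} {j : M} {q : 𝔾 × 𝔼}
    (h1 : q.1 ∈ (extChartAt (𝓡 d) g₀).target) (h2 : q.2 ∈ (extChartAt (𝓡 m) j).target) :
    MDifferentiableAt 𝓘(ℝ, 𝔾 × 𝔼) (𝓡 m) (actChart d m g₀ j) q :=
  mdifferentiableAt_of_contMDiffOn (contMDiffOn_actChart univ g₀ j)
    (isOpen_prod_chartDomain isOpen_univ g₀ j) ⟨h1, h2, mem_univ _⟩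

lemma mfderiv_actChart_inr {g₀ : G} {j : M} {u : 𝔾} {y : 𝔼}
    (hu : u ∈ (extChartAt (𝓡 d) g₀).target) (hy : y ∈ (extChartAt (𝓡 m) j).target) :
    (mfderiv 𝓘(ℝ, 𝔾 × 𝔼) (𝓡 m) (actChart d m g₀ j) (u, y) : 𝔾 × 𝔼 →L[ℝ] 𝔼).comp
      (ContinuousLinearMap.inr ℝ 𝔾 𝔼) = mfderiv 𝓘(ℝ, 𝔼) (𝓡 m)
        (fun z => (extChartAt (𝓡 d) g₀).symm u • (extChartAt (𝓡 m) j).symm z) y := by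
  have h := mfderiv_comp (I := 𝓘(ℝ, 𝔼)) (f := fun z : 𝔼 => (u, z)) y
    (mdifferentiableAt_actChart (q := (u, y)) hu hy)
    (hasFDerivAt_prodMk_right u y).differentiableAt.mdifferentiableAt
  rw [mfderiv_eq_fderiv, (hasFDerivAt_prodMk_right u y).fderiv] at h
  exact h.symm

lemma mfderiv_smul_comp_symm {g : G} (hg : ContMDiff (𝓡 m) (𝓡 m) ∞ fun x : M => g • x) {j : M} {y : 𝔼} (hy : y ∈ (extChartAt (𝓡 m) j).target) :
    mfderiv 𝓘(ℝ, 𝔼) (𝓡 m) (fun z => g • (extChartAt (𝓡 m) j).symm z) y =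
      (mfderiv (𝓡 m) (𝓡 m) (fun x : M => g • x) ((extChartAt (𝓡 m) j).symm y) : 𝔼 →L[ℝ] 𝔼).comp
        (mfderiv 𝓘(ℝ, 𝔼) (𝓡 m) (extChartAt (𝓡 m) j).symm y : 𝔼 →L[ℝ] 𝔼) :=
  mfderiv_comp y ((hg.contMDiffAt).mdifferentiableAt (by simp)) (mdifferentiableAt_extChartAt_symm hy)

/-- The pullback of a form under the action of `g`, in the chart at `j`. -/
lemma pull_smul {g : G} (hg : ContMDiff (𝓡 m) (𝓡 m) ∞ fun x : M => g • x) {k : ℕ} (β : DiffForm m M k) {j : M} {y : 𝔼}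
    (hy : y ∈ (extChartAt (𝓡 m) j).target) :
    β.pull (fun z => g • (extChartAt (𝓡 m) j).symm z) y =
      ((β (g • (extChartAt (𝓡 m) j).symm y)).compContinuousLinearMap
        (mfderiv (𝓡 m) (𝓡 m) (fun x : M => g • x)
          ((extChartAt (𝓡 m) j).symm y))).compContinuousLinearMap
        (mfderiv 𝓘(ℝ, 𝔼) (𝓡 m) (extChartAt (𝓡 m) j).symm y : 𝔼 →L[ℝ] 𝔼) := by
  rw [DiffForm.pull, mfderiv_smul_comp_symm hg hy]
  rfl

lemma pull_actChart_inr {k : ℕ} (β : DiffForm m M k) {g₀ : G} {j : M} {u : 𝔾} {y : 𝔼}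
    (hu : u ∈ (extChartAt (𝓡 d) g₀).target) (hy : y ∈ (extChartAt (𝓡 m) j).target) :
    (β.pull (actChart d m g₀ j) (u, y)).compContinuousLinearMap (ContinuousLinearMap.inr ℝ 𝔾 𝔼) =
      β.pull (fun z => (extChartAt (𝓡 d) g₀).symm u • (extChartAt (𝓡 m) j).symm z) y := by
  rw [DiffForm.pull, DiffForm.pull, ← mfderiv_actChart_inr hu hy]
  rfl

/-- The form `β` is invariant on `U`. -/
def InvariantForm (G : Type*) [Group G] [MulAction G M] {k : ℕ} (U : Set M) (β : DiffForm m M k) :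
    Prop :=
  ∀ (g : G), ∀ x ∈ U,
    (β (g • x)).compContinuousLinearMap (mfderiv (𝓡 m) (𝓡 m) (fun y : M => g • y) x) = β x

lemma InvariantForm.pull_smul {k : ℕ} {U : Set M} {β : DiffForm m M k} (h : InvariantForm G U β)
    {g : G} (hg : ContMDiff (𝓡 m) (𝓡 m) ∞ fun x : M => g • x) {j : M} {y : 𝔼}
    (hy : y ∈ chartDomain U j) :
    β.pull (fun z => g • (extChartAt (𝓡 m) j).symm z) y = β.inChart j y := by
  rw [HamiltonianLocalization.pull_smul hg β hy.1, h g _ hy.2]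
  rfl

/-- The chart of `G` at `1` identifies the fundamental vector field with a partial derivative of the
action. -/
lemma mfderiv_actChart_inl {j : M} {y : 𝔼} (hy : y ∈ (extChartAt (𝓡 m) j).target) (X : 𝔾) :
    (mfderiv 𝓘(ℝ, 𝔾 × 𝔼) (𝓡 m) (actChart d m (1 : G) j) (extChartAt (𝓡 d) (1 : G) 1, y) :
      𝔾 × 𝔼 →L[ℝ] 𝔼) (X, 0) =
      fundamentalField G X ((extChartAt (𝓡 m) j).symm y) := by
  set u := extChartAt (𝓡 d) (1 : G) 1 with hu
  have hut : u ∈ (extChartAt (𝓡 d) (1 : G)).target := mem_extChartAt_target 1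
  have hu1 : (extChartAt (𝓡 d) (1 : G)).symm u = 1 := (extChartAt (𝓡 d) (1 : G)).left_inv
    (mem_extChartAt_source 1)
  have h := mfderiv_comp (I := 𝓘(ℝ, 𝔾)) (f := fun z : 𝔾 => (z, y)) u
    (mdifferentiableAt_actChart (q := (u, y)) hut hy)
    (hasFDerivAt_prodMk_left u y).differentiableAt.mdifferentiableAt
  rw [mfderiv_eq_fderiv, (hasFDerivAt_prodMk_left u y).fderiv] at h
  have h2 := mfderiv_comp_of_eq (I := 𝓘(ℝ, 𝔾)) (f := (extChartAt (𝓡 d) (1 : G)).symm) (x := u)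
    (mdifferentiableAt_smul_const (d := d) (m := m) (1 : G) ((extChartAt (𝓡 m) j).symm y))
    (mdifferentiableAt_extChartAt_symm hut) hu1
  have h3 : mfderiv 𝓘(ℝ, 𝔾) (𝓡 d) (extChartAt (𝓡 d) (1 : G)).symm u =
      ContinuousLinearMap.id ℝ 𝔾 := by
    rw [mfderiv_eq_fderiv_extChartAt (mdifferentiableAt_extChartAt_symm hut), hu1]
    have h4 : extChartAt (𝓡 d) (1 : G) ∘ (extChartAt (𝓡 d) (1 : G)).symm =ᶠ[𝓝 u] id := by
      filter_upwards [(isOpen_extTarget (1 : G)).mem_nhds hut] with z hz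
      exact (extChartAt (𝓡 d) (1 : G)).right_inv hz
    rw [h4.fderiv_eq]
    exact fderiv_id
  have key : ∀ (g : G) (_ : g = 1) (A : 𝔾 →L[ℝ] 𝔾) (_ : A = ContinuousLinearMap.id ℝ 𝔾),
      (mfderiv (𝓡 d) (𝓡 m) (fun h : G => h • (extChartAt (𝓡 m) j).symm y) g :
        𝔾 →L[ℝ] 𝔼) (A X) = fundamentalField G X ((extChartAt (𝓡 m) j).symm y) := by
    rintro g rfl A rfl; rfl
  have e1 : (mfderiv 𝓘(ℝ, 𝔾 × 𝔼) (𝓡 m) (actChart d m (1 : G) j) (u, y) :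
      𝔾 × 𝔼 →L[ℝ] 𝔼) (X, 0) =
      (mfderiv 𝓘(ℝ, 𝔾) (𝓡 m) (actChart d m (1 : G) j ∘ fun z => (z, y)) u : 𝔾 →L[ℝ] 𝔼) X :=
    (congrArg (fun T : 𝔾 →L[ℝ] 𝔼 => T X) h).symm
  rw [e1]
  refine (congrArg (fun T : 𝔾 →L[ℝ] 𝔼 => T X) h2).trans ?_
  exact key _ hu1 _ h3

/-- `X♯` at `g • x` is the image of `(Ad g⁻¹ X)♯` at `x`. -/
lemma fundamentalField_smul (g : G) (X : 𝔾) (x : M) :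
    fundamentalField G X (g • x) =
      mfderiv (𝓡 m) (𝓡 m) (fun y : M => g • y) x (fundamentalField G (Ad g⁻¹ X) x) := by
  have hc : ContMDiff (𝓡 d) (𝓡 d) ∞ fun h : G => g⁻¹ * h * g⁻¹⁻¹ :=
    ContMDiff.mul (I := 𝓡 d) (ContMDiff.mul (I := 𝓡 d) contMDiff_const contMDiff_id) contMDiff_const
  -- The orbit map of `g • x` is the orbit map of `x`, preceded by conjugation with `g⁻¹` and
  -- followed by the action of `g`.
  have e : (fun h : G => h • (g • x)) =
      (fun y : M => g • y) ∘ ((fun h : G => h • x) ∘ fun h : G => g⁻¹ * h * g⁻¹⁻¹) := by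
    funext h
    simp only [Function.comp_apply, smul_smul, inv_inv, mul_assoc, mul_inv_cancel_left]
  have h1 : g⁻¹ * 1 * g⁻¹⁻¹ = 1 := by simp
  have hd1 := mfderiv_comp_of_eq (x := (1 : G))
    (mdifferentiableAt_smul_const (d := d) (m := m) (1 : G) x)
    ((hc.contMDiffAt (x := 1)).mdifferentiableAt (by simp)) h1
  have hd2 := mfderiv_comp_of_eq (I := 𝓡 d) (x := (1 : G)) (y := x)
    (mdifferentiableAt_const_smul d (m := m) g x)
    ((mdifferentiableAt_smul_const (d := d) (m := m) (g⁻¹ * 1 * g⁻¹⁻¹) x).comp (1 : G)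
      ((hc.contMDiffAt (x := 1)).mdifferentiableAt (by simp))) (by simp)
  have key : ∀ (h : G) (_ : h = 1) (z : M) (_ : z = x) (Y : 𝔾),
      (mfderiv (𝓡 m) (𝓡 m) (fun y : M => g • y) z : 𝔼 →L[ℝ] 𝔼)
        ((mfderiv (𝓡 d) (𝓡 m) (fun h : G => h • x) h : 𝔾 →L[ℝ] 𝔼) Y) =
      mfderiv (𝓡 m) (𝓡 m) (fun y : M => g • y) x (fundamentalField G Y x) := by
    rintro h rfl z rfl Y; rfl
  rw [fundamentalField, e]
  refine (congrArg (fun T : 𝔾 →L[ℝ] 𝔼 => T X) hd2).trans ?_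
  refine Eq.trans ?_ (key _ h1 _ (show (g⁻¹ * 1 * g⁻¹⁻¹) • x = x by simp) _)
  refine congrArg (mfderiv (𝓡 m) (𝓡 m) (fun y : M => g • y) ((g⁻¹ * 1 * g⁻¹⁻¹) • x) :
    𝔼 →L[ℝ] 𝔼) ?_
  exact congrArg (fun T : 𝔾 →L[ℝ] 𝔼 => T X) hd1

end Action

/-! ### Equivariantly exact perturbations of a Hamiltonian structure -/

section Perturbation

variable {d m : ℕ} {G : Type*} [Group G] [TopologicalSpace G]
  [ChartedSpace (EuclideanSpace ℝ (Fin d)) G]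
  {M : Type*} [TopologicalSpace M] [ChartedSpace (EuclideanSpace ℝ (Fin m)) M] [MulAction G M]

local notation "𝔼" => EuclideanSpace ℝ (Fin m)
local notation "𝔾" => EuclideanSpace ℝ (Fin d)

lemma IsHamiltonian.mono {U V : Set M} {σ : DiffForm m M 2} {Φ : M → LieDual d}
    (h : IsHamiltonian G U σ Φ) (hV : IsOpen V) (hVi : InvariantSet G V) (hVU : V ⊆ U) :
    IsHamiltonian G V σ Φ where
  isOpen := hV
  invariant := hVi
  smooth_form j := (h.smooth_form j).mono (inter_subset_inter_right _ (preimage_mono hVU))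
  closed_form j y hy := h.closed_form j y ⟨hy.1, hVU hy.2⟩
  invariant_form g x hx := h.invariant_form g x (hVU hx)
  smooth_moment := h.smooth_moment.mono hVU
  equivariant_moment g x hx := h.equivariant_moment g x (hVU hx)
  hamilton X x hx := h.hamilton X x (hVU hx)

lemma DiffForm.inChart_congr {k : ℕ} {U : Set M} {σ σ' : DiffForm m M k}
    (h : ∀ x ∈ U, σ' x = σ x) {j : M} {y : 𝔼} (hy : y ∈ chartDomain U j) :
    σ'.inChart j y = σ.inChart j y := by
  rw [DiffForm.inChart, DiffForm.inChart, h _ hy.2]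

lemma DiffForm.SmoothOn.congr {k : ℕ} {U : Set M} {σ σ' : DiffForm m M k} (hσ : σ.SmoothOn U)
    (h : ∀ x ∈ U, σ' x = σ x) : σ'.SmoothOn U := fun j =>
  (hσ j).congr fun _ hy => DiffForm.inChart_congr h hy

lemma DiffForm.SmoothOn.mono {k : ℕ} {U V : Set M} {σ : DiffForm m M k} (hσ : σ.SmoothOn U)
    (h : V ⊆ U) : σ.SmoothOn V := fun j =>
  (hσ j).mono (inter_subset_inter_right _ (preimage_mono h))

/-- The function `X ↦ β(X♯)` with values in `𝔤*`. -/
def formMoment (d : ℕ) {m : ℕ} (G : Type*) [Group G] [TopologicalSpace G]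
    [ChartedSpace (EuclideanSpace ℝ (Fin d)) G] {M : Type*} [TopologicalSpace M]
    [ChartedSpace (EuclideanSpace ℝ (Fin m)) M] [MulAction G M] (β : DiffForm m M 1) (x : M) :
    LieDual d :=
  ((ContinuousAlternatingMap.ofSubsingleton ℝ (EuclideanSpace ℝ (Fin m)) ℝ
    (0 : Fin 1)).symm (β x)).comp (mfderiv (𝓡 d) (𝓡 m) (fun g : G => g • x) 1 :
      EuclideanSpace ℝ (Fin d) →L[ℝ] EuclideanSpace ℝ (Fin m))

lemma formMoment_apply (β : DiffForm m M 1) (x : M) (X : 𝔾) :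
    formMoment d G β x X = β x ![fundamentalField G X x] := by
  change β x (fun _ => fundamentalField G X x) = _
  congr 1; ext i; fin_cases i; rfl

variable [LieGroup (𝓡 d) ∞ G] [IsManifold (𝓡 m) ∞ M] [ContMDiffSMul (𝓡 d) (𝓡 m) ∞ G M]

lemma pull_actChart_inl (β : DiffForm m M 1) {j : M} {y : 𝔼}
    (hy : y ∈ (extChartAt (𝓡 m) j).target) (X : 𝔾) :
    β.pull (actChart d m (1 : G) j) (extChartAt (𝓡 d) (1 : G) 1, y) ![(X, 0)] =
      formMoment d G β ((extChartAt (𝓡 m) j).symm y) X := by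
  rw [formMoment_apply, ← mfderiv_actChart_inl hy X]
  have h1 : actChart d m (1 : G) j (extChartAt (𝓡 d) (1 : G) 1, y) =
      (extChartAt (𝓡 m) j).symm y := by
    rw [actChart, (extChartAt (𝓡 d) (1 : G)).left_inv (mem_extChartAt_source 1), one_smul]
  have key : ∀ (z x : M) (_ : z = x) (A : 𝔾 × 𝔼 →L[ℝ] 𝔼),
      (β z : 𝔼 [⋀^Fin 1]→L[ℝ] ℝ).compContinuousLinearMap A ![(X, 0)] =
        (β x : 𝔼 [⋀^Fin 1]→L[ℝ] ℝ) ![A (X, 0)] := by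
    rintro z x rfl A
    change β z _ = _
    congr 1; ext i; fin_cases i; rfl
  exact key _ _ h1 _

variable {U : Set M} {β : DiffForm m M 1}

/-- In charts, `β(X♯)` is the value on `(X, 0)` of the pullback of `β` under the action map,
restricted to the identity of `G`. -/
lemma contMDiffOn_formMoment (hU : IsOpen U) (hUi : InvariantSet G U) (hβ : β.SmoothOn U) :
    ContMDiffOn (𝓡 m) 𝓘(ℝ, LieDual d) ∞ (formMoment d G β) U := by
  refine contMDiffOn_of_comp_symm hU fun j => ?_
  refine contDiffOn_clm_apply.2 fun X => ?_
  have hB := hβ.pull (isOpen_prod_chartDomain (d := d) hU (1 : G) j) (contMDiffOn_actChart U (1 : G) j)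
    (mapsTo_actChart hUi (1 : G) j)
  have h1 : ContDiffOn ℝ ∞ (fun y : 𝔼 => β.pull (actChart d m (1 : G) j)
      (extChartAt (𝓡 d) (1 : G) 1, y)) (chartDomain U j) :=
    hB.comp (contDiff_prodMk_right _).contDiffOn fun y hy => ⟨mem_extChartAt_target 1, hy⟩
  refine ((contDiffOn_alternating_iff.1 h1) ![(X, 0)]).congr fun y hy => ?_
  exact (pull_actChart_inl β hy.1 X).symm

lemma formMoment_smul (hβ : InvariantForm G U β) (g : G) {x : M} (hx : x ∈ U) :
    formMoment d G β (g • x) = coAd g (formMoment d G β x) := by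
  ext X
  rw [formMoment_apply, fundamentalField_smul (m := m) (d := d)]
  change _ = formMoment d G β x (Ad g⁻¹ X)
  rw [formMoment_apply, ← hβ g x hx]
  rw [ContinuousAlternatingMap.compContinuousLinearMap_apply]
  congr 1; ext i; fin_cases i; rfl

/-- Exterior differentiation commutes with the pullback under each `g`. The identity is first
obtained in a chart and then carried back along the derivative of the inverse chart, which is onto.
-/
lemma InvariantForm.dForm {k : ℕ} {β : DiffForm m M k}
    (hg : ∀ g : G, ContMDiff (𝓡 m) (𝓡 m) ∞ fun x : M => g • x) (hU : IsOpen U)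
    (hUi : InvariantSet G U) (hβ : β.SmoothOn U) (hi : InvariantForm G U β) :
    InvariantForm G U (HamiltonianLocalization.dForm β) := by
  intro g x hx
  obtain ⟨j, y, hy, rfl⟩ := exists_chart_point (m := m) hx
  replace hg := hg g
  have h1 := hβ.pull_dForm hU (isOpen_chartDomain hU j)
    (hg.comp_contMDiffOn (contMDiffOn_extChartAt_symm_chartDomain U j))
    (fun z hz => hUi g _ hz.2) hy
  have h2 : β.pull ((fun x : M => g • x) ∘ (extChartAt (𝓡 m) j).symm) =ᶠ[𝓝 y] β.inChart j := by
    filter_upwards [(isOpen_chartDomain hU j).mem_nhds hy] with z hz using hi.pull_smul hg hz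
  rw [h2.extDeriv_eq, ← hβ.inChart_dForm hU hy] at h1
  have h3 := (HamiltonianLocalization.pull_smul hg (HamiltonianLocalization.dForm β) hy.1).symm.trans
    h1
  ext v
  have h4 : ∀ w : 𝔼, ∃ w' : 𝔼, (mfderiv 𝓘(ℝ, 𝔼) (𝓡 m) (extChartAt (𝓡 m) j).symm y :
      𝔼 →L[ℝ] 𝔼) w' = w := fun w => by
    have e3 := mfderiv_symm_chartVec ((extChartAt (𝓡 m) j).map_target hy.1) w
    rw [(extChartAt (𝓡 m) j).right_inv hy.1] at e3
    exact ⟨_, e3⟩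
  choose s hs using h4
  have h5 := congrArg (fun T : 𝔼 [⋀^Fin (k + 1)]→L[ℝ] ℝ => T fun i => s (v i)) h3
  have h6 : (fun i => (mfderiv 𝓘(ℝ, 𝔼) (𝓡 m) (extChartAt (𝓡 m) j).symm y :
      𝔼 →L[ℝ] 𝔼) (s (v i))) = v := funext fun i => hs _
  have h7 := congrArg (fun v : Fin (k + 1) → 𝔼 => ((HamiltonianLocalization.dForm β
      (g • (extChartAt (𝓡 m) j).symm y)).compContinuousLinearMap
      (mfderiv (𝓡 m) (𝓡 m) (fun y : M => g • y) ((extChartAt (𝓡 m) j).symm y)) :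
      𝔼 [⋀^Fin (k + 1)]→L[ℝ] ℝ) v) h6
  have h8 := congrArg (fun v : Fin (k + 1) → 𝔼 => (HamiltonianLocalization.dForm β
      ((extChartAt (𝓡 m) j).symm y) : 𝔼 [⋀^Fin (k + 1)]→L[ℝ] ℝ) v) h6
  exact h7.symm.trans (h5.trans h8)

/-- Cartan's formula: `d(β(X♯)) = -ι(X♯)dβ` for an invariant `1`-form `β`. -/
lemma mfderiv_formMoment (hU : IsOpen U) (hUi : InvariantSet G U) (hβ : β.SmoothOn U)
    (hi : InvariantForm G U β) (X : 𝔾) {x : M} (hx : x ∈ U) (w : TangentSpace (𝓡 m) x) :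
    mfderiv (𝓡 m) 𝓘(ℝ, ℝ) (fun z => formMoment d G β z X) x w =
      - dForm β x ![fundamentalField G X x, w] := by
  obtain ⟨j, y, hy, rfl⟩ := exists_chart_point (m := m) hx
  set u := extChartAt (𝓡 d) (1 : G) 1 with hu
  have hut : u ∈ (extChartAt (𝓡 d) (1 : G)).target := mem_extChartAt_target 1
  have hu1 : (extChartAt (𝓡 d) (1 : G)).symm u = 1 := (extChartAt (𝓡 d) (1 : G)).left_inv
    (mem_extChartAt_source 1)
  set f := actChart d m (1 : G) j with hf
  have hW := isOpen_prod_chartDomain (d := d) (m := m) hU (1 : G) j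
  have hyW : (u, y) ∈ (extChartAt (𝓡 d) (1 : G)).target ×ˢ chartDomain U j := ⟨hut, hy⟩
  have hB := hβ.pull hW (contMDiffOn_actChart U (1 : G) j) (mapsTo_actChart hUi (1 : G) j)
  have hBd : DifferentiableAt ℝ (β.pull f) (u, y) :=
    (hB.contDiffAt (hW.mem_nhds hyW)).differentiableAt (by simp)
  obtain ⟨w', rfl⟩ : ∃ w' : 𝔼, (mfderiv 𝓘(ℝ, 𝔼) (𝓡 m) (extChartAt (𝓡 m) j).symm y :
      𝔼 →L[ℝ] 𝔼) w' = w := by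
    have e3 := mfderiv_symm_chartVec ((extChartAt (𝓡 m) j).map_target hy.1) w
    rw [(extChartAt (𝓡 m) j).right_inv hy.1] at e3
    exact ⟨_, e3⟩
  have hev : ∀ p q : 𝔾 × 𝔼, fderiv ℝ (β.pull f) (u, y) p ![q] =
      fderiv ℝ (fun z => β.pull f z ![q]) (u, y) p := fun p q => by
    let L : ((𝔾 × 𝔼) [⋀^Fin 1]→L[ℝ] ℝ) →L[ℝ] ℝ := ContinuousAlternatingMap.apply ℝ _ ℝ ![q]
    exact (congrArg (fun T => T p) (L.hasFDerivAt.comp (u, y) hBd.hasFDerivAt).fderiv).symm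
  -- The differential of the pullback under the action map is evaluated on `(X, 0)` and `(0, w')`.
  -- One term differentiates along the group the value on a vector tangent to `M`; by invariance
  -- that value does not depend on the group variable.
  have hT1 : fderiv ℝ (fun z => β.pull f z ![(0, w')]) (u, y) (X, 0) = 0 := by
    have e1 : (fun z => β.pull f z ![(0, w')]) =ᶠ[𝓝 (u, y)]
        (fun z : 𝔼 => β.inChart j z ![w']) ∘ Prod.snd := by
      filter_upwards [hW.mem_nhds hyW] with q hq
      have h1 := pull_actChart_inr β (d := d) (G := G) hq.1 hq.2.1
      rw [hi.pull_smul (contMDiff_const_smul' d _) hq.2] at h1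
      rw [Function.comp_apply, ← h1]
      change β.pull f q _ = β.pull f q _
      congr 1; ext i <;> fin_cases i <;> rfl
    have hk : DifferentiableAt ℝ (fun z : 𝔼 => β.inChart j z ![w']) y :=
      (((contDiffOn_alternating_iff.1 (hβ j)) ![w']).contDiffAt
        ((isOpen_chartDomain hU j).mem_nhds hy)).differentiableAt (by simp)
    have e2 := (HasFDerivAt.comp (f := Prod.snd) (u, y) hk.hasFDerivAt
      (hasFDerivAt_snd (𝕜 := ℝ))).fderiv
    rw [e1.fderiv_eq, e2]
    simp
  -- The other term is the derivative of `β(X♯)` along `M`, and it enters the differential with a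
  -- minus sign.
  have hT2 : fderiv ℝ (fun z => β.pull f z ![(X, 0)]) (u, y) (0, w') =
      mfderiv (𝓡 m) 𝓘(ℝ, ℝ) (fun z => formMoment d G β z X) ((extChartAt (𝓡 m) j).symm y)
        (mfderiv 𝓘(ℝ, 𝔼) (𝓡 m) (extChartAt (𝓡 m) j).symm y w') := by
    have hd : DifferentiableAt ℝ (fun z => β.pull f z ![(X, 0)]) (u, y) :=
      (((contDiffOn_alternating_iff.1 hB) ![(X, 0)]).contDiffAt
        (hW.mem_nhds hyW)).differentiableAt (by simp)
    have e1 := (hd.hasFDerivAt.comp y (hasFDerivAt_prodMk_right u y)).fderiv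
    have e2 : ((fun z => β.pull f z ![(X, 0)]) ∘ fun z : 𝔼 => (u, z)) =ᶠ[𝓝 y]
        (fun z => formMoment d G β z X) ∘ (extChartAt (𝓡 m) j).symm := by
      filter_upwards [(isOpen_chartDomain hU j).mem_nhds hy] with z hz
        using pull_actChart_inl β hz.1 X
    have hm : MDifferentiableAt (𝓡 m) 𝓘(ℝ, ℝ) (fun z => formMoment d G β z X)
        ((extChartAt (𝓡 m) j).symm y) := by
      have h1 := ((contMDiffOn_formMoment (d := d) (G := G) hU hUi hβ).contMDiffAt
        (hU.mem_nhds hy.2)).mdifferentiableAt (n := ∞) (by simp)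
      exact ((ContinuousLinearMap.apply ℝ ℝ X).differentiableAt.mdifferentiableAt).comp _ h1
    have e3 := mfderiv_comp y hm (mdifferentiableAt_extChartAt_symm hy.1)
    rw [mfderiv_eq_fderiv, ← e2.fderiv_eq, e1] at e3
    exact congrArg (fun T : 𝔼 →L[ℝ] ℝ => T w') e3
  have hd := hβ.pull_dForm hU hW (contMDiffOn_actChart U (1 : G) j)
    (mapsTo_actChart hUi (1 : G) j) hyW
  have h1 := congrArg (fun T : (𝔾 × 𝔼) [⋀^Fin 2]→L[ℝ] ℝ => T ![(X, 0), (0, w')]) hd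
  simp only [extDeriv, alternatizeUncurryFin_two_apply, ← hf, hev] at h1
  obtain ⟨r, hr⟩ : ∃ r : ℝ, r = (mfderiv (𝓡 m) 𝓘(ℝ, ℝ) (fun z => formMoment d G β z X)
      ((extChartAt (𝓡 m) j).symm y)
        (mfderiv 𝓘(ℝ, 𝔼) (𝓡 m) (extChartAt (𝓡 m) j).symm y w') : ℝ) := ⟨_, rfl⟩
  rw [hT1, hT2.trans hr.symm, zero_sub] at h1
  have hf1 : f (u, y) = (extChartAt (𝓡 m) j).symm y := by
    rw [hf, actChart, hu1, one_smul]
  have hw : (mfderiv 𝓘(ℝ, 𝔾 × 𝔼) (𝓡 m) f (u, y) : 𝔾 × 𝔼 →L[ℝ] 𝔼) (0, w') =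
      mfderiv 𝓘(ℝ, 𝔼) (𝓡 m) (extChartAt (𝓡 m) j).symm y w' := by
    have e := mfderiv_actChart_inr (d := d) (G := G) hut hy.1
    rw [hu1] at e
    have e' : (fun z => (1 : G) • (extChartAt (𝓡 m) j).symm z) = (extChartAt (𝓡 m) j).symm :=
      funext fun z => one_smul G _
    exact (congrArg (fun T : 𝔼 →L[ℝ] 𝔼 => T w') e).trans (congrArg (fun h : 𝔼 → M =>
      ((mfderiv 𝓘(ℝ, 𝔼) (𝓡 m) h y : 𝔼 →L[ℝ] 𝔼) w' : 𝔼)) e')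
  have key : ∀ (z x : M) (_ : z = x) (A : 𝔾 × 𝔼 →L[ℝ] 𝔼) (a b : 𝔼) (_ : A (X, 0) = a)
      (_ : A (0, w') = b), (dForm β z : 𝔼 [⋀^Fin 2]→L[ℝ] ℝ).compContinuousLinearMap A
        ![(X, 0), (0, w')] = (dForm β x : 𝔼 [⋀^Fin 2]→L[ℝ] ℝ) ![a, b] := by
    rintro z x rfl A a b rfl rfl
    change dForm β z _ = _
    congr 1; ext i; fin_cases i <;> rfl
  have h2 := key _ _ hf1 _ _ _ (mfderiv_actChart_inl hy.1 X) hw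
  have h3 : dForm β ((extChartAt (𝓡 m) j).symm y) ![fundamentalField G X
      ((extChartAt (𝓡 m) j).symm y), (mfderiv 𝓘(ℝ, 𝔼) (𝓡 m) (extChartAt (𝓡 m) j).symm y :
      𝔼 →L[ℝ] 𝔼) w'] = - r := h2.symm.trans h1
  exact hr.symm.trans ((neg_neg r).symm.trans (congrArg Neg.neg h3.symm))

/-- Adding `d_G β = dβ - β(·♯)` for an invariant `1`-form `β` to a Hamiltonian structure. -/
lemma IsHamiltonian.perturb {σ : DiffForm m M 2} {Φ : M → LieDual d}
    (h : IsHamiltonian G U σ Φ) (hβ : β.SmoothOn U) (hi : InvariantForm G U β) :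
    IsHamiltonian G U (fun x => σ x + dForm β x) (fun x => Φ x - formMoment d G β x) where
  isOpen := h.isOpen
  invariant := h.invariant
  smooth_form j := (h.smooth_form j).add (hβ.dForm h.isOpen j)
  closed_form j y hy := by
    have hV := (isOpen_chartDomain h.isOpen j).mem_nhds hy
    have e : DiffForm.inChart (fun x => σ x + dForm β x : DiffForm m M 2) j =
        σ.inChart j + (dForm β).inChart j := rfl
    rw [e, extDeriv_add (((h.smooth_form j).contDiffAt hV).differentiableAt (by simp))
      (((hβ.dForm h.isOpen j).contDiffAt hV).differentiableAt (by simp)),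
      h.closed_form j y hy, hβ.closedOn_dForm h.isOpen j y hy, add_zero]
  invariant_form g x hx := by
    have h1 := h.invariant_form g x hx
    have h2 := hi.dForm (fun g => contMDiff_const_smul' d g) h.isOpen h.invariant hβ g x hx
    exact (congrArg₂ (· + ·) h1 h2 :)
  smooth_moment := h.smooth_moment.sub (contMDiffOn_formMoment h.isOpen h.invariant hβ)
  equivariant_moment g x hx := by
    rw [h.equivariant_moment g x hx, formMoment_smul hi g hx]
    ext X; rfl
  hamilton X x hx w := by
    let ev : LieDual d →L[ℝ] ℝ := ContinuousLinearMap.apply ℝ ℝ X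
    have d1 : MDifferentiableAt (𝓡 m) 𝓘(ℝ, ℝ) (fun z => Φ z X) x :=
      (ev.differentiableAt.mdifferentiableAt).comp x
        ((h.smooth_moment.contMDiffAt (h.isOpen.mem_nhds hx)).mdifferentiableAt (by simp))
    have d2 : MDifferentiableAt (𝓡 m) 𝓘(ℝ, ℝ) (fun z => formMoment d G β z X) x :=
      (ev.differentiableAt.mdifferentiableAt).comp x
        (((contMDiffOn_formMoment h.isOpen h.invariant hβ).contMDiffAt
          (h.isOpen.mem_nhds hx)).mdifferentiableAt (n := ∞) (by simp))
    let A (f : M → ℝ) : 𝔼 →L[ℝ] ℝ := mfderiv (𝓡 m) 𝓘(ℝ, ℝ) f x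
    have e : A (fun z => (Φ z - formMoment d G β z) X) w =
        A (fun z => Φ z X) w - A (fun z => formMoment d G β z X) w :=
      congrArg (fun T : 𝔼 →L[ℝ] ℝ => T w) (d1.hasMFDerivAt.sub d2.hasMFDerivAt).mfderiv
    have e1 : A (fun z => Φ z X) w = _ := h.hamilton X x hx w
    have e2 : A (fun z => formMoment d G β z X) w = _ :=
      mfderiv_formMoment h.isOpen h.invariant hβ hi X hx w
    rw [e1, e2, sub_neg_eq_add] at e
    exact e

end Perturbation

/-! ### Averaging over the compact group -/

section Averaging

variable {d m : ℕ} {G : Type*} [Group G] [TopologicalSpace G]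
  [ChartedSpace (EuclideanSpace ℝ (Fin d)) G]
  {M : Type*} [TopologicalSpace M] [ChartedSpace (EuclideanSpace ℝ (Fin m)) M] [MulAction G M]

local notation "𝔼" => EuclideanSpace ℝ (Fin m)
local notation "𝔾" => EuclideanSpace ℝ (Fin d)

/-- The image of normalized Haar measure under inversion. Right invariance is what is needed,
because pulling back under `g` and then under `h` is pulling back under `g * h`. -/
lemma exists_rightInvariant_probability [IsTopologicalGroup G] [CompactSpace G]
    [MeasurableSpace G] [BorelSpace G] :
    ∃ μ : Measure G, IsProbabilityMeasure μ ∧ μ.IsMulRightInvariant := by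
  refine ⟨(Measure.haarMeasure (⊤ : TopologicalSpace.PositiveCompacts G)).inv, ⟨?_⟩, inferInstance⟩
  rw [Measure.inv_apply, inv_univ]
  exact Measure.haarMeasure_self

/-- The average of the pullbacks of the form `β` under the action of `G`. -/
def avgForm {G : Type*} [Group G] [MulAction G M] [MeasurableSpace G] (μ : Measure G) {k : ℕ}
    (β : DiffForm m M k) : DiffForm m M k := fun x =>
  (∫ g : G, ((β (g • x)).compContinuousLinearMap (mfderiv (𝓡 m) (𝓡 m) (fun y : M => g • y) x) :
    EuclideanSpace ℝ (Fin m) [⋀^Fin k]→L[ℝ] ℝ) ∂μ :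
      EuclideanSpace ℝ (Fin m) [⋀^Fin k]→L[ℝ] ℝ)

variable [IsManifold (𝓡 m) ∞ M]

lemma eventually_extChartAt_smul [LieGroup (𝓡 d) ∞ G]
    (g₀ : G) {j : M} {y₀ : 𝔼}
    (hy : y₀ ∈ (extChartAt (𝓡 m) j).target) : ∀ᶠ q : G × 𝔼 in 𝓝 (g₀, y₀),
      q.1 ∈ (extChartAt (𝓡 d) g₀).source ∧ q.2 ∈ (extChartAt (𝓡 m) j).target :=
  ((isOpen_extChartAt_source g₀).prod (isOpen_extTarget j)).mem_nhds ⟨mem_extChartAt_source g₀, hy⟩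

/-- Near `g₀`, a chart of `G` writes the family as the part along `M` of the pullback of `β` under
the action map, which is smooth in both variables jointly. -/
lemma isSmoothFamily_pull_smul [LieGroup (𝓡 d) ∞ G] [ContMDiffSMul (𝓡 d) (𝓡 m) ∞ G M]
    {k : ℕ} {β : DiffForm m M k} (hβ : β.SmoothOn univ) (j : M) :
    IsSmoothFamily 𝔾 (univ : Set G) (chartDomain univ j)
      fun g y => β.pull (fun z => g • (extChartAt (𝓡 m) j).symm z) y := by
  intro g₀ _ y₀ hy₀
  refine ⟨extChartAt (𝓡 d) g₀, fun q => (β.pull (actChart d m g₀ j) q).compContinuousLinearMap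
    (ContinuousLinearMap.inr ℝ 𝔾 𝔼), (extChartAt (𝓡 d) g₀).target ×ˢ chartDomain univ j,
    continuousAt_extChartAt g₀, isOpen_prod_chartDomain isOpen_univ g₀ j,
    ⟨mem_extChartAt_target g₀, hy₀⟩, ?_, ?_⟩
  · exact contDiffOn_compContinuousLinearMap (hβ.pull (isOpen_prod_chartDomain isOpen_univ g₀ j)
      (contMDiffOn_actChart univ g₀ j) (mapsTo_univ _ _)) contDiffOn_const
  · filter_upwards [eventually_extChartAt_smul (d := d) g₀ hy₀.1] with q hq
    have h := pull_actChart_inr β ((extChartAt (𝓡 d) g₀).map_source hq.1) hq.2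
    rw [(extChartAt (𝓡 d) g₀).left_inv hq.1] at h
    exact h.symm

lemma isSmoothFamily_comp_smul [LieGroup (𝓡 d) ∞ G] [ContMDiffSMul (𝓡 d) (𝓡 m) ∞ G M]
    {f : M → ℝ} (hf : ContMDiff (𝓡 m) 𝓘(ℝ, ℝ) ∞ f) (j : M) :
    IsSmoothFamily 𝔾 (univ : Set G) (chartDomain univ j)
      fun g y => f (g • (extChartAt (𝓡 m) j).symm y) := by
  intro g₀ _ y₀ hy₀
  refine ⟨extChartAt (𝓡 d) g₀, fun q => f (actChart d m g₀ j q),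
    (extChartAt (𝓡 d) g₀).target ×ˢ chartDomain univ j,
    continuousAt_extChartAt g₀, isOpen_prod_chartDomain isOpen_univ g₀ j,
    ⟨mem_extChartAt_target g₀, hy₀⟩, ?_, ?_⟩
  · exact contMDiffOn_iff_contDiffOn.1 (hf.comp_contMDiffOn (contMDiffOn_actChart univ g₀ j))
  · filter_upwards [eventually_extChartAt_smul (d := d) g₀ hy₀.1] with q hq
    rw [actChart, (extChartAt (𝓡 d) g₀).left_inv hq.1]

lemma chartVec_comp_pull_smul {k : ℕ} (β : DiffForm m M k) {g : G}
    (hg : ContMDiff (𝓡 m) (𝓡 m) ∞ fun x : M => g • x) {j : M} {y : 𝔼}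
    (hy : y ∈ (extChartAt (𝓡 m) j).target) :
    ((β (g • (extChartAt (𝓡 m) j).symm y)).compContinuousLinearMap
      (mfderiv (𝓡 m) (𝓡 m) (fun x : M => g • x) ((extChartAt (𝓡 m) j).symm y)) :
        𝔼 [⋀^Fin k]→L[ℝ] ℝ) =
    (β.pull (fun z => g • (extChartAt (𝓡 m) j).symm z) y).compContinuousLinearMap
      (mfderiv (𝓡 m) 𝓘(ℝ, 𝔼) (extChartAt (𝓡 m) j) ((extChartAt (𝓡 m) j).symm y) :
        𝔼 →L[ℝ] 𝔼) := by
  rw [pull_smul hg β hy]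
  ext v
  have h1 : ∀ w : 𝔼, (mfderiv 𝓘(ℝ, 𝔼) (𝓡 m) (extChartAt (𝓡 m) j).symm y : 𝔼 →L[ℝ] 𝔼)
      ((mfderiv (𝓡 m) 𝓘(ℝ, 𝔼) (extChartAt (𝓡 m) j) ((extChartAt (𝓡 m) j).symm y) :
        𝔼 →L[ℝ] 𝔼) w) = w := fun w => by
    have e3 := mfderiv_symm_chartVec ((extChartAt (𝓡 m) j).map_target hy) w
    rw [(extChartAt (𝓡 m) j).right_inv hy] at e3
    exact e3
  exact (congrArg (fun v : Fin k → 𝔼 => ((β (g • (extChartAt (𝓡 m) j).symm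
    y)).compContinuousLinearMap (mfderiv (𝓡 m) (𝓡 m) (fun y : M => g • y)
      ((extChartAt (𝓡 m) j).symm y)) : 𝔼 [⋀^Fin k]→L[ℝ] ℝ) v) (funext fun i => h1 (v i))).symm

variable [T2Space G] [CompactSpace G] [MeasurableSpace G] [BorelSpace G] (μ : Measure G)
  [IsProbabilityMeasure μ]

lemma integrable_pull_smul [LieGroup (𝓡 d) ∞ G] [ContMDiffSMul (𝓡 d) (𝓡 m) ∞ G M]
    {k : ℕ} {β : DiffForm m M k} (hβ : β.SmoothOn univ) (x : M) :
    Integrable (fun g : G => ((β (g • x)).compContinuousLinearMap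
      (mfderiv (𝓡 m) (𝓡 m) (fun y : M => g • y) x) : 𝔼 [⋀^Fin k]→L[ℝ] ℝ)) μ := by
  obtain ⟨j, y, hy, rfl⟩ := exists_chart_point (m := m) (mem_univ x)
  have h := (isSmoothFamily_pull_smul (d := d) (G := G) hβ j).integrableOn isCompact_univ hy (μ := μ)
  rw [integrableOn_univ] at h
  let A : 𝔼 →L[ℝ] 𝔼 := mfderiv (𝓡 m) 𝓘(ℝ, 𝔼) (extChartAt (𝓡 m) j) ((extChartAt (𝓡 m) j).symm y)
  let L : (𝔼 [⋀^Fin k]→L[ℝ] ℝ) →L[ℝ] 𝔼 [⋀^Fin k]→L[ℝ] ℝ :=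
    ContinuousAlternatingMap.compContinuousLinearMapCLM A
  refine (L.integrable_comp h).congr (Filter.Eventually.of_forall fun g => ?_)
  exact (chartVec_comp_pull_smul β (contMDiff_const_smul' d g) hy.1).symm

lemma inChart_avgForm [LieGroup (𝓡 d) ∞ G] [ContMDiffSMul (𝓡 d) (𝓡 m) ∞ G M]
    {k : ℕ} {β : DiffForm m M k} (hβ : β.SmoothOn univ) {j : M} {y : 𝔼}
    (hy : y ∈ (extChartAt (𝓡 m) j).target) :
    (avgForm μ β).inChart j y = ∫ g : G, β.pull (fun z => g • (extChartAt (𝓡 m) j).symm z) y ∂μ := by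
  let A : 𝔼 →L[ℝ] 𝔼 := mfderiv 𝓘(ℝ, 𝔼) (𝓡 m) (extChartAt (𝓡 m) j).symm y
  let L : (𝔼 [⋀^Fin k]→L[ℝ] ℝ) →L[ℝ] 𝔼 [⋀^Fin k]→L[ℝ] ℝ :=
    ContinuousAlternatingMap.compContinuousLinearMapCLM A
  have h1 := L.integral_comp_comm
      (integrable_pull_smul (d := d) μ hβ ((extChartAt (𝓡 m) j).symm y))
  refine h1.symm.trans (integral_congr_ae (Filter.Eventually.of_forall fun g => ?_))
  exact (pull_smul (contMDiff_const_smul' d g) β hy).symm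

lemma smoothOn_avgForm [LieGroup (𝓡 d) ∞ G] [ContMDiffSMul (𝓡 d) (𝓡 m) ∞ G M]
    {k : ℕ} {β : DiffForm m M k} (hβ : β.SmoothOn univ) :
    (avgForm μ β).SmoothOn univ := by
  intro j
  have h := (isSmoothFamily_pull_smul (d := d) (G := G) hβ j).contDiffOn_integral isCompact_univ
    (isOpen_chartDomain isOpen_univ j) (μ := μ)
  refine h.congr fun y hy => ?_
  rw [inChart_avgForm (d := d) μ hβ hy.1, Measure.restrict_univ]

lemma avgForm_apply [LieGroup (𝓡 d) ∞ G] [ContMDiffSMul (𝓡 d) (𝓡 m) ∞ G M]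
    {k : ℕ} {β : DiffForm m M k} (hβ : β.SmoothOn univ) (x : M)
    (v : Fin k → TangentSpace (𝓡 m) x) : avgForm μ β x v = ∫ g : G, (β (g • x)
      fun i => mfderiv (𝓡 m) (𝓡 m) (fun y : M => g • y) x (v i)) ∂μ :=
  ((ContinuousAlternatingMap.apply ℝ 𝔼 ℝ v).integral_comp_comm
    (integrable_pull_smul (d := d) μ hβ x)).symm

lemma contMDiff_avg [LieGroup (𝓡 d) ∞ G] [ContMDiffSMul (𝓡 d) (𝓡 m) ∞ G M]
    {f : M → ℝ} (hf : ContMDiff (𝓡 m) 𝓘(ℝ, ℝ) ∞ f) :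
    ContMDiff (𝓡 m) 𝓘(ℝ, ℝ) ∞ fun x => ∫ g : G, f (g • x) ∂μ := by
  rw [← contMDiffOn_univ]
  refine contMDiffOn_of_comp_symm isOpen_univ fun j => ?_
  have h := (isSmoothFamily_comp_smul (d := d) (G := G) hf j).contDiffOn_integral isCompact_univ
    (isOpen_chartDomain isOpen_univ j) (μ := μ)
  simp only [Measure.restrict_univ] at h
  exact h

variable [μ.IsMulRightInvariant]

lemma invariantForm_avgForm [LieGroup (𝓡 d) ∞ G] [ContMDiffSMul (𝓡 d) (𝓡 m) ∞ G M]
    {k : ℕ} {β : DiffForm m M k} (hβ : β.SmoothOn univ) :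
    InvariantForm G univ (avgForm μ β) := by
  intro h x _
  haveI := topologicalGroup_of_lieGroup (𝓡 d) ∞ (G := G)
  let F : G → 𝔼 [⋀^Fin k]→L[ℝ] ℝ := fun g => ((β (g • x)).compContinuousLinearMap
      (mfderiv (𝓡 m) (𝓡 m) (fun y : M => g • y) x))
  let A : 𝔼 →L[ℝ] 𝔼 := mfderiv (𝓡 m) (𝓡 m) (fun y : M => h • y) x
  let L : (𝔼 [⋀^Fin k]→L[ℝ] ℝ) →L[ℝ] 𝔼 [⋀^Fin k]→L[ℝ] ℝ :=
    ContinuousAlternatingMap.compContinuousLinearMapCLM A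
  have h1 := L.integral_comp_comm
      (integrable_pull_smul (d := d) μ hβ (h • x))
  refine h1.symm.trans (Eq.trans (integral_congr_ae (Filter.Eventually.of_forall fun g => ?_))
    (integral_mul_right_eq_self F h))
  have e : (fun y : M => (g * h) • y) = (fun y : M => g • y) ∘ fun y : M => h • y :=
    funext fun y => mul_smul g h y
  have h2 := mfderiv_comp x (mdifferentiableAt_const_smul d (m := m) g (h • x))
    (mdifferentiableAt_const_smul d (m := m) h x)
  rw [← e] at h2
  have key : ∀ (z : M) (_ : (g * h) • x = z) (A : 𝔼 →L[ℝ] 𝔼), (β ((g * h) • x) :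
      𝔼 [⋀^Fin k]→L[ℝ] ℝ).compContinuousLinearMap A = (β z :
        𝔼 [⋀^Fin k]→L[ℝ] ℝ).compContinuousLinearMap A := by
    rintro z rfl A; rfl
  refine Eq.symm ((congrArg (fun A : 𝔼 →L[ℝ] 𝔼 => (β ((g * h) • x) :
    𝔼 [⋀^Fin k]→L[ℝ] ℝ).compContinuousLinearMap A) h2).trans (key _ (mul_smul g h x) _))

lemma avg_smul (f : M → ℝ) (h : G) (x : M) [IsTopologicalGroup G] :
    ∫ g : G, f (g • h • x) ∂μ = ∫ g : G, f (g • x) ∂μ := by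
  simp only [← mul_smul]
  exact integral_mul_right_eq_self (fun g : G => f (g • x)) h

end Averaging

/-! ### A `1`-form positive on the vector field of a taming map -/

section TamingForm

variable {d m : ℕ} {G : Type*} [Group G] [TopologicalSpace G]
  [ChartedSpace (EuclideanSpace ℝ (Fin d)) G] [LieGroup (𝓡 d) ∞ G]
  {M : Type*} [TopologicalSpace M] [ChartedSpace (EuclideanSpace ℝ (Fin m)) M] [MulAction G M]
  [IsManifold (𝓡 m) ∞ M] [ContMDiffSMul (𝓡 d) (𝓡 m) ∞ G M]

local notation "𝔼" => EuclideanSpace ℝ (Fin m)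
local notation "𝔾" => EuclideanSpace ℝ (Fin d)

lemma DiffForm.smoothOn_of_locally {k : ℕ} {σ : DiffForm m M k} {U : Set M}
    (h : ∀ x ∈ U, ∃ N : Set M, IsOpen N ∧ x ∈ N ∧ σ.SmoothOn N) : σ.SmoothOn U := by
  intro j y hy
  obtain ⟨N, hN, hxN, hσ⟩ := h _ hy.2
  exact ((hσ j).contDiffAt ((isOpen_chartDomain hN j).mem_nhds ⟨hy.1, hxN⟩)).contDiffWithinAt

lemma DiffForm.SmoothOn.smul {k : ℕ} {σ : DiffForm m M k} {U : Set M} {f : M → ℝ}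
    (hf : ContMDiffOn (𝓡 m) 𝓘(ℝ, ℝ) ∞ f U) (hσ : σ.SmoothOn U) :
    DiffForm.SmoothOn (fun x => f x • σ x : DiffForm m M k) U := fun j =>
  (contDiffOn_comp_symm hf j).smul (hσ j)

lemma DiffForm.smoothOn_zero {k : ℕ} (U : Set M) :
    DiffForm.SmoothOn (fun _ => 0 : DiffForm m M k) U := fun _ => contDiffOn_const (c := 0)

/-- A form `f σ` with `f` smooth is smooth if `σ` is smooth on a neighbourhood of the support
of `f`. -/
lemma DiffForm.SmoothOn.smul_of_tsupport {k : ℕ} {σ : DiffForm m M k} {U : Set M} {f : M → ℝ}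
    (hU : IsOpen U) (hf : ContMDiff (𝓡 m) 𝓘(ℝ, ℝ) ∞ f) (hσ : σ.SmoothOn U) (hfU : tsupport f ⊆ U) :
    DiffForm.SmoothOn (fun x => f x • σ x : DiffForm m M k) univ := by
  refine DiffForm.smoothOn_of_locally fun x _ => ?_
  by_cases hx : x ∈ tsupport f
  · exact ⟨U, hU, hfU hx, hσ.smul hf.contMDiffOn⟩
  · refine ⟨(tsupport f)ᶜ, (isClosed_tsupport f).isOpen_compl, hx,
      (DiffForm.smoothOn_zero (m := m) (k := k) _).congr fun z hz => ?_⟩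
    rw [image_eq_zero_of_notMem_tsupport hz, zero_smul]

/-- In coordinates this is the partial derivative along `G`, at the identity, of the smooth action
map, applied to the smooth vector `v`. -/
lemma contDiffOn_chartVec_fundamentalField {v : M → 𝔾} (hv : ContMDiff (𝓡 m) 𝓘(ℝ, 𝔾) ∞ v) (j : M) :
    ContDiffOn ℝ ∞ (fun y : 𝔼 => chartVec (m := m) j ((extChartAt (𝓡 m) j).symm y)
      (fundamentalField (m := m) G (v ((extChartAt (𝓡 m) j).symm y)) ((extChartAt (𝓡 m) j).symm y)))
      (extChartAt (𝓡 m) j).target := by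
  intro y₀ hy₀
  set u := extChartAt (𝓡 d) (1 : G) 1 with hu
  set f := actChart d m (1 : G) j with hf
  have hW := isOpen_prod_chartDomain (d := d) (m := m) isOpen_univ (1 : G) j
  have hut : u ∈ (extChartAt (𝓡 d) (1 : G)).target := mem_extChartAt_target 1
  have hf1 : ∀ y, f (u, y) = (extChartAt (𝓡 m) j).symm y := fun y => by
    rw [hf, actChart, hu, (extChartAt (𝓡 d) (1 : G)).left_inv (mem_extChartAt_source 1), one_smul]
  have hfj : f (u, y₀) ∈ (extChartAt (𝓡 m) j).source := by
    rw [hf1]; exact (extChartAt (𝓡 m) j).map_target hy₀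
  obtain ⟨W', hW'W, hW'o, hyW', hs, -⟩ := exists_nhd_chart hW
    (show (u, y₀) ∈ _ from ⟨hut, hy₀, mem_univ _⟩) (contMDiffOn_actChart univ (1 : G) j)
    (mapsTo_univ _ _) hfj
  have h1 := contDiffOn_extChartAt_comp ((contMDiffOn_actChart univ (1 : G) j).mono hW'W) hs
  have h2 := h1.fderiv_of_isOpen hW'o (m := ∞) (by simp)
  have hV : IsOpen ((fun y : 𝔼 => (u, y)) ⁻¹' W') := hW'o.preimage (by fun_prop)
  have hvj := contDiffOn_comp_symm (hv.contMDiffOn (s := univ)) j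
  have h3 : ContDiffOn ℝ ∞ (fun y : 𝔼 => fderiv ℝ (extChartAt (𝓡 m) j ∘ f) (u, y)
      (v ((extChartAt (𝓡 m) j).symm y), 0)) ((fun y : 𝔼 => (u, y)) ⁻¹' W') := by
    refine (h2.comp (contDiff_prodMk_right u).contDiffOn fun y hy => hy).clm_apply
      (ContDiffOn.prodMk (hvj.mono fun y hy => (hW'W hy).2) contDiffOn_const)
  refine ((h3.contDiffAt (hV.mem_nhds hyW')).congr_of_eventuallyEq ?_).contDiffWithinAt
  filter_upwards [hV.mem_nhds hyW'] with y hy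
  have hy2 := hW'W hy
  have hm1 := mdifferentiableAt_actChart (g₀ := (1 : G)) (j := j) (q := (u, y)) hut hy2.2.1
  have hm2 := (contMDiffAt_extChartAt_of_mem (hs hy)).mdifferentiableAt (n := ∞) (by simp)
  have h4 := mfderiv_comp (u, y) hm2 hm1
  rw [mfderiv_eq_fderiv] at h4
  have key : ∀ (z x : M) (_ : z = x) (a b : 𝔼) (_ : a = b),
      (mfderiv (𝓡 m) 𝓘(ℝ, 𝔼) (extChartAt (𝓡 m) j) z : 𝔼 →L[ℝ] 𝔼) a = chartVec j x b := by
    rintro z x rfl a b rfl; rfl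
  exact ((congrArg (fun T : 𝔾 × 𝔼 →L[ℝ] 𝔼 => T (v ((extChartAt (𝓡 m) j).symm y), 0)) h4).trans
    (key _ _ (hf1 y) _ _ (mfderiv_actChart_inl hy2.2.1 _))).symm

/-- The `1`-form dual to the fundamental vector field of `v` for the metric of the chart at `j`. -/
def chartTamingForm (G : Type*) [Group G] [TopologicalSpace G]
    [ChartedSpace (EuclideanSpace ℝ (Fin d)) G] [MulAction G M] (v : M → EuclideanSpace ℝ (Fin d))
    (j : M) : DiffForm m M 1 := fun x =>
  (covForm ((innerSL ℝ (chartVec (m := m) j x (fundamentalField (m := m) G (v x) x))).comp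
    (mfderiv (𝓡 m) 𝓘(ℝ, EuclideanSpace ℝ (Fin m)) (extChartAt (𝓡 m) j) x :
      EuclideanSpace ℝ (Fin m) →L[ℝ] EuclideanSpace ℝ (Fin m))) :
    EuclideanSpace ℝ (Fin m) [⋀^Fin 1]→L[ℝ] ℝ)

lemma chartTamingForm_apply (v : M → 𝔾) (j x : M) :
    chartTamingForm (m := m) G v j x ![fundamentalField (m := m) G (v x) x] =
      ‖chartVec (m := m) j x (fundamentalField (m := m) G (v x) x)‖ ^ 2 := by
  rw [← real_inner_self_eq_norm_sq]
  rfl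

lemma smoothOn_chartTamingForm {v : M → 𝔾} (hv : ContMDiff (𝓡 m) 𝓘(ℝ, 𝔾) ∞ v) (j : M) :
    (chartTamingForm (m := m) G v j).SmoothOn (extChartAt (𝓡 m) j).source := by
  refine DiffForm.smoothOn_of_forall_exists fun x hx => ⟨j, hx, _, isOpen_extTarget j,
    (extChartAt (𝓡 m) j).map_source hx, ?_⟩
  have h1 := ((covForm (E := 𝔼)).comp
    (innerSL ℝ (E := 𝔼) : 𝔼 →L[ℝ] 𝔼 →L[ℝ] ℝ)).contDiff (n := ∞)|>.comp_contDiffOn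
      (contDiffOn_chartVec_fundamentalField (G := G) hv j)
  refine h1.congr fun y hy => ?_
  refine alternating_one_ext fun w => ?_
  exact congrArg (innerSL ℝ (chartVec (m := m) j ((extChartAt (𝓡 m) j).symm y)
    (fundamentalField (m := m) G (v ((extChartAt (𝓡 m) j).symm y))
      ((extChartAt (𝓡 m) j).symm y)))) (chartVec_mfderiv_symm hy w)

variable [T2Space M] [SecondCountableTopology M]

/-- There is a `1`-form that is positive on the fundamental vector field of a taming map off its
localizing set. -/
lemma exists_tamingForm {v : M → 𝔾} (hv : ContMDiff (𝓡 m) 𝓘(ℝ, 𝔾) ∞ v) :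
    ∃ θ : DiffForm m M 1, θ.SmoothOn univ ∧ (∀ x, 0 ≤ θ x ![fundamentalField (m := m) G (v x) x]) ∧
      ∀ x, fundamentalField (m := m) G (v x) x ≠ 0 → 0 < θ x ![fundamentalField (m := m) G (v x) x] := by
  set ρ := chartPartition m M with hρ
  have hfin : ∀ x, {j | ρ j x ≠ 0}.Finite := fun x => ρ.locallyFinite.point_finite x
  let θ : DiffForm m M 1 := fun x => ∑ j ∈ (hfin x).toFinset, ρ j x • chartTamingForm (m := m) G v j x
  have hval : ∀ x, θ x ![fundamentalField (m := m) G (v x) x] = ∑ j ∈ (hfin x).toFinset, ρ j x *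
      ‖chartVec (m := m) j x (fundamentalField (m := m) G (v x) x)‖ ^ 2 := by
    intro x
    have h1 := map_sum (ContinuousAlternatingMap.apply ℝ 𝔼 ℝ
      (![fundamentalField (m := m) G (v x) x] : Fin 1 → 𝔼)) (fun j => (ρ j x • chartTamingForm (m := m) G v j x :
        𝔼 [⋀^Fin 1]→L[ℝ] ℝ)) (hfin x).toFinset
    refine h1.trans (Finset.sum_congr rfl fun j _ => ?_)
    rw [← chartTamingForm_apply]
    rfl
  refine ⟨θ, ?_, fun x => ?_, fun x hx => ?_⟩
  -- The index set in the definition of `θ` varies with the point; near a given point it can be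
  -- enlarged to one fixed finite set by local finiteness.
  · refine DiffForm.smoothOn_of_locally fun x _ => ?_
    obtain ⟨N, hN, hNf⟩ := ρ.locallyFinite x
    obtain ⟨N', hN'N, hN'o, hxN'⟩ := mem_nhds_iff.1 hN
    refine ⟨N', hN'o, hxN', ?_⟩
    have hterm : ∀ j : M, DiffForm.SmoothOn
        (fun x => ρ j x • chartTamingForm (m := m) G v j x : DiffForm m M 1) univ := fun j =>
      DiffForm.SmoothOn.smul_of_tsupport (isOpen_extChartAt_source j) (ρ j).contMDiff
        (smoothOn_chartTamingForm hv j) (tsupport_chartPartition_subset j)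
    have hs : DiffForm.SmoothOn (fun x => ∑ j ∈ hNf.toFinset, ρ j x • chartTamingForm (m := m) G v j x :
        DiffForm m M 1) univ := by
      intro i
      have e : DiffForm.inChart (fun x => ∑ j ∈ hNf.toFinset, ρ j x • chartTamingForm (m := m) G v j x :
          DiffForm m M 1) i = fun y => ∑ j ∈ hNf.toFinset, DiffForm.inChart
            (fun x => ρ j x • chartTamingForm (m := m) G v j x : DiffForm m M 1) i y := by
        funext y
        exact map_sum (ContinuousAlternatingMap.compContinuousLinearMapCLM
          (mfderiv 𝓘(ℝ, 𝔼) (𝓡 m) (extChartAt (𝓡 m) i).symm y : 𝔼 →L[ℝ] 𝔼)) (fun j =>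
            (ρ j _ • chartTamingForm (m := m) G v j _ : 𝔼 [⋀^Fin 1]→L[ℝ] ℝ)) hNf.toFinset
      rw [e]
      exact ContDiffOn.sum fun j _ => hterm j i
    refine (hs.mono (subset_univ N')).congr fun z hz => ?_
    refine Finset.sum_subset (fun j hj => ?_) fun j _ hj => ?_
    · rw [Set.Finite.mem_toFinset] at hj ⊢
      exact ⟨z, hj, hN'N hz⟩
    · rw [Set.Finite.mem_toFinset, mem_setOf_eq, not_not] at hj
      rw [hj, zero_smul]
  · rw [hval]
    exact Finset.sum_nonneg fun j _ => mul_nonneg (ρ.nonneg j x) (sq_nonneg _)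
  · rw [hval]
    obtain ⟨j, hj⟩ := ρ.exists_pos_of_mem (mem_univ x)
    refine Finset.sum_pos' (fun j _ => mul_nonneg (ρ.nonneg j x) (sq_nonneg _))
      ⟨j, (Set.Finite.mem_toFinset _).2 hj.ne', mul_pos hj (pow_pos (norm_pos_iff.2 fun h0 => hx ?_) 2)⟩
    have hxs : x ∈ (extChartAt (𝓡 m) j).source :=
      tsupport_chartPartition_subset j (subset_tsupport _ hj.ne')
    have h2 := mfderiv_symm_chartVec hxs (fundamentalField (m := m) G (v x) x)
    rw [h0] at h2
    exact h2.symm.trans (map_zero (mfderiv 𝓘(ℝ, 𝔼) (𝓡 m) (extChartAt (𝓡 m) j).symm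
      (extChartAt (𝓡 m) j x) : 𝔼 →L[ℝ] 𝔼))

end TamingForm

/-! ### Invariant taming forms and `1`-forms with prescribed value on the taming field -/

section InvariantData

variable {d m : ℕ} {G : Type*} [Group G] [TopologicalSpace G]
  [ChartedSpace (EuclideanSpace ℝ (Fin d)) G] [LieGroup (𝓡 d) ∞ G]
  {M : Type*} [TopologicalSpace M] [ChartedSpace (EuclideanSpace ℝ (Fin m)) M] [MulAction G M]

local notation "𝔼" => EuclideanSpace ℝ (Fin m)
local notation "𝔾" => EuclideanSpace ℝ (Fin d)

lemma Ad_inv_Ad (g : G) (X : 𝔾) : Ad g⁻¹ (Ad g X) = X := by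
  have hc : ∀ g : G, ContMDiff (𝓡 d) (𝓡 d) ∞ fun h : G => g * h * g⁻¹ := fun g =>
    ContMDiff.mul (I := 𝓡 d) (ContMDiff.mul (I := 𝓡 d) contMDiff_const contMDiff_id) contMDiff_const
  have h1 := mfderiv_comp_of_eq (x := (1 : G)) (y := (1 : G))
    (((hc g⁻¹).contMDiffAt (x := 1)).mdifferentiableAt (by simp))
    (((hc g).contMDiffAt (x := 1)).mdifferentiableAt (by simp)) (by simp)
  have h2 : ((fun h : G => g⁻¹ * h * g⁻¹⁻¹) ∘ fun h : G => g * h * g⁻¹) = id := by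
    funext h
    simp only [Function.comp_apply, id_eq]
    group
  rw [h2, mfderiv_id] at h1
  have key : ∀ (z : G) (_ : z = 1) (Y : 𝔾), (mfderiv (𝓡 d) (𝓡 d)
      (fun h : G => g⁻¹ * h * g⁻¹⁻¹) z : 𝔾 →L[ℝ] 𝔾) Y = Ad g⁻¹ Y := by
    rintro z rfl Y; rfl
  have h3 := congrArg (fun T : 𝔾 →L[ℝ] 𝔾 => T X) h1
  exact ((h3 : X = _).trans (key _ (by simp) _)).symm

variable [IsManifold (𝓡 m) ∞ M] [ContMDiffSMul (𝓡 d) (𝓡 m) ∞ G M]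

lemma IsTamingMap.fundamentalField_smul {v : M → 𝔾} (hv : IsTamingMap (m := m) G v) (g : G) (x : M) :
    fundamentalField G (v (g • x)) (g • x) =
      mfderiv (𝓡 m) (𝓡 m) (fun y : M => g • y) x (fundamentalField (m := m) G (v x) x) := by
  rw [HamiltonianLocalization.fundamentalField_smul (d := d) (m := m), hv.equivariant, Ad_inv_Ad]

lemma IsTamingMap.smul_mem_localizingSet {v : M → 𝔾} (hv : IsTamingMap (m := m) G v) (g : G) {x : M}
    (hx : x ∈ localizingSet G m v) : g • x ∈ localizingSet G m v := by
  change fundamentalField (m := m) G (v (g • x)) (g • x) = 0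
  have hx' : fundamentalField (m := m) G (v x) x = 0 := hx
  rw [hv.fundamentalField_smul, hx']
  exact map_zero (mfderiv (𝓡 m) (𝓡 m) (fun y : M => g • y) x : 𝔼 →L[ℝ] 𝔼)

lemma IsTamingMap.smul_mem_localizingSet_iff {v : M → 𝔾} (hv : IsTamingMap (m := m) G v) (g : G)
    {x : M} : g • x ∈ localizingSet G m v ↔ x ∈ localizingSet G m v :=
  ⟨fun h => by simpa using hv.smul_mem_localizingSet g⁻¹ h, hv.smul_mem_localizingSet g⟩

/-- The value of a `1`-form on the fundamental vector field of `v`. -/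
def tameValue (G : Type*) [Group G] [TopologicalSpace G]
    [ChartedSpace (EuclideanSpace ℝ (Fin d)) G] [MulAction G M] (v : M → EuclideanSpace ℝ (Fin d))
    (θ : DiffForm m M 1) (x : M) : ℝ :=
  formMoment d G θ x (v x)

lemma tameValue_smul {v : M → 𝔾} (hv : IsTamingMap (m := m) G v) {θ : DiffForm m M 1}
    (hθ : InvariantForm G univ θ) (g : G) (x : M) :
    tameValue G v θ (g • x) = tameValue G v θ x := by
  rw [tameValue, formMoment_smul hθ g (mem_univ x), hv.equivariant]
  change formMoment d G θ x (Ad g⁻¹ (Ad g (v x))) = _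
  rw [Ad_inv_Ad, tameValue]

lemma contMDiff_tameValue {v : M → 𝔾} (hv : IsTamingMap (m := m) G v) {θ : DiffForm m M 1}
    (hθ : θ.SmoothOn univ) : ContMDiff (𝓡 m) 𝓘(ℝ, ℝ) ∞ (tameValue G v θ) :=
  (contMDiffOn_univ.1 (contMDiffOn_formMoment isOpen_univ (fun _ _ _ => mem_univ _) hθ)).clm_apply
    hv.smooth

lemma integral_pos_of_continuous_pos [MeasurableSpace G] [BorelSpace G] [CompactSpace G]
    [T2Space G] (μ : Measure G) [IsProbabilityMeasure μ] {f : G → ℝ} (hf : Continuous f)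
    (h0 : ∀ g, 0 < f g) : 0 < ∫ g, f g ∂μ := by
  have hi : Integrable f μ := by
    rw [← integrableOn_univ]
    exact hf.continuousOn.integrableOn_compact isCompact_univ
  rw [integral_pos_iff_support_of_nonneg (fun g => (h0 g).le) hi]
  have : Function.support f = univ := eq_univ_of_forall fun g => (h0 g).ne'
  rw [this, measure_univ]
  exact one_pos

/-- The rescaling of a taming form that realizes a prescribed invariant function on the fundamental
vector field. -/
lemma exists_form_of_tameValue {v : M → 𝔾} (hv : IsTamingMap (m := m) G v) {θ : DiffForm m M 1}
    (hθ : θ.SmoothOn univ) (hθi : InvariantForm G univ θ) {V N : Set M} (hV : IsOpen V)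
    (hN : IsOpen N) {f : M → ℝ} (hf : ContMDiffOn (𝓡 m) 𝓘(ℝ, ℝ) ∞ f V)
    (hfi : ∀ (g : G), ∀ x ∈ V, f (g • x) = f x) (hfN : ∀ x ∈ N, f x = 0)
    (hVN : ∀ x ∈ V, x ∈ N ∨ tameValue G v θ x ≠ 0) :
    ∃ β : DiffForm m M 1, β.SmoothOn V ∧ InvariantForm G V β ∧
      (∀ x ∈ V, formMoment d G β x (v x) = - f x) ∧ (∀ x ∈ N, dForm β x = 0) ∧
      ∀ x ∈ N, formMoment d G β x = 0 := by
  set F := tameValue G v θ with hF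
  have hFs := contMDiff_tameValue hv hθ
  -- The quotient is meaningful wherever `F` is nonzero. At a zero of `F` in `V` the point lies in
  -- `N`, where `f` and hence `β` vanish, whatever the value of the quotient by zero.
  let β : DiffForm m M 1 := fun x => (-(f x / F x)) • θ x
  have hβN : ∀ x ∈ N, β x = 0 := fun x hx => by simp [β, hfN x hx]
  refine ⟨β, ?_, fun g x hx => ?_, fun x hx => ?_, fun x hx => ?_, fun x hx => ?_⟩
  · refine DiffForm.smoothOn_of_locally fun x hx => ?_
    rcases hVN x hx with h | h
    · exact ⟨N, hN, h, (DiffForm.smoothOn_zero (m := m) (k := 1) N).congr hβN⟩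
    · have ho : IsOpen (V ∩ {x | F x ≠ 0}) := hV.inter (hFs.continuous.isOpen_preimage _ isOpen_ne)
      refine ⟨_, ho, ⟨hx, h⟩, DiffForm.SmoothOn.smul ?_ (hθ.mono (subset_univ _))⟩
      exact ((hf.mono inter_subset_left).div₀ hFs.contMDiffOn fun x hx => hx.2).neg
  · have h1 : f (g • x) / F (g • x) = f x / F x := by rw [hfi g x hx, hF, tameValue_smul hv hθi]
    have h2 := hθi g x (mem_univ x)
    change ((-(f (g • x) / F (g • x))) • θ (g • x)).compContinuousLinearMap _ = _
    rw [h1]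
    exact congrArg (fun T : 𝔼 [⋀^Fin 1]→L[ℝ] ℝ => (-(f x / F x)) • T) h2
  · have h1 : formMoment d G β x (v x) = -(f x / F x) * F x := by
      rw [formMoment_apply]
      change -(f x / F x) * θ x ![fundamentalField G (v x) x] = _
      rw [← formMoment_apply]
      rfl
    rw [h1]
    rcases hVN x hx with h | h
    · rw [hfN x h]; simp
    · field_simp
  · have hx1 : x ∈ N := hx
    have e : β.inChart x =ᶠ[𝓝 (extChartAt (𝓡 m) x x)] fun _ => 0 := by
      have hy : extChartAt (𝓡 m) x x ∈ chartDomain N x := by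
        refine ⟨mem_extChartAt_target x, ?_⟩
        rw [mem_preimage, (extChartAt (𝓡 m) x).left_inv (mem_extChartAt_source x)]
        exact hx
      filter_upwards [(isOpen_chartDomain hN x).mem_nhds hy] with z hz
      rw [DiffForm.inChart, hβN _ hz.2]
      rfl
    have h2 : extDeriv (β.inChart x) (extChartAt (𝓡 m) x x) = 0 := by
      rw [e.extDeriv_eq, extDeriv, fderiv_fun_const]
      exact map_zero (ContinuousAlternatingMap.alternatizeUncurryFinCLM ℝ 𝔼 ℝ)
    exact h2
  · ext X
    rw [formMoment_apply, hβN x hx]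
    rfl

variable [T2Space G] [CompactSpace G] [T2Space M] [SecondCountableTopology M]

/-- There is an invariant `1`-form that is positive on the fundamental vector field of a taming map
off its localizing set. -/
lemma exists_invariant_tamingForm {v : M → 𝔾} (hv : IsTamingMap (m := m) G v) :
    ∃ θ : DiffForm m M 1, θ.SmoothOn univ ∧ InvariantForm G univ θ ∧
      ∀ x, x ∉ localizingSet G m v → 0 < tameValue G v θ x := by
  obtain ⟨θ, hθ, -, hθpos⟩ := exists_tamingForm (G := G) hv.smooth
  haveI := topologicalGroup_of_lieGroup (𝓡 d) ∞ (G := G)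
  letI : MeasurableSpace G := borel G
  haveI : BorelSpace G := ⟨rfl⟩
  obtain ⟨μ, hμ, hμr⟩ := exists_rightInvariant_probability (G := G)
  refine ⟨avgForm μ θ, smoothOn_avgForm (d := d) μ hθ, invariantForm_avgForm (d := d) μ hθ,
    fun x hx => ?_⟩
  have h1 : tameValue G v (avgForm μ θ) x = ∫ g : G, tameValue G v θ (g • x) ∂μ := by
    rw [tameValue, formMoment_apply, avgForm_apply (d := d) μ hθ]
    refine integral_congr_ae (Filter.Eventually.of_forall fun g => ?_)
    simp only [tameValue, formMoment_apply]
    rw [hv.fundamentalField_smul]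
    congr 1; ext i; fin_cases i; rfl
  rw [h1]
  refine integral_pos_of_continuous_pos μ ((contMDiff_tameValue hv hθ).continuous.comp
    (contMDiff_smul_const (d := d) (m := m) x).continuous) fun g => ?_
  change 0 < tameValue G v θ (g • x)
  rw [tameValue, formMoment_apply]
  -- The localizing set is invariant, so along the orbit of a point outside it the integrand stays
  -- strictly positive.
  exact hθpos _ fun h => hx ((hv.smul_mem_localizingSet_iff g).1 h)

end InvariantData

/-! ### Invariant cutoff functions -/

section Cutoff

variable {d m : ℕ} {G : Type*} [Group G] [TopologicalSpace G]
  [ChartedSpace (EuclideanSpace ℝ (Fin d)) G] [T2Space G] [CompactSpace G]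
  {M : Type*} [TopologicalSpace M] [ChartedSpace (EuclideanSpace ℝ (Fin m)) M] [MulAction G M]
  [IsManifold (𝓡 m) ∞ M] [T2Space M] [SecondCountableTopology M]

local notation "𝔼" => EuclideanSpace ℝ (Fin m)

/-- An invariant smooth cutoff function that vanishes exactly off `U` and equals `1` near `C`. -/
lemma exists_invariant_cutoff [LieGroup (𝓡 d) ∞ G] [ContMDiffSMul (𝓡 d) (𝓡 m) ∞ G M] {U C : Set M} (hU : IsOpen U) (hUi : InvariantSet G U)
    (hC : IsClosed C) (hCi : InvariantSet G C) (hCU : C ⊆ U) :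
    ∃ g : M → ℝ, ContMDiff (𝓡 m) 𝓘(ℝ, ℝ) ∞ g ∧ (∀ x, g x ∈ Icc (0 : ℝ) 1) ∧
      (∀ (h : G) x, g (h • x) = g x) ∧ (∀ x, x ∉ U → g x = 0) ∧ (∀ x ∈ U, 0 < g x) ∧
      ∃ N : Set M, IsOpen N ∧ C ⊆ N ∧ ∀ x ∈ N, g x = 1 := by
  haveI := topologicalGroup_of_lieGroup (𝓡 d) ∞ (G := G)
  letI : MeasurableSpace G := borel G
  haveI : BorelSpace G := ⟨rfl⟩
  haveI := sigmaCompactSpace_of_secondCountable m M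
  haveI := ChartedSpace.locallyCompactSpace 𝔼 M
  obtain ⟨μ, hμ, hμr⟩ := exists_rightInvariant_probability (G := G)
  obtain ⟨V, hV, hCV, hVU⟩ := normal_exists_closure_subset hC hU hCU
  obtain ⟨f, hf, hf01, hf0, hf1⟩ := exists_contMDiff_zero_iff_one_iff_of_isClosed (n := ⊤) (𝓡 m)
    hU.isClosed_compl (isClosed_closure (s := V)) (disjoint_compl_left_iff_subset.2 hVU)
  have hf01' : ∀ x, 0 ≤ f x ∧ f x ≤ 1 := fun x => hf01 (mem_range_self x)
  have hfc : ∀ x, Continuous fun h : G => f (h • x) := fun x =>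
    hf.continuous.comp (contMDiff_smul_const (d := d) (m := m) x).continuous
  have hfi : ∀ x, Integrable (fun h : G => f (h • x)) μ := fun x => by
    rw [← integrableOn_univ]
    exact (hfc x).continuousOn.integrableOn_compact isCompact_univ
  refine ⟨fun x => ∫ h : G, f (h • x) ∂μ, contMDiff_avg (d := d) μ hf, fun x => ⟨?_, ?_⟩,
    fun h x => avg_smul μ f h x, fun x hx => ?_, fun x hx => ?_,
    {x | ∀ h : G, h • x ∈ V}, ?_, fun x hx h => hCV (hCi h x hx), fun x hx => ?_⟩
  · exact integral_nonneg fun h => (hf01' _).1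
  · have := integral_mono (hfi x) (integrable_const (1 : ℝ)) fun h => (hf01' (h • x)).2
    simpa using this
  · refine integral_eq_zero_of_ae (Filter.Eventually.of_forall fun h => ?_)
    refine (hf0 _).1 fun hm => hx ?_
    simpa using hUi h⁻¹ _ hm
  · refine integral_pos_of_continuous_pos μ (hfc x) fun h => ?_
    exact lt_of_le_of_ne (hf01' _).1 fun h0 => (hf0 _).2 h0.symm (hUi h x hx)
  -- The set of points whose whole orbit lies in `V` is open because `G` is compact.
  · rw [isOpen_iff_eventually]
    intro x hx
    have := (isCompact_univ (X := G)).eventually_forall_of_forall_eventually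
      (P := fun x h => h • x ∈ V) (x₀ := x) fun h _ => ?_
    · filter_upwards [this] with z hz h using hz h (mem_univ h)
    · have hc : Continuous fun p : M × G => p.2 • p.1 :=
        ((contMDiff_smul (I := 𝓡 d) (I' := 𝓡 m) (n := ∞) (G := G) (M := M)).continuous).comp
          continuous_swap
      exact hc.continuousAt.eventually (hV.mem_nhds (hx h))
  · have : ∀ h : G, f (h • x) = 1 := fun h => (hf1 _).1 (subset_closure (hx h))
    simp [this]

end Cutoff

/-! ### Polarization through compact sublevel sets -/

section Polarized

variable {d : ℕ} {M : Type*} [TopologicalSpace M]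
  {U : Set M} {v : M → LieAlg d} {Φ : M → LieDual d}

/-- The lower bound turns the half-line into a compact interval, whose preimage is compact by
properness. -/
lemma IsPolarizedOn.isCompact_sublevel (h : IsPolarizedOn U v Φ) (c : ℝ) :
    IsCompact {x | x ∈ U ∧ Φ x (v x) ≤ c} := by
  obtain ⟨b, hb⟩ := h.2
  have h1 := (h.1.isCompact_preimage (isCompact_Icc (a := b) (b := c))).image continuous_subtype_val
  convert h1 using 1
  ext x
  constructor
  · rintro ⟨hx, hxc⟩
    exact ⟨⟨x, hx⟩, ⟨hb ⟨x, hx, rfl⟩, hxc⟩, rfl⟩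
  · rintro ⟨⟨x, hx⟩, ⟨-, hxc⟩, rfl⟩
    exact ⟨hx, hxc⟩

lemma isPolarizedOn_of_isCompact {b : ℝ} (hc : ContinuousOn (fun x => Φ x (v x)) U)
    (hb : ∀ x ∈ U, b ≤ Φ x (v x)) (hK : ∀ c, IsCompact {x | x ∈ U ∧ Φ x (v x) ≤ c}) :
    IsPolarizedOn U v Φ := by
  have hcr : Continuous (U.domRestrict fun x => Φ x (v x)) := continuousOn_iff_continuous_restrict.1 hc
  refine ⟨isProperMap_iff_isCompact_preimage.2 ⟨hcr, fun K hKc => ?_⟩, b, ?_⟩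
  · obtain ⟨c, hKb⟩ := hKc.bddAbove
    have h1 : IsCompact ((U.domRestrict fun x => Φ x (v x)) ⁻¹' Iic c) := by
      rw [Subtype.isCompact_iff]
      convert hK c using 1
      ext x
      constructor
      · rintro ⟨⟨x, hx⟩, hxc, rfl⟩
        exact ⟨hx, hxc⟩
      · rintro ⟨hx, hxc⟩
        exact ⟨⟨x, hx⟩, hxc, rfl⟩
    exact h1.of_isClosed_subset (hKc.isClosed.preimage hcr) (preimage_mono fun t ht => hKb ht)
  · rintro _ ⟨x, hx, rfl⟩
    exact hb x hx

/-- Boundedness of the taming map enters here: a point where `⟨Φ, v⟩` exceeds `c` cannot contribute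
to the integral of `φ`, for any moment map `Φ`. -/
lemma exists_bound_of_tsupport (hvb : Bornology.IsBounded (range v))
    (φ : 𝓓((⊤ : TopologicalSpace.Opens (LieDual d)), ℝ)) :
    ∃ c : ℝ, ∀ ξ ∈ tsupport φ, ∀ x, ξ (v x) ≤ c := by
  obtain ⟨S, hS⟩ := hvb.exists_norm_le
  obtain ⟨R, hR⟩ := φ.hasCompactSupport.isCompact.isBounded.exists_norm_le
  refine ⟨R * S, fun ξ hξ x => (le_abs_self _).trans ?_⟩
  have h1 := ξ.le_opNorm (v x)
  have h2 : 0 ≤ R := (norm_nonneg ξ).trans (hR ξ hξ)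
  calc |ξ (v x)| ≤ ‖ξ‖ * ‖v x‖ := h1
    _ ≤ R * S := mul_le_mul (hR ξ hξ) (hS _ ⟨x, rfl⟩) (norm_nonneg _) h2

end Polarized

/-! ### Localization to a neighbourhood of the localizing set -/

section Localization

variable {d n : ℕ} {M : Type*} [TopologicalSpace M]
  [ChartedSpace (EuclideanSpace ℝ (Fin (2 * n))) M] [IsManifold (𝓡 (2 * n)) ∞ M] [T2Space M]
  [SecondCountableTopology M]

lemma DH_mono (o : ManifoldOrientation (2 * n) M) {U V : Set M} (hU : IsOpen U) (hVU : V ⊆ U)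
    (σ : DiffForm (2 * n) M 2) (Φ : M → LieDual d)
    (φ : 𝓓((⊤ : TopologicalSpace.Opens (LieDual d)), ℝ)) (h0 : ∀ x ∈ U, x ∉ V → φ (Φ x) = 0) :
    DH o U σ Φ φ = DH o V σ Φ φ := by
  rw [DH, DH, integralForm, integralForm]
  refine finsum_congr fun j => ?_
  refine setIntegral_eq_of_subset_of_forall_sdiff_eq_zero (isOpen_chartDomain hU j).measurableSet
    (inter_subset_inter_right _ (preimage_mono hVU)) fun y hy => ?_
  rw [h0 _ hy.1.2 fun h => hy.2 ⟨hy.1.1, h⟩]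
  ring

variable {G : Type*} [Group G] [TopologicalSpace G] [T2Space G] [CompactSpace G]
    [ChartedSpace (EuclideanSpace ℝ (Fin d)) G] [LieGroup (𝓡 d) ∞ G]
    [MulAction G M] [ContMDiffSMul (𝓡 d) (𝓡 (2 * n)) ∞ G M]

lemma IsHamiltonian.continuousOn_apply {U : Set M} {σ : DiffForm (2 * n) M 2} {Φ : M → LieDual d}
    (H : IsHamiltonian G U σ Φ) {v : M → LieAlg d} (hv : IsTamingMap (m := 2 * n) G v) :
    ContinuousOn (fun x => Φ x (v x)) U :=
  H.smooth_moment.continuousOn.clm_apply hv.smooth.continuous.continuousOn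

/-- It is the zero set of the continuous function `θ(v♯)`, for an invariant taming form `θ`. -/
lemma IsTamingMap.isClosed_localizingSet {v : M → LieAlg d} (hv : IsTamingMap (m := 2 * n) G v) :
    IsClosed (localizingSet G (2 * n) v) := by
  obtain ⟨θ, hθ, -, hpos⟩ := exists_invariant_tamingForm hv
  have h : localizingSet G (2 * n) v = {x | tameValue G v θ x = 0} := by
    ext x
    constructor
    · intro hx
      have hx' : fundamentalField (m := 2 * n) G (v x) x = 0 := hx
      change formMoment d G θ x (v x) = 0
      rw [formMoment_apply, hx']
      exact (θ x).map_coord_zero 0 rfl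
    · intro hx
      by_contra hn
      exact (hpos x hn).ne' hx
  rw [h]
  exact isClosed_eq (contMDiff_tameValue hv hθ).continuous continuous_const

/-- A polarized Hamiltonian structure on `U₀` can be localized to an invariant neighbourhood `U` of
the localizing set without changing the Duistermaat-Heckman integral of a given test function. -/
theorem exists_localization (o : ManifoldOrientation (2 * n) M) {v : M → LieAlg d}
    (hv : IsTamingMap (m := 2 * n) G v) (hvb : Bornology.IsBounded (range v)) {U₀ U : Set M}
    {σ₀ : DiffForm (2 * n) M 2} {Φ₀ : M → LieDual d} (H : IsHamiltonian G U₀ σ₀ Φ₀)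
    (hp : IsPolarizedOn U₀ v Φ₀) (hU : IsOpen U) (hUi : InvariantSet G U) (hUU : U ⊆ U₀)
    (hC : IsClosed (U₀ ∩ localizingSet G (2 * n) v)) (hCU : U₀ ∩ localizingSet G (2 * n) v ⊆ U)
    (φ : 𝓓((⊤ : TopologicalSpace.Opens (LieDual d)), ℝ)) :
    ∃ (σ' : DiffForm (2 * n) M 2) (Φ' : M → LieDual d), IsHamiltonian G U σ' Φ' ∧
      IsPolarizedOn U v Φ' ∧ (∃ N, IsOpen N ∧ U₀ ∩ localizingSet G (2 * n) v ⊆ N ∧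
        ∀ x ∈ N, σ' x = σ₀ x ∧ Φ' x = Φ₀ x) ∧ DH o U₀ σ₀ Φ₀ φ = DH o U σ' Φ' φ := by
  obtain ⟨θ, hθ, hθi, hpos⟩ := exists_invariant_tamingForm hv
  obtain ⟨g, hg, hg01, hgi, hg0, hgpos, N, hN, hCN, hgN⟩ := exists_invariant_cutoff (d := d) (m := 2 * n) hU hUi hC
    (fun h x hx => ⟨H.invariant h x hx.1, hv.smul_mem_localizingSet h hx.2⟩) hCU
  obtain ⟨c₀, hc₀⟩ := exists_bound_of_tsupport hvb φ
  obtain ⟨b, hb⟩ := hp.2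
  have hb' : ∀ x ∈ U₀, b ≤ Φ₀ x (v x) := fun x hx => hb ⟨x, hx, rfl⟩
  -- Positive and large enough that raising `⟨Φ₀, v⟩ ≥ b` by `B` takes it above `c₀`.
  set B : ℝ := |c₀ - b| + 1 with hB
  have hB0 : 0 < B := by positivity
  have hBc : c₀ < b + B := by have := le_abs_self (c₀ - b); linarith
  have hcont : ContinuousOn (fun x => Φ₀ x (v x)) U₀ := H.continuousOn_apply hv
  have hVN : ∀ x ∈ U₀, x ∈ N ∨ tameValue G v θ x ≠ 0 := fun x hx => by
    by_cases hz : x ∈ localizingSet G (2 * n) v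
    · exact Or.inl (hCN ⟨hx, hz⟩)
    · exact Or.inr (hpos x hz).ne'
  -- the perturbation on `U₀`
  obtain ⟨β₂, hβ₂, hβ₂i, hβ₂v, hβ₂N, hβ₂N'⟩ := exists_form_of_tameValue hv hθ hθi H.isOpen hN
    (f := fun x => B * (1 - g x)) (((contMDiff_const (I' := 𝓘(ℝ, ℝ)) (c := B)).mul
      ((contMDiff_const (c := (1 : ℝ))).sub hg)).contMDiffOn)
    (fun h x _ => by simp only [hgi]) (fun x hx => by simp [hgN x hx]) hVN
  set σ₂ : DiffForm (2 * n) M 2 := fun x => σ₀ x + dForm β₂ x with hσ₂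
  set Φ₂ : M → LieDual d := fun x => Φ₀ x - formMoment d G β₂ x with hΦ₂
  have H₂ : IsHamiltonian G U₀ σ₂ Φ₂ := H.perturb hβ₂ hβ₂i
  have hΦ₂v : ∀ x ∈ U₀, Φ₂ x (v x) = Φ₀ x (v x) + B * (1 - g x) := fun x hx => by
    change Φ₀ x (v x) - formMoment d G β₂ x (v x) = _
    rw [hβ₂v x hx]; ring
  -- Outside `U` the cutoff vanishes and the full amount `B` is added. Consequently `{⟨Φ₂, v⟩ ≤ c₀}`
  -- lies in `U`, and the second perturbation, defined on `U` alone, can be compared with the first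
  -- over a compact subset of `U`.
  have hout : ∀ x ∈ U₀, x ∉ U → c₀ < Φ₂ x (v x) := fun x hx hxU => by
    rw [hΦ₂v x hx, hg0 x hxU]
    have := hb' x hx
    linarith
  -- the perturbation on `U`
  obtain ⟨β₃, hβ₃, hβ₃i, hβ₃v, hβ₃N, hβ₃N'⟩ := exists_form_of_tameValue hv hθ hθi hU hN
    (f := fun x => B * (1 - g x) ^ 2 / g x) ((((contMDiff_const (I' := 𝓘(ℝ, ℝ)) (c := B)).mul
      (((contMDiff_const (c := (1 : ℝ))).sub hg).pow 2)).contMDiffOn).div₀ hg.contMDiffOn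
        fun x hx => (hgpos x hx).ne')
    (fun h x _ => by simp only [hgi]) (fun x hx => by simp [hgN x hx]) fun x hx => hVN x (hUU hx)
  set σ₃ : DiffForm (2 * n) M 2 := fun x => σ₂ x + dForm β₃ x with hσ₃
  set Φ₃ : M → LieDual d := fun x => Φ₂ x - formMoment d G β₃ x with hΦ₃
  have H₂U := H₂.mono hU hUi hUU
  have H₃ : IsHamiltonian G U σ₃ Φ₃ := H₂U.perturb hβ₃ hβ₃i
  have hΦ₃v : ∀ x ∈ U, Φ₃ x (v x) = Φ₂ x (v x) + B * (1 - g x) ^ 2 / g x := fun x hx => by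
    change Φ₂ x (v x) - formMoment d G β₃ x (v x) = _
    rw [hβ₃v x hx]; ring
  -- The second increment is chosen so that the total `B (1 - g) + B (1 - g)² / g` collapses to `B
  -- (1 - g) / g`, which tends to infinity as `g` tends to `0`.
  have hΦ₃v' : ∀ x ∈ U, Φ₃ x (v x) = Φ₀ x (v x) + B * (1 - g x) / g x := fun x hx => by
    rw [hΦ₃v x hx, hΦ₂v x (hUU hx)]
    have := (hgpos x hx).ne'
    field_simp
    ring
  have hnn : ∀ x ∈ U, 0 ≤ B * (1 - g x) / g x := fun x hx =>
    div_nonneg (mul_nonneg hB0.le (by linarith [(hg01 x).2])) (hgpos x hx).le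
  have hnn₂ : ∀ x, 0 ≤ B * (1 - g x) := fun x => mul_nonneg hB0.le (by linarith [(hg01 x).2])
  refine ⟨σ₃, Φ₃, H₃, ?_, ⟨N, hN, hCN, fun x hx => ⟨?_, ?_⟩⟩, ?_⟩
  · refine isPolarizedOn_of_isCompact (b := b) (H₃.continuousOn_apply hv) (fun x hx => ?_)
      fun c => ?_
    · rw [hΦ₃v' x hx]
      have := hb' x (hUU hx); have := hnn x hx
      linarith
    · rcases lt_or_ge c b with hcb | hcb
      · convert isCompact_empty (X := M)
        rw [eq_empty_iff_forall_notMem]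
        rintro x ⟨hx, hxc⟩
        rw [hΦ₃v' x hx] at hxc
        have := hb' x (hUU hx); have := hnn x hx
        linarith
      · set ε : ℝ := B / (B + (c - b)) with hε
        have hε0 : 0 < ε := div_pos hB0 (by linarith)
        have hK := hp.isCompact_sublevel c
        have hgε : IsClosed {x | ε ≤ g x} := isClosed_le continuous_const hg.continuous
        have hK2 := hK.inter_right hgε
        have hsub : {x | x ∈ U₀ ∧ Φ₀ x (v x) ≤ c} ∩ {x | ε ≤ g x} ⊆ U := by
          rintro x ⟨-, hx⟩
          by_contra hxU
          rw [mem_setOf_eq, hg0 x hxU] at hx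
          linarith
        have hcl : IsClosed (({x | x ∈ U₀ ∧ Φ₀ x (v x) ≤ c} ∩ {x | ε ≤ g x}) ∩
            (fun x => Φ₃ x (v x)) ⁻¹' Iic c) :=
          ((H₃.continuousOn_apply hv).mono hsub).preimage_isClosed_of_isClosed hK2.isClosed
            isClosed_Iic
        convert hK2.of_isClosed_subset hcl inter_subset_left using 1
        ext x
        constructor
        · rintro ⟨hx, hxc⟩
          have h1 := hnn x hx
          have h2 := hb' x (hUU hx)
          have h3 := hgpos x hx
          have hxc' : Φ₃ x (v x) ≤ c := hxc
          rw [hΦ₃v' x hx] at hxc'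
          refine ⟨⟨⟨hUU hx, by linarith⟩, ?_⟩, hxc⟩
          have h4 : B * (1 - g x) / g x ≤ c - b := by linarith
          rw [div_le_iff₀ h3] at h4
          rw [mem_setOf_eq, hε, div_le_iff₀ (by linarith)]
          linarith
        · rintro ⟨hx, hxc⟩
          exact ⟨hsub hx, hxc⟩
  · simp only [hσ₃, hσ₂, hβ₂N x hx, hβ₃N x hx, add_zero]
  · simp only [hΦ₃, hΦ₂, hβ₂N' x hx, hβ₃N' x hx, sub_zero]
  · have hmom : ∀ (Ψ : M → LieDual d) (β : DiffForm (2 * n) M 1) (x : M) (X : LieAlg d),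
        (Ψ x - formMoment d G β x) X - Ψ x X = - β x ![fundamentalField G X x] := fun Ψ β x X => by
      rw [← formMoment_apply, sub_apply]; ring
    -- The pairing with `v` only increases along the segment, so off the initial sublevel set at
    -- `c₀` the moment map avoids the support of `φ` throughout.
    have e1 : DH o U₀ σ₀ Φ₀ φ = DH o U₀ σ₂ Φ₂ φ := by
      refine DH_eq_of_exact o (hp.isCompact_sublevel c₀) (fun x hx => hx.1) H H₂ hβ₂
        (fun x _ => rfl) (fun x _ X => hmom Φ₀ β₂ x X) φ fun x hx hxK r hr hm => hxK ⟨hx, ?_⟩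
      have h1 := hc₀ _ hm x
      simp only [add_apply, smul_apply, sub_apply, hΦ₂v x hx, smul_eq_mul] at h1
      have := mul_nonneg hr.1 (hnn₂ x)
      linarith
    have e2 : DH o U₀ σ₂ Φ₂ φ = DH o U σ₂ Φ₂ φ :=
      DH_mono o H.isOpen hUU σ₂ Φ₂ φ fun x hx hxU => image_eq_zero_of_notMem_tsupport fun hm =>
        absurd (hc₀ _ hm x) (not_le.2 (hout x hx hxU))
    have hK3 : IsCompact {x | x ∈ U₀ ∧ Φ₂ x (v x) ≤ c₀} := by
      have hK := hp.isCompact_sublevel c₀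
      have hcl := ((H₂.continuousOn_apply hv).mono fun x (hx : x ∈ {x | x ∈ U₀ ∧ Φ₀ x (v x) ≤ c₀}) =>
        hx.1).preimage_isClosed_of_isClosed hK.isClosed (isClosed_Iic (a := c₀))
      convert hK.of_isClosed_subset hcl inter_subset_left using 1
      ext x
      constructor
      · rintro ⟨hx, hxc⟩
        have hxc' : Φ₂ x (v x) ≤ c₀ := hxc
        rw [hΦ₂v x hx] at hxc'
        exact ⟨⟨hx, by linarith [hnn₂ x]⟩, hxc⟩
      · rintro ⟨hx, hxc⟩
        exact ⟨hx.1, hxc⟩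
    have e3 : DH o U σ₂ Φ₂ φ = DH o U σ₃ Φ₃ φ := by
      refine DH_eq_of_exact o hK3 (fun x hx => ?_) H₂U H₃ hβ₃
        (fun x _ => rfl) (fun x _ X => hmom Φ₂ β₃ x X) φ fun x hx hxK r hr hm => hxK ⟨hUU hx, ?_⟩
      · by_contra hxU
        exact absurd hx.2 (not_le.2 (hout x hx.1 hxU))
      · have h1 := hc₀ _ hm x
        simp only [add_apply, smul_apply, sub_apply, hΦ₃v x hx, smul_eq_mul] at h1
        have h2 : 0 ≤ B * (1 - g x) ^ 2 / g x :=
          div_nonneg (mul_nonneg hB0.le (sq_nonneg _)) (hgpos x hx).le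
        have := mul_nonneg hr.1 h2
        linarith
    rw [e1, e2, e3]

end Localization

/-! ### The homotopy operator on closed `2`-forms -/

section HomotopyOperator

variable {m : ℕ} {M : Type*} [TopologicalSpace M] [ChartedSpace (EuclideanSpace ℝ (Fin m)) M]

local notation "𝔼" => EuclideanSpace ℝ (Fin m)

/-- The contraction of a `2`-form on `ℝ × E` with `∂/∂t`, restricted to `E`. -/
def sliceContract {E : Type*} [NormedAddCommGroup E] [NormedSpace ℝ E]
    (Ω : (ℝ × E) [⋀^Fin 2]→L[ℝ] ℝ) : E [⋀^Fin 1]→L[ℝ] ℝ :=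
  covForm ((contract Ω (1, 0)).comp (ContinuousLinearMap.inr ℝ ℝ E))

lemma sliceContract_apply {E : Type*} [NormedAddCommGroup E] [NormedSpace ℝ E]
    (Ω : (ℝ × E) [⋀^Fin 2]→L[ℝ] ℝ) (v : Fin 1 → E) :
    sliceContract Ω v = Ω ![(1, 0), (0, v 0)] :=
  contract_apply Ω (1, 0) (0, v 0)

/-- The velocity of the homotopy `P`. -/
def homotopyVelocity (P : ℝ → M → M) (t : ℝ) (x : M) : TangentSpace (𝓡 m) (P t x) :=
  (mfderiv 𝓘(ℝ, ℝ) (𝓡 m) (fun s => P s x) t : ℝ →L[ℝ] EuclideanSpace ℝ (Fin m)) 1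

/-- The `1`-form `ι(∂/∂t) P^* τ` at time `t`. -/
def homotopyIntegrand (P : ℝ → M → M) (τ : DiffForm m M 2) (t : ℝ) (x : M) :
    EuclideanSpace ℝ (Fin m) [⋀^Fin 1]→L[ℝ] ℝ :=
  let T : EuclideanSpace ℝ (Fin m) [⋀^Fin 2]→L[ℝ] ℝ := τ (P t x)
  let A : EuclideanSpace ℝ (Fin m) →L[ℝ] EuclideanSpace ℝ (Fin m) := mfderiv (𝓡 m) (𝓡 m) (P t) x
  covForm ((contract T (homotopyVelocity (m := m) P t x)).comp A)

/-- The homotopy operator `- ∫₀¹ ι(∂/∂t) P^* τ dt`. -/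
def homotopyForm (P : ℝ → M → M) (τ : DiffForm m M 2) : DiffForm m M 1 := fun x =>
  (-∫ t in Icc (0 : ℝ) 1, homotopyIntegrand P τ t x : EuclideanSpace ℝ (Fin m) [⋀^Fin 1]→L[ℝ] ℝ)

lemma homotopyIntegrand_apply (P : ℝ → M → M) (τ : DiffForm m M 2) (t : ℝ) (x : M)
    (w : TangentSpace (𝓡 m) x) : homotopyIntegrand P τ t x ![w] =
      τ (P t x) ![homotopyVelocity P t x, mfderiv (𝓡 m) (𝓡 m) (P t) x w] := by
  let T : EuclideanSpace ℝ (Fin m) [⋀^Fin 2]→L[ℝ] ℝ := τ (P t x)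
  let A : EuclideanSpace ℝ (Fin m) →L[ℝ] EuclideanSpace ℝ (Fin m) := mfderiv (𝓡 m) (𝓡 m) (P t) x
  exact contract_apply T (homotopyVelocity (m := m) P t x) (A w)

variable [IsManifold (𝓡 m) ∞ M]

lemma DiffForm.eq_of_inChart_eq {k : ℕ} {σ σ' : DiffForm m M k} {j : M} {y : 𝔼}
    (hy : y ∈ (extChartAt (𝓡 m) j).target) (h : σ.inChart j y = σ'.inChart j y) :
    σ ((extChartAt (𝓡 m) j).symm y) = σ' ((extChartAt (𝓡 m) j).symm y) := by
  ext v
  have h4 : ∀ w : 𝔼, ∃ w' : 𝔼, (mfderiv 𝓘(ℝ, 𝔼) (𝓡 m) (extChartAt (𝓡 m) j).symm y :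
      𝔼 →L[ℝ] 𝔼) w' = w := fun w => by
    have e3 := mfderiv_symm_chartVec ((extChartAt (𝓡 m) j).map_target hy) w
    rw [(extChartAt (𝓡 m) j).right_inv hy] at e3
    exact ⟨_, e3⟩
  choose s hs using h4
  have h5 := congrArg (fun T : 𝔼 [⋀^Fin k]→L[ℝ] ℝ => T fun i => s (v i)) h
  have h6 : (fun i => (mfderiv 𝓘(ℝ, 𝔼) (𝓡 m) (extChartAt (𝓡 m) j).symm y :
      𝔼 →L[ℝ] 𝔼) (s (v i))) = v := funext fun i => hs _
  have h7 := congrArg (fun v : Fin k → 𝔼 => (σ ((extChartAt (𝓡 m) j).symm y) :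
      𝔼 [⋀^Fin k]→L[ℝ] ℝ) v) h6
  have h8 := congrArg (fun v : Fin k → 𝔼 => (σ' ((extChartAt (𝓡 m) j).symm y) :
      𝔼 [⋀^Fin k]→L[ℝ] ℝ) v) h6
  exact h7.symm.trans (h5.trans h8)

/-- The homotopy in the chart at `j`. -/
def homotopyChart (P : ℝ → M → M) (j : M) (q : ℝ × EuclideanSpace ℝ (Fin m)) : M :=
  P q.1 ((extChartAt (𝓡 m) j).symm q.2)

lemma isOpen_univ_prod_chartDomain {U : Set M} (hU : IsOpen U) (j : M) :
    IsOpen ((univ : Set ℝ) ×ˢ chartDomain (m := m) U j) :=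
  isOpen_univ.prod (isOpen_chartDomain hU j)

section

variable {P : ℝ → M → M} {U : Set M} {τ : DiffForm m M 2}

lemma contMDiffOn_homotopyChart
    (hP : ContMDiffOn (𝓘(ℝ, ℝ).prod (𝓡 m)) (𝓡 m) ∞ (fun q : ℝ × M => P q.1 q.2) (univ ×ˢ U))
    (j : M) : ContMDiffOn 𝓘(ℝ, ℝ × 𝔼) (𝓡 m) ∞ (homotopyChart P j) (univ ×ˢ chartDomain (m := m) U j) := by
  have h1 : ContMDiffOn 𝓘(ℝ, ℝ × 𝔼) 𝓘(ℝ, ℝ) ∞ (fun q : ℝ × 𝔼 => q.1) (univ ×ˢ chartDomain (m := m) U j) :=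
    contDiff_fst.contMDiff.contMDiffOn
  have h2 : ContMDiffOn 𝓘(ℝ, ℝ × 𝔼) (𝓡 m) ∞ (fun q : ℝ × 𝔼 => (extChartAt (𝓡 m) j).symm q.2)
      (univ ×ˢ chartDomain (m := m) U j) :=
    (contMDiffOn_extChartAt_symm (I := 𝓡 m) (n := ∞) j).comp
      (contDiff_snd.contMDiff.contMDiffOn) fun q hq => hq.2.1
  exact hP.comp (h1.prodMk h2) fun q hq => ⟨mem_univ _, hq.2.2⟩

lemma mapsTo_homotopyChart (hPU : ∀ t, MapsTo (P t) U U) (j : M) :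
    MapsTo (homotopyChart (m := m) P j) (univ ×ˢ chartDomain (m := m) U j) U := fun _ hq => hPU _ hq.2.2

lemma contMDiffAt_homotopy (hU : IsOpen U)
    (hP : ContMDiffOn (𝓘(ℝ, ℝ).prod (𝓡 m)) (𝓡 m) ∞ (fun q : ℝ × M => P q.1 q.2) (univ ×ˢ U))
    (t : ℝ) {x : M} (hx : x ∈ U) : ContMDiffAt (𝓡 m) (𝓡 m) ∞ (P t) x :=
  (hP.contMDiffAt ((isOpen_univ.prod hU).mem_nhds ⟨mem_univ t, hx⟩)).comp x
    (contMDiffAt_const.prodMk contMDiffAt_id)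

lemma contMDiffAt_homotopy_time (hU : IsOpen U)
    (hP : ContMDiffOn (𝓘(ℝ, ℝ).prod (𝓡 m)) (𝓡 m) ∞ (fun q : ℝ × M => P q.1 q.2) (univ ×ˢ U))
    (t : ℝ) {x : M} (hx : x ∈ U) : ContMDiffAt 𝓘(ℝ, ℝ) (𝓡 m) ∞ (fun s => P s x) t :=
  (hP.contMDiffAt ((isOpen_univ.prod hU).mem_nhds ⟨mem_univ t, hx⟩)).comp t
    (contMDiffAt_id.prodMk contMDiffAt_const)

lemma mfderiv_homotopyChart_inr (hU : IsOpen U)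
    (hP : ContMDiffOn (𝓘(ℝ, ℝ).prod (𝓡 m)) (𝓡 m) ∞ (fun q : ℝ × M => P q.1 q.2) (univ ×ˢ U))
    {j : M} (t : ℝ) {y : 𝔼} (hy : y ∈ chartDomain U j) :
    (mfderiv 𝓘(ℝ, ℝ × 𝔼) (𝓡 m) (homotopyChart P j) (t, y) : ℝ × 𝔼 →L[ℝ] 𝔼).comp
      (ContinuousLinearMap.inr ℝ ℝ 𝔼) = mfderiv 𝓘(ℝ, 𝔼) (𝓡 m)
        (fun z => P t ((extChartAt (𝓡 m) j).symm z)) y := by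
  have h := mfderiv_comp (I := 𝓘(ℝ, 𝔼)) (f := fun z : 𝔼 => (t, z)) y
    (mdifferentiableAt_of_contMDiffOn (contMDiffOn_homotopyChart hP j)
      (isOpen_univ_prod_chartDomain hU j) (y := (t, y)) ⟨mem_univ _, hy⟩)
    (hasFDerivAt_prodMk_right t y).differentiableAt.mdifferentiableAt
  rw [mfderiv_eq_fderiv, (hasFDerivAt_prodMk_right t y).fderiv] at h
  exact h.symm

lemma mfderiv_homotopy_comp_symm (hU : IsOpen U)
    (hP : ContMDiffOn (𝓘(ℝ, ℝ).prod (𝓡 m)) (𝓡 m) ∞ (fun q : ℝ × M => P q.1 q.2) (univ ×ˢ U))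
    {j : M} (t : ℝ) {y : 𝔼} (hy : y ∈ chartDomain U j) :
    mfderiv 𝓘(ℝ, 𝔼) (𝓡 m) (fun z => P t ((extChartAt (𝓡 m) j).symm z)) y =
      (mfderiv (𝓡 m) (𝓡 m) (P t) ((extChartAt (𝓡 m) j).symm y) : 𝔼 →L[ℝ] 𝔼).comp
        (mfderiv 𝓘(ℝ, 𝔼) (𝓡 m) (extChartAt (𝓡 m) j).symm y : 𝔼 →L[ℝ] 𝔼) :=
  mfderiv_comp y ((contMDiffAt_homotopy hU hP t hy.2).mdifferentiableAt (by simp))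
    (mdifferentiableAt_extChartAt_symm hy.1)

lemma mfderiv_homotopyChart_inl (hU : IsOpen U)
    (hP : ContMDiffOn (𝓘(ℝ, ℝ).prod (𝓡 m)) (𝓡 m) ∞ (fun q : ℝ × M => P q.1 q.2) (univ ×ˢ U))
    {j : M} (t : ℝ) {y : 𝔼} (hy : y ∈ chartDomain U j) :
    (mfderiv 𝓘(ℝ, ℝ × 𝔼) (𝓡 m) (homotopyChart P j) (t, y) : ℝ × 𝔼 →L[ℝ] 𝔼) (1, 0) =
      homotopyVelocity (m := m) P t ((extChartAt (𝓡 m) j).symm y) := by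
  have h := mfderiv_comp (I := 𝓘(ℝ, ℝ)) (f := fun s : ℝ => (s, y)) t
    (mdifferentiableAt_of_contMDiffOn (contMDiffOn_homotopyChart hP j)
      (isOpen_univ_prod_chartDomain hU j) (y := (t, y)) ⟨mem_univ _, hy⟩)
    (hasFDerivAt_prodMk_left t y).differentiableAt.mdifferentiableAt
  rw [mfderiv_eq_fderiv, (hasFDerivAt_prodMk_left t y).fderiv] at h
  exact (congrArg (fun T : ℝ →L[ℝ] 𝔼 => T 1) h).symm

/-- This compares the two descriptions of the integrand: contraction with `∂/∂t` of the pullback to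
`ℝ × ℝᵐ`, convenient for calculus, and the pointwise form on `M`, convenient for evaluating on
fundamental vectors. -/
lemma sliceContract_pull (hU : IsOpen U)
    (hP : ContMDiffOn (𝓘(ℝ, ℝ).prod (𝓡 m)) (𝓡 m) ∞ (fun q : ℝ × M => P q.1 q.2) (univ ×ˢ U))
    {j : M} (t : ℝ) {y : 𝔼} (hy : y ∈ chartDomain U j) :
    sliceContract (τ.pull (homotopyChart P j) (t, y)) =
      (homotopyIntegrand P τ t ((extChartAt (𝓡 m) j).symm y)).compContinuousLinearMap
        (mfderiv 𝓘(ℝ, 𝔼) (𝓡 m) (extChartAt (𝓡 m) j).symm y : 𝔼 →L[ℝ] 𝔼) := by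
  refine alternating_one_ext fun w => ?_
  have h1 := (mfderiv_homotopyChart_inr hU hP t hy).trans (mfderiv_homotopy_comp_symm hU hP t hy)
  have h2 := congrArg (fun T : 𝔼 →L[ℝ] 𝔼 => T w) h1
  have h3 := mfderiv_homotopyChart_inl hU hP t hy
  rw [sliceContract_apply]
  have key : ∀ (A : ℝ × 𝔼 →L[ℝ] 𝔼) (a b : 𝔼) (_ : A (1, 0) = a) (_ : A (0, w) = b),
      (τ (P t ((extChartAt (𝓡 m) j).symm y)) : 𝔼 [⋀^Fin 2]→L[ℝ] ℝ).compContinuousLinearMap A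
        ![(1, 0), (0, w)] = (τ (P t ((extChartAt (𝓡 m) j).symm y)) : 𝔼 [⋀^Fin 2]→L[ℝ] ℝ)
          ![a, b] := by
    rintro A a b rfl rfl
    change τ (P t _) _ = _
    congr 1; ext i; fin_cases i <;> rfl
  refine (key _ _ _ h3 h2).trans ?_
  refine Eq.trans ?_ (congrArg (homotopyIntegrand P τ t ((extChartAt (𝓡 m) j).symm y))
    (?_ : ![(mfderiv 𝓘(ℝ, 𝔼) (𝓡 m) (extChartAt (𝓡 m) j).symm y : 𝔼 →L[ℝ] 𝔼) w] =
      fun i => (mfderiv 𝓘(ℝ, 𝔼) (𝓡 m) (extChartAt (𝓡 m) j).symm y : 𝔼 →L[ℝ] 𝔼) (![w] i)))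
  swap
  · funext i; fin_cases i; rfl
  exact (homotopyIntegrand_apply P τ t ((extChartAt (𝓡 m) j).symm y)
    ((mfderiv 𝓘(ℝ, 𝔼) (𝓡 m) (extChartAt (𝓡 m) j).symm y : 𝔼 →L[ℝ] 𝔼) w)).symm

lemma contDiffOn_sliceContract {E X : Type*} [NormedAddCommGroup E] [NormedSpace ℝ E]
    [NormedAddCommGroup X] [NormedSpace ℝ X] [FiniteDimensional ℝ E] {W : Set X}
    {Ω : X → (ℝ × E) [⋀^Fin 2]→L[ℝ] ℝ} (h : ContDiffOn ℝ ∞ Ω W) :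
    ContDiffOn ℝ ∞ (fun q => sliceContract (Ω q)) W := by
  refine contDiffOn_alternating_iff.2 fun v => ?_
  simp only [sliceContract_apply]
  exact contDiffOn_alternating_iff.1 h _

lemma isSmoothFamily_sliceContract (hU : IsOpen U)
    (hP : ContMDiffOn (𝓘(ℝ, ℝ).prod (𝓡 m)) (𝓡 m) ∞ (fun q : ℝ × M => P q.1 q.2) (univ ×ˢ U))
    (hPU : ∀ t, MapsTo (P t) U U) (hτ : τ.SmoothOn U) (j : M) :
    IsSmoothFamily ℝ (Icc (0 : ℝ) 1) (chartDomain (m := m) U j)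
      fun t y => sliceContract (τ.pull (homotopyChart P j) (t, y)) :=
  .of_contDiffOn (isOpen_univ_prod_chartDomain hU j) (prod_mono_left (subset_univ _))
    (contDiffOn_sliceContract (hτ.pull (isOpen_univ_prod_chartDomain hU j)
      (contMDiffOn_homotopyChart hP j) (mapsTo_homotopyChart hPU j)))

lemma integrableOn_homotopyIntegrand (hU : IsOpen U)
    (hP : ContMDiffOn (𝓘(ℝ, ℝ).prod (𝓡 m)) (𝓡 m) ∞ (fun q : ℝ × M => P q.1 q.2) (univ ×ˢ U))
    (hPU : ∀ t, MapsTo (P t) U U) (hτ : τ.SmoothOn U) {x : M} (hx : x ∈ U) :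
    IntegrableOn (fun t => homotopyIntegrand P τ t x) (Icc (0 : ℝ) 1) := by
  obtain ⟨j, y, hy, rfl⟩ := exists_chart_point (m := m) hx
  have h := (isSmoothFamily_sliceContract hU hP hPU hτ j).integrableOn isCompact_Icc hy
    (μ := volume)
  let A : 𝔼 →L[ℝ] 𝔼 := mfderiv (𝓡 m) 𝓘(ℝ, 𝔼) (extChartAt (𝓡 m) j) ((extChartAt (𝓡 m) j).symm y)
  let L : (𝔼 [⋀^Fin 1]→L[ℝ] ℝ) →L[ℝ] 𝔼 [⋀^Fin 1]→L[ℝ] ℝ :=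
    ContinuousAlternatingMap.compContinuousLinearMapCLM A
  refine (L.integrable_comp h).congr (Filter.Eventually.of_forall fun t => ?_)
  have h1 : ∀ w : 𝔼, (mfderiv 𝓘(ℝ, 𝔼) (𝓡 m) (extChartAt (𝓡 m) j).symm y : 𝔼 →L[ℝ] 𝔼)
      (A w) = w := fun w => by
    have e3 := mfderiv_symm_chartVec ((extChartAt (𝓡 m) j).map_target hy.1) w
    rw [(extChartAt (𝓡 m) j).right_inv hy.1] at e3
    exact e3
  refine (congrArg L (sliceContract_pull hU hP t hy)).trans ?_
  ext v
  exact congrArg (homotopyIntegrand P τ t ((extChartAt (𝓡 m) j).symm y))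
    (funext fun i => h1 (v i))

lemma inChart_homotopyForm (hU : IsOpen U)
    (hP : ContMDiffOn (𝓘(ℝ, ℝ).prod (𝓡 m)) (𝓡 m) ∞ (fun q : ℝ × M => P q.1 q.2) (univ ×ˢ U))
    (hPU : ∀ t, MapsTo (P t) U U) (hτ : τ.SmoothOn U) {j : M} {y : 𝔼} (hy : y ∈ chartDomain U j) :
    (homotopyForm P τ).inChart j y =
      -∫ t in Icc (0 : ℝ) 1, sliceContract (τ.pull (homotopyChart P j) (t, y)) := by
  let A : 𝔼 →L[ℝ] 𝔼 := mfderiv 𝓘(ℝ, 𝔼) (𝓡 m) (extChartAt (𝓡 m) j).symm y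
  let L : (𝔼 [⋀^Fin 1]→L[ℝ] ℝ) →L[ℝ] 𝔼 [⋀^Fin 1]→L[ℝ] ℝ :=
    ContinuousAlternatingMap.compContinuousLinearMapCLM A
  have h1 := L.integral_comp_comm (integrableOn_homotopyIntegrand hU hP hPU hτ hy.2)
  have h2 : (homotopyForm P τ).inChart j y =
      L (-∫ t in Icc (0 : ℝ) 1, homotopyIntegrand P τ t ((extChartAt (𝓡 m) j).symm y)) := rfl
  rw [h2, map_neg, ← h1]
  congr 1
  exact integral_congr_ae (Filter.Eventually.of_forall fun t => (sliceContract_pull hU hP t hy).symm)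

lemma smoothOn_homotopyForm (hU : IsOpen U)
    (hP : ContMDiffOn (𝓘(ℝ, ℝ).prod (𝓡 m)) (𝓡 m) ∞ (fun q : ℝ × M => P q.1 q.2) (univ ×ˢ U))
    (hPU : ∀ t, MapsTo (P t) U U) (hτ : τ.SmoothOn U) : (homotopyForm P τ).SmoothOn U := fun j =>
  ((isSmoothFamily_sliceContract hU hP hPU hτ j).contDiffOn_integral isCompact_Icc
    (isOpen_chartDomain hU j)).neg.congr fun _ hy => inChart_homotopyForm hU hP hPU hτ hy

/-- The homotopy formula `d(hτ) = P₀^*τ - P₁^*τ` for a closed `2`-form `τ`. -/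
lemma extDeriv_homotopyForm (hU : IsOpen U)
    (hP : ContMDiffOn (𝓘(ℝ, ℝ).prod (𝓡 m)) (𝓡 m) ∞ (fun q : ℝ × M => P q.1 q.2) (univ ×ˢ U))
    (hPU : ∀ t, MapsTo (P t) U U) (hτ : τ.SmoothOn U) (hτc : τ.ClosedOn U) {j : M} {y : 𝔼}
    (hy : y ∈ chartDomain U j) :
    extDeriv ((homotopyForm P τ).inChart j) y =
      τ.pull (fun z => P 0 ((extChartAt (𝓡 m) j).symm z)) y -
        τ.pull (fun z => P 1 ((extChartAt (𝓡 m) j).symm z)) y := by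
  set Ω := τ.pull (homotopyChart (m := m) P j) with hΩ
  set W := (univ : Set ℝ) ×ˢ chartDomain (m := m) U j with hWdef
  have hW : IsOpen W := isOpen_univ_prod_chartDomain hU j
  have hΩs : ContDiffOn ℝ ∞ Ω W := hτ.pull hW (contMDiffOn_homotopyChart hP j)
    (mapsTo_homotopyChart (m := m) hPU j)
  have hfam := isSmoothFamily_sliceContract hU hP hPU hτ j
  have hder := (hfam.hasFDerivAt_integral isCompact_Icc (isOpen_chartDomain hU j) hy
    (μ := volume)).neg
  have hfd : fderiv ℝ (fun z => -∫ t in Icc (0 : ℝ) 1, sliceContract (Ω (t, z))) y =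
    -∫ t in Icc (0 : ℝ) 1, fderiv ℝ (fun z => sliceContract (Ω (t, z))) y := hder.fderiv
  have hbev : (homotopyForm P τ).inChart j =ᶠ[𝓝 y]
      fun z => -∫ t in Icc (0 : ℝ) 1, sliceContract (Ω (t, z)) := by
    filter_upwards [(isOpen_chartDomain (m := m) hU j).mem_nhds hy] with z (hz : z ∈ chartDomain (m := m) U j)
      using inChart_homotopyForm hU hP hPU hτ hz
  have hslice : ∀ t w₁ w₂, Ω (t, y) ![(0, w₁), (0, w₂)] =
      τ.pull (fun z => P t ((extChartAt (𝓡 m) j).symm z)) y ![w₁, w₂] := by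
    intro t w₁ w₂
    have h1 := mfderiv_homotopyChart_inr hU hP t hy
    rw [DiffForm.pull, ← h1]
    change τ (P t _) _ = τ (P t _) _
    congr 1; ext i; fin_cases i <;> rfl
  refine alternating_two_ext fun w₁ w₂ => ?_
  rw [ContinuousAlternatingMap.sub_apply, ← hslice, ← hslice, hbev.extDeriv_eq, extDeriv, hfd]
  let L : (𝔼 →L[ℝ] 𝔼 [⋀^Fin 1]→L[ℝ] ℝ) →L[ℝ] ℝ :=
    (ContinuousAlternatingMap.apply ℝ 𝔼 ℝ ![w₁, w₂]).comp
      (ContinuousAlternatingMap.alternatizeUncurryFinCLM ℝ 𝔼 ℝ)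
  have hL := L.integral_comp_comm (hfam.derivative.integrableOn isCompact_Icc hy (μ := volume))
  have hLn : ContinuousAlternatingMap.alternatizeUncurryFin
      (-∫ t in Icc (0 : ℝ) 1, fderiv ℝ (fun z => sliceContract (Ω (t, z))) y) ![w₁, w₂] =
      -∫ t in Icc (0 : ℝ) 1, L (fderiv ℝ (fun z => sliceContract (Ω (t, z))) y) := by
    rw [hL, ← map_neg]; rfl
  refine hLn.trans ?_
  have hyW : ∀ t : ℝ, W ∈ 𝓝 (t, y) := fun t => hW.mem_nhds ⟨mem_univ _, hy⟩
  have hΩd : ∀ t : ℝ, HasFDerivAt Ω (fderiv ℝ Ω (t, y)) (t, y) := fun t =>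
    ((hΩs.contDiffAt (hyW t)).differentiableAt (by simp)).hasFDerivAt
  have hev : ∀ (t : ℝ) (w a : 𝔼), t ∈ Icc (0 : ℝ) 1 →
      fderiv ℝ (fun z => sliceContract (Ω (t, z))) y w ![a] =
        fderiv ℝ Ω (t, y) (0, w) ![(1, 0), (0, a)] := by
    intro t w a ht
    have h1 := (ContinuousAlternatingMap.apply ℝ 𝔼 ℝ ![a]).hasFDerivAt.comp y
      (hfam.hasFDerivAt ht hy)
    have h2 := (ContinuousAlternatingMap.apply ℝ (ℝ × 𝔼) ℝ ![(1, 0), (0, a)]).hasFDerivAt.comp y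
      ((hΩd t).comp y (hasFDerivAt_prodMk_right t y))
    have h3 : (⇑(ContinuousAlternatingMap.apply ℝ 𝔼 ℝ ![a]) ∘
        fun z => sliceContract (Ω (t, z))) = ⇑(ContinuousAlternatingMap.apply ℝ (ℝ × 𝔼) ℝ
          ![(1, 0), (0, a)]) ∘ Ω ∘ Prod.mk t := by
      funext z
      change sliceContract (Ω (t, z)) ![a] = Ω (t, z) ![(1, 0), (0, a)]
      rw [sliceContract_apply]
      rfl
    have h4 := (h3 ▸ h1).unique h2
    exact congrArg (fun T : 𝔼 →L[ℝ] ℝ => T w) h4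
  -- Closedness of the pullback, evaluated on `∂/∂t` and two spatial vectors, trades the spatial
  -- derivatives of the contraction for the time derivative of the slice.
  have hclosed : ∀ t : ℝ, fderiv ℝ Ω (t, y) (0, w₁) ![(1, 0), (0, w₂)] -
      fderiv ℝ Ω (t, y) (0, w₂) ![(1, 0), (0, w₁)] =
        fderiv ℝ Ω (t, y) (1, 0) ![(0, w₁), (0, w₂)] := by
    intro t
    have h1 := hτc.extDeriv_pull hU hτ hW (contMDiffOn_homotopyChart hP j)
      (mapsTo_homotopyChart hPU j) (y := (t, y)) ⟨mem_univ _, hy⟩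
    have h2 := congrArg (fun T : (ℝ × 𝔼) [⋀^Fin 3]→L[ℝ] ℝ => T ![(1, 0), (0, w₁), (0, w₂)]) h1
    have h3 : extDeriv Ω (t, y) ![(1, 0), (0, w₁), (0, w₂)] = 0 := h2
    rw [extDeriv, alternatizeUncurryFin_three_apply] at h3
    linarith
  have hint : ∀ t ∈ Icc (0 : ℝ) 1, L (fderiv ℝ (fun z => sliceContract (Ω (t, z))) y) =
      fderiv ℝ Ω (t, y) (1, 0) ![(0, w₁), (0, w₂)] := by
    intro t ht
    rw [← hclosed, ← hev t w₁ w₂ ht, ← hev t w₂ w₁ ht]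
    exact alternatizeUncurryFin_two_apply _ _ _
  have hcurve : ∀ t : ℝ, HasDerivAt (fun s : ℝ => Ω (s, y) ![(0, w₁), (0, w₂)])
      (fderiv ℝ Ω (t, y) (1, 0) ![(0, w₁), (0, w₂)]) t := by
    intro t
    have h1 := HasFDerivAt.comp (f := fun s : ℝ => (s, y)) t (hΩd t) (hasFDerivAt_prodMk_left t y)
    have h2 := ((ContinuousAlternatingMap.apply ℝ (ℝ × 𝔼) ℝ
      ![(0, w₁), (0, w₂)]).hasFDerivAt.comp t h1).hasDerivAt
    exact h2
  have hΩf : ContDiffOn ℝ ∞ (fderiv ℝ Ω) W := hΩs.fderiv_of_isOpen hW (by simp)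
  have hcont : Continuous fun t : ℝ => fderiv ℝ Ω (t, y) (1, 0) ![(0, w₁), (0, w₂)] :=
    (ContinuousAlternatingMap.apply ℝ (ℝ × 𝔼) ℝ ![(0, w₁), (0, w₂)]).continuous.comp
      ((hΩf.continuousOn.comp_continuous (f := fun t : ℝ => (t, y)) (by fun_prop)
        fun t => ⟨mem_univ _, hy⟩).clm_apply continuous_const)
  -- Integrating the time derivative leaves the difference between the end slices; the minus sign in
  -- `homotopyForm` makes it slice `0` minus slice `1`.
  have hFTC := intervalIntegral.integral_eq_sub_of_hasDerivAt (a := 0) (b := 1)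
    (fun t _ => hcurve t) (hcont.intervalIntegrable _ _)
  rw [setIntegral_congr_fun measurableSet_Icc hint, integral_Icc_eq_integral_Ioc,
    ← intervalIntegral.integral_of_le zero_le_one, hFTC]
  ring

end

end HomotopyOperator

/-! ### Primitives from a weak deformation retraction -/

section

variable {m : ℕ} {M : Type*} [TopologicalSpace M] [ChartedSpace (EuclideanSpace ℝ (Fin m)) M]

local notation "𝔼" => EuclideanSpace ℝ (Fin m)

/-- Reparametrizing time by a smooth step function with values in `[0, 1]` extends the homotopy
smoothly to all real times and avoids one-sided derivatives at the ends. -/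
lemma HasWeakDeformationRetraction.exists_homotopy {G : Type*} [Group G] [MulAction G M]
    {U C : Set M} (h : HasWeakDeformationRetraction G m U C) : ∃ P : ℝ → M → M,
      ContMDiffOn (𝓘(ℝ, ℝ).prod (𝓡 m)) (𝓡 m) ∞ (fun q : ℝ × M => P q.1 q.2) (univ ×ˢ U) ∧
      (∀ t, MapsTo (P t) U U) ∧ (∀ t (g : G), ∀ x ∈ U, P t (g • x) = g • P t x) ∧
      (∀ x ∈ U, P 0 x = x) ∧ ∀ x ∈ U, P 1 x ∈ C := by
  obtain ⟨p, hp, hpU, hpg, hp0, hp1, -⟩ := h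
  have hI : ∀ t, Real.smoothTransition t ∈ Icc (0 : ℝ) 1 := fun t =>
    ⟨Real.smoothTransition.nonneg t, Real.smoothTransition.le_one t⟩
  refine ⟨fun t => p (Real.smoothTransition t), ?_, fun t => hpU _ (hI t), fun t => hpg _ (hI t),
    fun x hx => ?_, fun x hx => ?_⟩
  · have h1 : ContMDiff 𝓘(ℝ, ℝ) 𝓘(ℝ, ℝ) ∞ Real.smoothTransition :=
      Real.smoothTransition.contDiff.contMDiff
    have h2 : ContMDiff (𝓘(ℝ, ℝ).prod (𝓡 m)) (𝓘(ℝ, ℝ).prod (𝓡 m)) ∞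
        fun q : ℝ × M => (Real.smoothTransition q.1, q.2) :=
      (h1.comp contMDiff_fst).prodMk contMDiff_snd
    exact hp.comp h2.contMDiffOn fun q hq => ⟨hI _, hq.2⟩
  · change p (Real.smoothTransition 0) x = x
    rw [Real.smoothTransition.zero]
    exact hp0 x hx
  · change p (Real.smoothTransition 1) x ∈ C
    rw [Real.smoothTransition.one]
    exact hp1 x hx

lemma DiffForm.pull_congr {F : Type} [NormedAddCommGroup F] [NormedSpace ℝ F] {k : ℕ}
    (σ : DiffForm m M k) {f f' : F → M} {y : F} (h : f =ᶠ[𝓝 y] f') : σ.pull f y = σ.pull f' y := by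
  have h1 : f y = f' y := h.self_of_nhds
  have h2 := h.mfderiv_eq (I := 𝓘(ℝ, F)) (I' := 𝓡 m)
  have key : ∀ (x x' : M) (_ : x = x') (A A' : F →L[ℝ] 𝔼) (_ : A = A'),
      (σ x : 𝔼 [⋀^Fin k]→L[ℝ] ℝ).compContinuousLinearMap A =
        (σ x' : 𝔼 [⋀^Fin k]→L[ℝ] ℝ).compContinuousLinearMap A' := by
    rintro x _ rfl A _ rfl; rfl
  exact key _ _ h1 _ _ h2

/-- The difference of two forms. -/
def formDiff {k : ℕ} (σ₀ σ₁ : DiffForm m M k) : DiffForm m M k := fun x => σ₁ x - σ₀ x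

lemma inChart_formDiff {k : ℕ} (σ₀ σ₁ : DiffForm m M k) (j : M) :
    (formDiff σ₀ σ₁).inChart j = σ₁.inChart j - σ₀.inChart j := rfl

lemma pull_formDiff {F : Type} [NormedAddCommGroup F] [NormedSpace ℝ F] {k : ℕ}
    (σ₀ σ₁ : DiffForm m M k) (f : F → M) (y : F) :
    (formDiff σ₀ σ₁).pull f y = σ₁.pull f y - σ₀.pull f y := rfl

lemma DiffForm.SmoothOn.formDiff {k : ℕ} {σ₀ σ₁ : DiffForm m M k} {U : Set M}
    (h₀ : σ₀.SmoothOn U) (h₁ : σ₁.SmoothOn U) : (formDiff σ₀ σ₁).SmoothOn U := fun j => by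
  rw [inChart_formDiff]
  exact (h₁ j).sub (h₀ j)

lemma DiffForm.ClosedOn.formDiff {k : ℕ} {σ₀ σ₁ : DiffForm m M k} {U : Set M} (hU : IsOpen U)
    (h₀ : σ₀.SmoothOn U) (h₁ : σ₁.SmoothOn U) (hc₀ : σ₀.ClosedOn U) (hc₁ : σ₁.ClosedOn U)
    [IsManifold (𝓡 m) ∞ M] :
    (formDiff σ₀ σ₁).ClosedOn U := fun j y hy => by
  have hd : ∀ {σ : DiffForm m M k}, σ.SmoothOn U → DifferentiableAt ℝ (σ.inChart j) y := fun h =>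
    ((h j).contDiffAt ((isOpen_chartDomain hU j).mem_nhds hy)).differentiableAt (by simp)
  have h2 := (hd h₁).hasFDerivAt.sub (hd h₀).hasFDerivAt
  have h3 : extDeriv (σ₁.inChart j - σ₀.inChart j) y =
      extDeriv (σ₁.inChart j) y - extDeriv (σ₀.inChart j) y := by
    rw [extDeriv, h2.fderiv]
    exact map_sub (ContinuousAlternatingMap.alternatizeUncurryFinCLM ℝ 𝔼 ℝ) _ _
  rw [inChart_formDiff, h3, hc₁ j y hy, hc₀ j y hy, sub_zero]

variable [IsManifold (𝓡 m) ∞ M]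

/-- If two closed forms agree on `C`, the homotopy operator of a retraction to `C` gives a primitive
of their difference. -/
lemma dForm_homotopyForm_of_agreeOn {U C : Set M} (hU : IsOpen U) {P : ℝ → M → M}
    (hP : ContMDiffOn (𝓘(ℝ, ℝ).prod (𝓡 m)) (𝓡 m) ∞ (fun q : ℝ × M => P q.1 q.2) (univ ×ˢ U))
    (hPU : ∀ t, MapsTo (P t) U U) (hP0 : ∀ x ∈ U, P 0 x = x) (hP1 : ∀ x ∈ U, P 1 x ∈ C)
    {σ₀ σ₁ : DiffForm m M 2} (h₀ : σ₀.SmoothOn U) (h₁ : σ₁.SmoothOn U) (hc₀ : σ₀.ClosedOn U)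
    (hc₁ : σ₁.ClosedOn U) {d : ℕ} {Φ₀ Φ₁ : M → LieDual d} (hA : AgreeOn C σ₀ Φ₀ σ₁ Φ₁) {x : M}
    (hx : x ∈ U) : dForm (homotopyForm P (formDiff σ₀ σ₁)) x = formDiff σ₀ σ₁ x := by
  obtain ⟨j, y, hy, rfl⟩ := exists_chart_point (m := m) hx
  refine DiffForm.eq_of_inChart_eq hy.1 ?_
  have hτ := h₀.formDiff h₁
  rw [(smoothOn_homotopyForm hU hP hPU hτ).inChart_dForm hU hy,
    extDeriv_homotopyForm hU hP hPU hτ (hc₀.formDiff hU h₀ h₁ hc₁) hy]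
  have e0 : (formDiff σ₀ σ₁).pull (fun z => P 0 ((extChartAt (𝓡 m) j).symm z)) y =
      (formDiff σ₀ σ₁).inChart j y := by
    refine DiffForm.pull_congr _ ?_
    filter_upwards [(isOpen_chartDomain (m := m) hU j).mem_nhds hy] with z hz using hP0 _ hz.2
  have e1 : (formDiff σ₀ σ₁).pull (fun z => P 1 ((extChartAt (𝓡 m) j).symm z)) y = 0 := by
    -- The composite of the end map with the inverse chart is a smooth map from an open subset of
    -- `ℝᵐ` into `C`, so agreement on `C` kills the pullback. Agreement is tested only in positive
    -- dimension; in dimension `0` every `2`-form is zero.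
    rcases Nat.eq_zero_or_pos m with rfl | hm
    · refine alternating_two_ext fun w₁ w₂ => ?_
      exact ContinuousAlternatingMap.map_coord_zero _ 0 (Subsingleton.elim _ _)
    · rw [pull_formDiff, sub_eq_zero]
      have hs : ContMDiffOn 𝓘(ℝ, 𝔼) (𝓡 m) ∞ (fun z => P 1 ((extChartAt (𝓡 m) j).symm z))
          (chartDomain U j) := fun z hz =>
        ((contMDiffAt_homotopy hU hP 1 hz.2).comp z
          ((contMDiffOn_extChartAt_symm_chartDomain U j).contMDiffAt
            ((isOpen_chartDomain hU j).mem_nhds hz))).contMDiffWithinAt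
      exact (hA m hm _ (isOpen_chartDomain hU j) _ hs (fun z hz => hP1 _ hz.2) y hy).1.symm
  rw [e0, e1, sub_zero]

/-- The constant map from the line to a point of `C` serves as a test map. -/
lemma AgreeOn.moment_eq {C : Set M} {σ₀ σ₁ : DiffForm m M 2} {d : ℕ} {Φ₀ Φ₁ : M → LieDual d}
    (hA : AgreeOn C σ₀ Φ₀ σ₁ Φ₁) {x : M} (hx : x ∈ C) : Φ₀ x = Φ₁ x :=
  (hA 1 one_pos univ isOpen_univ (fun _ => x) contMDiffOn_const (fun _ _ => hx) 0 (mem_univ _)).2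

lemma homotopyForm_apply {U : Set M} (hU : IsOpen U) {P : ℝ → M → M}
    (hP : ContMDiffOn (𝓘(ℝ, ℝ).prod (𝓡 m)) (𝓡 m) ∞ (fun q : ℝ × M => P q.1 q.2) (univ ×ˢ U))
    (hPU : ∀ t, MapsTo (P t) U U) {τ : DiffForm m M 2} (hτ : τ.SmoothOn U) {x : M} (hx : x ∈ U)
    (w : TangentSpace (𝓡 m) x) : homotopyForm P τ x ![w] = -∫ t in Icc (0 : ℝ) 1,
      homotopyIntegrand P τ t x ![w] := by
  have h := (ContinuousAlternatingMap.apply ℝ 𝔼 ℝ ![w]).integral_comp_comm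
    (integrableOn_homotopyIntegrand hU hP hPU hτ hx)
  exact (congrArg Neg.neg h).symm

variable {d : ℕ} {G : Type*} [Group G] [TopologicalSpace G]
    [ChartedSpace (EuclideanSpace ℝ (Fin d)) G] [MulAction G M]

/-- An equivariant map carries the orbit map of `x` to the orbit map of `f x`. -/
lemma mfderiv_fundamentalField_of_equivariant [LieGroup (𝓡 d) ∞ G]
    [ContMDiffSMul (𝓡 d) (𝓡 m) ∞ G M] {f : M → M} {U : Set M} (hUi : InvariantSet G U)
    (hfe : ∀ (g : G), ∀ x ∈ U, f (g • x) = g • f x) {x : M} (hx : x ∈ U)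
    (hf : MDifferentiableAt (𝓡 m) (𝓡 m) f x) (X : LieAlg d) :
    mfderiv (𝓡 m) (𝓡 m) f x (fundamentalField G X x) = fundamentalField (m := m) G X (f x) := by
  have h1 : (fun g : G => g • f x) = f ∘ fun g : G => g • x := funext fun g => (hfe g x hx).symm
  have hf' : MDifferentiableAt (𝓡 m) (𝓡 m) f ((1 : G) • x) := by rwa [one_smul]
  have h2 := mfderiv_comp (1 : G) hf' (mdifferentiableAt_smul_const (d := d) (m := m) (1 : G) x)
  have h3 : (mfderiv (𝓡 d) (𝓡 m) (fun g : G => g • f x) 1 : LieAlg d →L[ℝ] 𝔼) X =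
      (mfderiv (𝓡 m) (𝓡 m) f ((1 : G) • x) : 𝔼 →L[ℝ] 𝔼)
        ((mfderiv (𝓡 d) (𝓡 m) (fun g : G => g • x) 1 : LieAlg d →L[ℝ] 𝔼) X) := by
    rw [h1]
    exact congrArg (fun T : LieAlg d →L[ℝ] 𝔼 => T X) h2
  have h4 : ∀ (x' : M) (_ : x' = x) (w : 𝔼), (mfderiv (𝓡 m) (𝓡 m) f x' : 𝔼 →L[ℝ] 𝔼) w =
      (mfderiv (𝓡 m) (𝓡 m) f x : 𝔼 →L[ℝ] 𝔼) w := by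
    rintro _ rfl _; rfl
  exact (h3.trans (h4 _ (one_smul G x) _)).symm

lemma hasDerivAt_moment_homotopy {U : Set M} (hU : IsOpen U) {P : ℝ → M → M}
    (hP : ContMDiffOn (𝓘(ℝ, ℝ).prod (𝓡 m)) (𝓡 m) ∞ (fun q : ℝ × M => P q.1 q.2) (univ ×ˢ U))
    (hPU : ∀ t, MapsTo (P t) U U) {σ : DiffForm m M 2} {Φ : M → LieDual d}
    (H : IsHamiltonian G U σ Φ) (X : LieAlg d) {x : M} (hx : x ∈ U) (t : ℝ) :
    HasDerivAt (fun s => Φ (P s x) X)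
      (σ (P t x) ![fundamentalField G X (P t x), homotopyVelocity P t x]) t := by
  have h1 : MDifferentiableAt (𝓡 m) 𝓘(ℝ, ℝ) (fun y => Φ y X) (P t x) := by
    have h2 : MDifferentiableAt (𝓡 m) 𝓘(ℝ, LieDual d) Φ (P t x) :=
      (H.smooth_moment.contMDiffAt (hU.mem_nhds (hPU t hx))).mdifferentiableAt (by simp)
    have h3 : MDifferentiableAt 𝓘(ℝ, LieDual d) 𝓘(ℝ, ℝ) (fun ξ : LieDual d => ξ X) (Φ (P t x)) :=
      DifferentiableAt.mdifferentiableAt (by fun_prop)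
    exact h3.comp (P t x) h2
  have h4 := (contMDiffAt_homotopy_time hU hP t hx).mdifferentiableAt (by simp)
  have h5 := h1.hasMFDerivAt.comp t h4.hasMFDerivAt
  let A : 𝔼 →L[ℝ] ℝ := mfderiv (𝓡 m) 𝓘(ℝ, ℝ) (fun y => Φ y X) (P t x)
  let B : ℝ →L[ℝ] 𝔼 := mfderiv 𝓘(ℝ, ℝ) (𝓡 m) (fun s => P s x) t
  have h6 : HasFDerivAt (fun s => Φ (P s x) X) (A.comp B) t := hasMFDerivAt_iff_hasFDerivAt.1 h5
  rw [← H.hamilton X _ (hPU t hx)]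
  exact h6.hasDerivAt

/-- By Hamilton's equation, the derivative of the difference of the two moment maps along `t ↦ P t
x` is the homotopy integrand on `X♯`. At time `1` the moment maps agree, at time `0` their
difference is the one sought. Neither invariance of the homotopy form nor Cartan's formula is
needed. -/
lemma homotopyForm_fundamentalField [LieGroup (𝓡 d) ∞ G]
    [ContMDiffSMul (𝓡 d) (𝓡 m) ∞ G M] {U C : Set M} {P : ℝ → M → M}
    (hP : ContMDiffOn (𝓘(ℝ, ℝ).prod (𝓡 m)) (𝓡 m) ∞ (fun q : ℝ × M => P q.1 q.2) (univ ×ˢ U))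
    (hPU : ∀ t, MapsTo (P t) U U) (hPe : ∀ t (g : G), ∀ x ∈ U, P t (g • x) = g • P t x)
    (hP0 : ∀ x ∈ U, P 0 x = x) (hP1 : ∀ x ∈ U, P 1 x ∈ C)
    {σ₀ σ₁ : DiffForm m M 2} {Φ₀ Φ₁ : M → LieDual d} (H₀ : IsHamiltonian G U σ₀ Φ₀)
    (H₁ : IsHamiltonian G U σ₁ Φ₁) (hA : AgreeOn C σ₀ Φ₀ σ₁ Φ₁) {x : M}
    (hx : x ∈ U) (X : LieAlg d) :
    Φ₁ x X - Φ₀ x X = - homotopyForm P (formDiff σ₀ σ₁) x ![fundamentalField G X x] := by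
  have hU := H₀.isOpen
  have hτ := H₀.smooth_form.formDiff H₁.smooth_form
  rw [homotopyForm_apply hU hP hPU hτ hx, neg_neg]
  have hd : ∀ t, HasDerivAt (fun s => Φ₀ (P s x) X - Φ₁ (P s x) X)
      (homotopyIntegrand P (formDiff σ₀ σ₁) t x ![fundamentalField G X x]) t := by
    intro t
    refine ((hasDerivAt_moment_homotopy hU hP hPU H₀ X hx t).sub
      (hasDerivAt_moment_homotopy hU hP hPU H₁ X hx t)).congr_deriv ?_
    symm
    rw [homotopyIntegrand_apply, mfderiv_fundamentalField_of_equivariant H₀.invariant (hPe t) hx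
      ((contMDiffAt_homotopy hU hP t hx).mdifferentiableAt (by simp)) X]
    have hsw : ∀ (T : 𝔼 [⋀^Fin 2]→L[ℝ] ℝ) (a b : 𝔼), T ![a, b] = - T ![b, a] := fun T a b => by
      have h := T.toAlternatingMap.map_swap ![b, a] (i := 0) (j := 1) (by simp)
      refine Eq.trans ?_ h
      change T ![a, b] = T _
      congr 1; ext i; fin_cases i <;> rfl
    refine (hsw _ _ _).trans ?_
    exact neg_sub _ _
  have hint := (ContinuousAlternatingMap.apply ℝ 𝔼 ℝ ![fundamentalField (m := m) G X x]).integrable_comp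
    (integrableOn_homotopyIntegrand hU hP hPU hτ hx)
  have hFTC := intervalIntegral.integral_eq_sub_of_hasDerivAt (a := 0) (b := 1)
    (fun t _ => hd t) ((intervalIntegrable_iff_integrableOn_Icc_of_le zero_le_one).2 hint)
  rw [integral_Icc_eq_integral_Ioc, ← intervalIntegral.integral_of_le zero_le_one, hFTC, hP0 x hx,
    hA.moment_eq (hP1 x hx)]
  ring

end

/-! ### Uniqueness of the distribution of a polarized completion -/

section

variable {d n : ℕ} {M : Type*} [TopologicalSpace M]
  [ChartedSpace (EuclideanSpace ℝ (Fin (2 * n))) M] [IsManifold (𝓡 (2 * n)) ∞ M] [T2Space M]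
  [SecondCountableTopology M]
  {G : Type*} [Group G] [TopologicalSpace G] [T2Space G] [CompactSpace G]
    [ChartedSpace (EuclideanSpace ℝ (Fin d)) G] [LieGroup (𝓡 d) ∞ G]
    [MulAction G M] [ContMDiffSMul (𝓡 d) (𝓡 (2 * n)) ∞ G M]

/-- Two polarized Hamiltonian structures on `U` that agree on a weak deformation retract have the
same Duistermaat-Heckman distribution. -/
theorem DH_eq_of_agreeOn (o : ManifoldOrientation (2 * n) M) {v : M → LieAlg d}
    (hvb : Bornology.IsBounded (range v)) {U C : Set M}
    (hr : HasWeakDeformationRetraction G (2 * n) U C)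
    {σ₀ σ₁ : DiffForm (2 * n) M 2} {Φ₀ Φ₁ : M → LieDual d} (H₀ : IsHamiltonian G U σ₀ Φ₀)
    (H₁ : IsHamiltonian G U σ₁ Φ₁) (hp₀ : IsPolarizedOn U v Φ₀) (hp₁ : IsPolarizedOn U v Φ₁)
    (hA : AgreeOn C σ₀ Φ₀ σ₁ Φ₁) (φ : 𝓓((⊤ : TopologicalSpace.Opens (LieDual d)), ℝ)) :
    DH o U σ₀ Φ₀ φ = DH o U σ₁ Φ₁ φ := by
  obtain ⟨P, hP, hPU, hPe, hP0, hP1⟩ := hr.exists_homotopy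
  obtain ⟨c₀, hc₀⟩ := exists_bound_of_tsupport hvb φ
  -- Off the union of both sublevel sets, both pairings with `v` exceed `c₀`; hence so does the
  -- pairing of every convex combination of the moment maps, which therefore avoids the support of
  -- `φ`.
  refine DH_eq_of_exact o ((hp₀.isCompact_sublevel c₀).union (hp₁.isCompact_sublevel c₀))
    (union_subset (fun x hx => hx.1) fun x hx => hx.1) H₀ H₁
    (smoothOn_homotopyForm H₀.isOpen hP hPU (H₀.smooth_form.formDiff H₁.smooth_form))
    (fun x hx => ?_)
    (fun x hx X => homotopyForm_fundamentalField hP hPU hPe hP0 hP1 H₀ H₁ hA hx X) φ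
    fun x hx hxK r hr hm => hxK ?_
  · rw [dForm_homotopyForm_of_agreeOn H₀.isOpen hP hPU hP0 hP1 H₀.smooth_form H₁.smooth_form
      H₀.closed_form H₁.closed_form hA hx]
    exact (add_sub_cancel _ _).symm
  · have h1 := hc₀ _ hm x
    simp only [add_apply, smul_apply, sub_apply, smul_eq_mul] at h1
    by_contra hn
    have h2 : c₀ < Φ₀ x (v x) := not_le.1 fun h => hn (Or.inl ⟨hx, h⟩)
    have h3 : c₀ < Φ₁ x (v x) := not_le.1 fun h => hn (Or.inr ⟨hx, h⟩)
    nlinarith [mul_nonneg hr.1 (sub_nonneg.2 h3.le), mul_nonneg (sub_nonneg.2 hr.2) (sub_nonneg.2 h2.le),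
      hr.1, hr.2]

end

/-! ### Connected components of the localizing set -/

section Components

variable {X : Type*} [TopologicalSpace X] {Z C : Set X}

lemma subset_of_mem_componentsOf (hC : C ∈ componentsOf Z) : C ⊆ Z := by
  obtain ⟨z, -, rfl⟩ := hC
  exact connectedComponentIn_subset Z z

/-- The closure of a component is connected and stays inside the closed set `Z`. -/
lemma isClosed_of_mem_componentsOf (hZ : IsClosed Z) (hC : C ∈ componentsOf Z) : IsClosed C := by
  obtain ⟨z, hz, rfl⟩ := hC
  refine isClosed_of_closure_subset (IsPreconnected.subset_connectedComponentIn
    isPreconnected_connectedComponentIn.closure (subset_closure (mem_connectedComponentIn hz)) ?_)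
  exact closure_minimal (connectedComponentIn_subset Z z) hZ

lemma exists_mem_componentsOf {z : X} (hz : z ∈ Z) : ∃ C ∈ componentsOf Z, z ∈ C :=
  ⟨_, ⟨z, hz, rfl⟩, mem_connectedComponentIn hz⟩

lemma disjoint_of_mem_componentsOf {C' : Set X} (hC : C ∈ componentsOf Z)
    (hC' : C' ∈ componentsOf Z) (h : C ≠ C') : Disjoint C C' := by
  obtain ⟨z, hz, rfl⟩ := hC
  obtain ⟨z', hz', rfl⟩ := hC'
  rw [Set.disjoint_left]
  intro x hx hx'
  exact h ((connectedComponentIn_eq hx).trans (connectedComponentIn_eq hx').symm)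

/-- Components that are open in the closed set `Z` have disjoint open neighbourhoods. -/
lemma exists_disjoint_nhds_components [TopologicalSpace.MetrizableSpace X] (hZ : IsClosed Z)
    (hiso : ∀ C ∈ componentsOf Z, ∃ O : Set X, IsOpen O ∧ O ∩ Z = C) :
    ∃ O : componentsOf Z → Set X, (∀ C, IsOpen (O C)) ∧ (∀ C, O C ∩ Z = C) ∧
      Pairwise (Function.onFun Disjoint O) := by
  let _ := TopologicalSpace.metrizableSpaceMetric X
  have hmem : ∀ C ∈ componentsOf Z, ∀ x ∈ Z, x ∈ C ↔
      Metric.infEDist x C < Metric.infEDist x (Z \ C) := by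
    intro C hC x hx
    constructor
    · intro hxC
      obtain ⟨O, hO, hOC⟩ := hiso C hC
      have hcl : IsClosed (Z \ C) := by
        have h : Z \ C = Z ∩ Oᶜ := by
          ext y
          rw [← hOC]
          simp only [mem_sdiff, mem_inter_iff, mem_compl_iff]
          tauto
        rw [h]
        exact hZ.inter hO.isClosed_compl
      rw [Metric.infEDist_zero_of_mem hxC, Metric.infEDist_pos_iff_notMem_closure, hcl.closure_eq]
      exact fun h => h.2 hxC
    · intro h
      by_contra hn
      rw [Metric.infEDist_zero_of_mem (s := Z \ C) ⟨hx, hn⟩] at h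
      exact not_lt_zero h
  -- The neighbourhood of `C` consists of the points strictly closer to `C` than to the rest of `Z`.
  -- No point is closer to each of two components than to the complement of that component in `Z`,
  -- because each component lies in the complement of the other.
  refine ⟨fun C => {x | Metric.infEDist x C < Metric.infEDist x (Z \ C)}, fun C =>
    isOpen_lt Metric.continuous_infEDist Metric.continuous_infEDist, fun C => ?_,
    fun C C' hne => ?_⟩
  · ext x
    constructor
    · rintro ⟨h, hx⟩
      exact (hmem C C.2 x hx).2 h
    · intro hx
      have hxZ := subset_of_mem_componentsOf C.2 hx
      exact ⟨(hmem C C.2 x hxZ).1 hx, hxZ⟩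
  · have hd := disjoint_of_mem_componentsOf C.2 C'.2 (Subtype.coe_injective.ne hne)
    rw [Function.onFun, Set.disjoint_left]
    intro x (hx : Metric.infEDist x (C : Set X) < _) (hx' : Metric.infEDist x (C' : Set X) < _)
    have h1 : Metric.infEDist x (Z \ C) ≤ Metric.infEDist x (C' : Set X) :=
      Metric.infEDist_anti fun y hy => ⟨subset_of_mem_componentsOf C'.2 hy,
        hd.notMem_of_mem_right hy⟩
    have h2 : Metric.infEDist x (Z \ C') ≤ Metric.infEDist x (C : Set X) :=
      Metric.infEDist_anti fun y hy => ⟨subset_of_mem_componentsOf C.2 hy,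
        hd.notMem_of_mem_left hy⟩
    exact absurd (hx.trans_le (h1.trans (hx'.le.trans h2))) (lt_irrefl _)

end Components

/-! ### Agreement on a subset, and polarization on one piece of a disjoint union -/

section Agree

variable {d m : ℕ} {M : Type*} [TopologicalSpace M] [ChartedSpace (EuclideanSpace ℝ (Fin m)) M]
  {Y : Set M} {σ₀ σ₁ σ₂ : DiffForm m M 2} {Φ₀ Φ₁ Φ₂ : M → LieDual d}

lemma AgreeOn.symm (h : AgreeOn Y σ₀ Φ₀ σ₁ Φ₁) : AgreeOn Y σ₁ Φ₁ σ₀ Φ₀ :=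
  fun k hk V hV p hp hpY u hu => ⟨(h k hk V hV p hp hpY u hu).1.symm,
    (h k hk V hV p hp hpY u hu).2.symm⟩

lemma AgreeOn.trans (h : AgreeOn Y σ₀ Φ₀ σ₁ Φ₁) (h' : AgreeOn Y σ₁ Φ₁ σ₂ Φ₂) :
    AgreeOn Y σ₀ Φ₀ σ₂ Φ₂ :=
  fun k hk V hV p hp hpY u hu =>
    ⟨(h k hk V hV p hp hpY u hu).1.trans (h' k hk V hV p hp hpY u hu).1,
      (h k hk V hV p hp hpY u hu).2.trans (h' k hk V hV p hp hpY u hu).2⟩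

lemma AgreeOn.of_eq (h : ∀ x ∈ Y, σ₀ x = σ₁ x ∧ Φ₀ x = Φ₁ x) : AgreeOn Y σ₀ Φ₀ σ₁ Φ₁ :=
  fun _ _ _ _ p _ hpY u hu => by
    have h1 := h (p u) (hpY hu)
    exact ⟨by rw [h1.1], h1.2⟩

end Agree

/-- Since `W` is open and covers the rest of `U`, a sublevel set on `V` is a sublevel set on `U`
intersected with the closed complement of `W`, hence still compact. -/
lemma IsPolarizedOn.mono_of_disjoint {d : ℕ} {M : Type*} [TopologicalSpace M] [T2Space M]
    {U V W : Set M} {v : M → LieAlg d} {Φ : M → LieDual d} (h : IsPolarizedOn U v Φ)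
    (hc : ContinuousOn (fun x => Φ x (v x)) U) (hVU : V ⊆ U) (hW : IsOpen W) (hVW : Disjoint V W)
    (hU : U ⊆ V ∪ W) : IsPolarizedOn V v Φ := by
  obtain ⟨b, hb⟩ := h.2
  refine isPolarizedOn_of_isCompact (b := b) (hc.mono hVU) (fun x hx => hb ⟨x, hVU hx, rfl⟩)
    fun c => ?_
  have h1 : {x | x ∈ V ∧ Φ x (v x) ≤ c} = {x | x ∈ U ∧ Φ x (v x) ≤ c} ∩ Wᶜ := by
    ext x
    constructor
    · rintro ⟨hx, hxc⟩
      exact ⟨⟨hVU hx, hxc⟩, hVW.notMem_of_mem_left hx⟩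
    · rintro ⟨⟨hx, hxc⟩, hxW⟩
      exact ⟨(hU hx).resolve_right hxW, hxc⟩
  rw [h1]
  exact (h.isCompact_sublevel c).inter_right hW.isClosed_compl

/-! ### Existence, uniqueness and summation of local models -/

section LocalModels

variable {d n : ℕ} {M : Type*} [TopologicalSpace M]
  [ChartedSpace (EuclideanSpace ℝ (Fin (2 * n))) M] [IsManifold (𝓡 (2 * n)) ∞ M] [T2Space M]
  [SecondCountableTopology M]
  {G : Type*} [Group G] [TopologicalSpace G] [T2Space G] [CompactSpace G]
    [ChartedSpace (EuclideanSpace ℝ (Fin d)) G] [LieGroup (𝓡 d) ∞ G]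
    [MulAction G M] [ContMDiffSMul (𝓡 d) (𝓡 (2 * n)) ∞ G M]

/-- A Duistermaat-Heckman integral is the sum of its restrictions to disjoint open sets that cover
the support. -/
lemma DH_eq_sum_of_disjoint (o : ManifoldOrientation (2 * n) M) {U K : Set M} (hK : IsCompact K)
    (hKU : K ⊆ U) {σ : DiffForm (2 * n) M 2} {Φ : M → LieDual d} (H : IsHamiltonian G U σ Φ)
    (φ : 𝓓((⊤ : TopologicalSpace.Opens (LieDual d)), ℝ)) (h0 : ∀ x ∈ U, x ∉ K → φ (Φ x) = 0)
    {ι : Type*} (s : Finset ι) {V : ι → Set M} (hV : ∀ i ∈ s, IsOpen (V i))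
    (hVU : ∀ i ∈ s, V i ⊆ U) (hd : Set.Pairwise (s : Set ι) (Function.onFun Disjoint V))
    (h0' : ∀ x ∈ U, (∀ i ∈ s, x ∉ V i) → φ (Φ x) = 0) :
    DH o U σ Φ φ = ∑ i ∈ s, DH o (V i) σ Φ φ := by
  set S : Finset M := (finite_tsupport_chartPartition_inter (m := 2 * n) hK).toFinset with hSdef
  have hS : ∀ j, (tsupport (chartPartition (2 * n) M j) ∩ K).Nonempty → j ∈ S :=
    fun j hj => by simpa [hSdef] using hj
  have hU := H.isOpen
  set V' : Set M := ⋃ i ∈ s, V i with hV'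
  have hV'o : IsOpen V' := isOpen_biUnion hV
  have hV'U : V' ⊆ U := iUnion₂_subset hVU
  rw [DH_mono o hU hV'U σ Φ φ fun x hx hxV => h0' x hx fun i hi hxi =>
    hxV (mem_biUnion hi hxi), DH_eq_sum o hS σ Φ φ fun x hx => h0 x (hV'U hx)]
  rw [Finset.sum_congr rfl fun i hi => DH_eq_sum o hS σ Φ φ fun x hx => h0 x (hVU i hi hx),
    Finset.sum_comm]
  refine Finset.sum_congr rfl fun j _ => ?_
  have hdom : chartDomain (m := 2 * n) V' j = ⋃ i ∈ s, chartDomain (m := 2 * n) (V i) j := by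
    simp only [chartDomain, hV', preimage_iUnion, inter_iUnion]
  have hsm : ContDiffOn ℝ ∞ (fun y => (chartPartition (2 * n) M j ((extChartAt (𝓡 (2 * n)) j).symm y) *
      chartSign o j y) * (φ (Φ ((extChartAt (𝓡 (2 * n)) j).symm y)) * pf (σ.inChart j y)))
      (chartDomain U j) :=
    ((contDiffOn_comp_symm ((chartPartition (2 * n) M j).contMDiff.contMDiffOn (s := U)) j).mul
      ((contDiffOn_chartSign o j).mono inter_subset_left)).mul
      ((φ.contDiff.comp_contDiffOn (contDiffOn_comp_symm H.smooth_moment j)).mul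
        (contDiff_infty_pf.comp_contDiffOn (H.smooth_form j)))
  have hint := integrableOn_of_contDiffOn (isOpen_chartDomain hU j) (isCompact_chartCompact hK j)
    (chartCompact_subset hKU j) hsm fun y hy hyK => by
      rcases notMem_chartCompact hy.1 hyK with h | h
      · rw [h0 _ hy.2 h]; ring
      · rw [image_eq_zero_of_notMem_tsupport h]; ring
  rw [hdom, integral_biUnion_finset s (fun i hi => (isOpen_chartDomain (hV i hi) j).measurableSet)]
  · intro i hi i' hi' hne
    exact ((hd hi hi' hne).preimage _).mono inter_subset_right inter_subset_right
  · exact fun i hi => hint.mono_set (inter_subset_inter_right _ (preimage_mono (hVU i hi)))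

variable {v : M → LieAlg d} {σ : DiffForm (2 * n) M 2} {Φ : M → LieDual d} {C : Set M}

/-- Localization applied to the completion itself, whose neighbourhood meets the localizing set only
in `C`. The new structure equals the old one near `C`, so it is again a completion of the original
one. -/
lemma IsLocalModel.exists_shrink (o : ManifoldOrientation (2 * n) M)
    (hv : IsTamingMap (m := 2 * n) G v) (hvb : Bornology.IsBounded (range v)) (hC : IsClosed C)
    {U₀ U : Set M} {σ₀ : DiffForm (2 * n) M 2} {Φ₀ : M → LieDual d}
    (h : IsLocalModel G v σ Φ C U₀ σ₀ Φ₀) (hU : IsRetractingNhd G (2 * n) U C) (hUU : U ⊆ U₀)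
    (φ : 𝓓((⊤ : TopologicalSpace.Opens (LieDual d)), ℝ)) :
    ∃ (σ' : DiffForm (2 * n) M 2) (Φ' : M → LieDual d), IsLocalModel G v σ Φ C U σ' Φ' ∧
      DH o U₀ σ₀ Φ₀ φ = DH o U σ' Φ' φ := by
  have hiso := h.isolating
  obtain ⟨σ', Φ', H', hp', ⟨N, -, hCN, hN⟩, hDH⟩ := exists_localization o hv hvb
    h.completion.hamiltonian h.completion.polarized hU.isOpen hU.invariant hUU
    (by rwa [hiso]) (by rw [hiso]; exact hU.subset) φ
  rw [hiso] at hCN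
  refine ⟨σ', Φ', ⟨hU, ?_, H', hp', (AgreeOn.of_eq fun x hx => hN x (hCN hx)).trans
    h.completion.agree⟩, hDH⟩
  refine subset_antisymm ((inter_subset_inter_left _ hUU).trans hiso.subset) fun x hx =>
    ⟨hU.subset hx, (hiso.symm.subset hx).2⟩

/-- All local models at `C` have the same Duistermaat-Heckman distribution. -/
lemma IsLocalModel.DH_eq (o : ManifoldOrientation (2 * n) M)
    (hv : IsTamingMap (m := 2 * n) G v) (hvb : Bornology.IsBounded (range v)) (hC : IsClosed C)
    (hr : ∀ O : Set M, IsOpen O → C ⊆ O → ∃ U ⊆ O, IsRetractingNhd G (2 * n) U C)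
    {U₀ U₁ : Set M} {σ₀ σ₁ : DiffForm (2 * n) M 2} {Φ₀ Φ₁ : M → LieDual d}
    (h₀ : IsLocalModel G v σ Φ C U₀ σ₀ Φ₀) (h₁ : IsLocalModel G v σ Φ C U₁ σ₁ Φ₁)
    (φ : 𝓓((⊤ : TopologicalSpace.Opens (LieDual d)), ℝ)) :
    DH o U₀ σ₀ Φ₀ φ = DH o U₁ σ₁ Φ₁ φ := by
  -- The intersection need not retract to `C`, so a smaller retracting neighbourhood inside it is
  -- used for the comparison.
  obtain ⟨U, hUO, hU⟩ := hr (U₀ ∩ U₁) (h₀.nhd.isOpen.inter h₁.nhd.isOpen)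
    (subset_inter h₀.nhd.subset h₁.nhd.subset)
  obtain ⟨σ₂, Φ₂, h₂, e₂⟩ := h₀.exists_shrink o hv hvb hC hU (hUO.trans inter_subset_left) φ
  obtain ⟨σ₃, Φ₃, h₃, e₃⟩ := h₁.exists_shrink o hv hvb hC hU (hUO.trans inter_subset_right) φ
  rw [e₂, e₃]
  exact DH_eq_of_agreeOn o hvb hU.retraction h₂.completion.hamiltonian h₃.completion.hamiltonian
    h₂.completion.polarized h₃.completion.polarized
    (h₂.completion.agree.trans h₃.completion.agree.symm) φ

/-- A global polarized structure can be replaced by local models at the components of the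
localizing set. -/
lemma exists_localModels (o : ManifoldOrientation (2 * n) M) (hΦ : IsHamiltonian G univ σ Φ)
    (hv : IsTamingMap (m := 2 * n) G v) (hvb : Bornology.IsBounded (range v))
    (hp : IsPolarizedOn univ v Φ)
    (hiso : ∀ C ∈ componentsOf (localizingSet G (2 * n) v),
      ∃ O : Set M, IsOpen O ∧ O ∩ localizingSet G (2 * n) v = C)
    (hr : ∀ C ∈ componentsOf (localizingSet G (2 * n) v),
      ∀ O : Set M, IsOpen O → C ⊆ O → ∃ U ⊆ O, IsRetractingNhd G (2 * n) U C)
    (φ : 𝓓((⊤ : TopologicalSpace.Opens (LieDual d)), ℝ)) :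
    ∃ (U : componentsOf (localizingSet G (2 * n) v) → Set M) (σ' : DiffForm (2 * n) M 2)
      (Φ' : M → LieDual d), (∀ C : componentsOf (localizingSet G (2 * n) v), IsLocalModel G v σ Φ C (U C) σ' Φ') ∧
      {C | DH o (U C) σ' Φ' φ ≠ 0}.Finite ∧ DH o univ σ Φ φ = ∑ᶠ C, DH o (U C) σ' Φ' φ := by
  set Z := localizingSet G (2 * n) v with hZdef
  have hZ : IsClosed Z := hv.isClosed_localizingSet
  have := ChartedSpace.locallyCompactSpace (EuclideanSpace ℝ (Fin (2 * n))) M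
  obtain ⟨O, hO, hOZ, hOd⟩ := exists_disjoint_nhds_components hZ hiso
  have hCO : ∀ C : componentsOf Z, (C : Set M) ⊆ O C := fun C x hx =>
    ((hOZ C).symm.subset hx).1
  choose U hUO hU using fun C : componentsOf Z => hr C C.2 (O C) (hO C) (hCO C)
  have hUd : Pairwise (Function.onFun Disjoint U) := fun C C' hne =>
    (hOd hne).mono (hUO C) (hUO C')
  have hUo : IsOpen (⋃ C, U C) := isOpen_iUnion fun C => (hU C).isOpen
  have hUi : InvariantSet G (⋃ C, U C) := fun g x hx => by
    obtain ⟨C, hxC⟩ := mem_iUnion.1 hx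
    exact mem_iUnion.2 ⟨C, (hU C).invariant g x hxC⟩
  have hZU : Z ⊆ ⋃ C, U C := fun z hz => by
    obtain ⟨C, hC, hzC⟩ := exists_mem_componentsOf hz
    exact mem_iUnion.2 ⟨⟨C, hC⟩, (hU ⟨C, hC⟩).subset hzC⟩
  -- A single structure on the disjoint union of all the neighbourhoods; its restrictions to the
  -- pieces are the local models.
  obtain ⟨σ', Φ', H', hp', ⟨N, -, hZN, hN⟩, hDH⟩ := exists_localization o hv hvb hΦ hp hUo hUi
    (subset_univ _) (by rwa [univ_inter]) (by rwa [univ_inter]) φ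
  rw [univ_inter] at hZN
  refine ⟨U, σ', Φ', fun C => ⟨hU C, ?_, ?_, ?_, ?_⟩, ?_⟩
  · refine subset_antisymm ((inter_subset_inter_left _ (hUO C)).trans (hOZ C).subset) fun x hx =>
      ⟨(hU C).subset hx, subset_of_mem_componentsOf C.2 hx⟩
  · exact H'.mono (hU C).isOpen (hU C).invariant (subset_iUnion U C)
  · refine hp'.mono_of_disjoint (W := ⋃ C' ∈ {C' | C' ≠ C}, U C') (H'.continuousOn_apply hv)
      (subset_iUnion U C) (isOpen_biUnion fun C' _ => (hU C').isOpen) ?_ ?_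
    · rw [disjoint_iUnion₂_right]
      exact fun C' hC' => hUd (Ne.symm hC')
    · intro x hx
      obtain ⟨C', hxC'⟩ := mem_iUnion.1 hx
      rcases eq_or_ne C' C with rfl | hne
      · exact Or.inl hxC'
      · exact Or.inr (mem_biUnion hne hxC')
  · exact AgreeOn.of_eq fun x hx => hN x (hZN (subset_of_mem_componentsOf C.2 hx))
  · obtain ⟨c₀, hc₀⟩ := exists_bound_of_tsupport hvb φ
    have hK := hp'.isCompact_sublevel c₀
    have h0 : ∀ x ∈ ⋃ C, U C, x ∉ {x | x ∈ ⋃ C, U C ∧ Φ' x (v x) ≤ c₀} → φ (Φ' x) = 0 :=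
      fun x hx hxK => image_eq_zero_of_notMem_tsupport fun hm => hxK ⟨hx, hc₀ _ hm x⟩
    -- The part of the union that can contribute to the integral of `φ` is compact, so it meets only
    -- the pieces indexed by a finite set `s`.
    obtain ⟨s, hs⟩ := hK.elim_finite_subcover U (fun C => (hU C).isOpen) fun x hx => hx.1
    have hz : ∀ x ∈ ⋃ C, U C, (∀ C ∈ s, x ∉ U C) → φ (Φ' x) = 0 := fun x hx hxs =>
      h0 x hx fun hxK => by
        obtain ⟨C, hC, hxC⟩ := mem_iUnion₂.1 (hs hxK)
        exact hxs C hC hxC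
    have hsupp : ∀ C, DH o (U C) σ' Φ' φ ≠ 0 → C ∈ s := fun C hC => by
      by_contra hCs
      refine hC ?_
      -- On a piece outside `s` the function `φ ∘ Φ'` vanishes identically, so the integral is an
      -- empty sum.
      have hsum := DH_eq_sum_of_disjoint o isCompact_empty (empty_subset _)
        (H'.mono (hU C).isOpen (hU C).invariant (subset_iUnion U C)) φ
        (fun x hx _ => hz x (mem_iUnion.2 ⟨C, hx⟩) fun C' hC' hx' =>
          (hUd (show C ≠ C' from fun h => hCs (h ▸ hC'))).notMem_of_mem_left hx hx')
        (∅ : Finset (componentsOf Z)) (V := U) (by simp) (by simp) (by simp)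
        fun x hx _ => hz x (mem_iUnion.2 ⟨C, hx⟩) fun C' hC' hx' =>
          (hUd (show C ≠ C' from fun h => hCs (h ▸ hC'))).notMem_of_mem_left hx hx'
      simpa using hsum
    refine ⟨s.finite_toSet.subset fun C hC => hsupp C hC, ?_⟩
    rw [hDH, finsum_eq_sum_of_support_subset _ (s := s) fun C hC => hsupp C hC]
    exact DH_eq_sum_of_disjoint o hK (fun x hx => hx.1) H' φ h0 s (fun C _ => (hU C).isOpen)
      (fun C _ => subset_iUnion U C) (fun C _ C' _ hne => hUd hne) hz

end LocalModels

end HamiltonianLocalization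

end

/-! ### The localization theorem -/

theorem mainTheorem1 {d n : ℕ}
    {G : Type*} [Group G] [TopologicalSpace G] [T2Space G] [CompactSpace G]
    [ChartedSpace (EuclideanSpace ℝ (Fin d)) G] [LieGroup (𝓡 d) ∞ G]
    {M : Type*} [TopologicalSpace M] [T2Space M] [SecondCountableTopology M]
    [ChartedSpace (EuclideanSpace ℝ (Fin (2 * n))) M] [IsManifold (𝓡 (2 * n)) ∞ M]
    [MulAction G M] [ContMDiffSMul (𝓡 d) (𝓡 (2 * n)) ∞ G M]
    (o : ManifoldOrientation (2 * n) M)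
    (σ : DiffForm (2 * n) M 2) (Φ : M → LieDual d) (hΦ : IsHamiltonian G univ σ Φ)
    (v : M → LieAlg d) (hv : IsTamingMap (m := 2 * n) G v)
    (hv_bounded : Bornology.IsBounded (range v))
    (hΦ_polarized : IsPolarizedOn univ v Φ)
    -- the connected components of the localizing set are isolated from each other
    (h_isolated : ∀ C ∈ componentsOf (localizingSet G (2 * n) v),
      ∃ O : Set M, IsOpen O ∧ O ∩ localizingSet G (2 * n) v = C)
    -- each of them has arbitrarily small neighbourhoods that retract to it
    (h_retract : ∀ C ∈ componentsOf (localizingSet G (2 * n) v),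
      ∀ O : Set M, IsOpen O → C ⊆ O → ∃ U ⊆ O, IsRetractingNhd G (2 * n) U C) :
    ∃ D : componentsOf (localizingSet G (2 * n) v) →
        𝓓((⊤ : TopologicalSpace.Opens (LieDual d)), ℝ) → ℝ,
      (∀ C : componentsOf (localizingSet G (2 * n) v), IsGermDH G o v σ Φ (C : Set M) (D C)) ∧
      ∀ φ : 𝓓((⊤ : TopologicalSpace.Opens (LieDual d)), ℝ),
        {C | D C φ ≠ 0}.Finite ∧ DH o univ σ Φ φ = ∑ᶠ C, D C φ := by
  have hcl : ∀ C : componentsOf (localizingSet G (2 * n) v), IsClosed (C : Set M) := fun C =>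
    isClosed_of_mem_componentsOf hv.isClosed_localizingSet C.2
  -- Reference models that define `D`. Only their existence is used, so any test function would do.
  obtain ⟨U, σ', Φ', hmodel, -⟩ := exists_localModels o hΦ hv hv_bounded hΦ_polarized h_isolated
    h_retract 0
  refine ⟨fun C φ => DH o (U C) σ' Φ' φ, fun C => ⟨fun O hO hCO => ?_, fun U₁ σ₁ Φ₁ h₁ φ =>
    (hmodel C).DH_eq o hv hv_bounded (hcl C) (h_retract C C.2) h₁ φ⟩, fun φ => ?_⟩
  · obtain ⟨U₁, hU₁O, hU₁⟩ := h_retract C C.2 (O ∩ U C) (hO.inter (hmodel C).nhd.isOpen)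
      (subset_inter hCO (hmodel C).nhd.subset)
    obtain ⟨σ₁, Φ₁, h₁, -⟩ := (hmodel C).exists_shrink o hv hv_bounded (hcl C) hU₁
      (hU₁O.trans inter_subset_right) 0
    exact ⟨U₁, hU₁O.trans inter_subset_left, σ₁, Φ₁, h₁⟩
  -- These models are adapted to `φ` and give the sum formula for it; uniqueness identifies their
  -- contributions with those of the reference models.
  · obtain ⟨U₁, σ₁, Φ₁, h₁, hfin, hsum⟩ := exists_localModels o hΦ hv hv_bounded hΦ_polarized
      h_isolated h_retract φ
    have e : ∀ C, DH o (U C) σ' Φ' φ = DH o (U₁ C) σ₁ Φ₁ φ := fun C =>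
      (hmodel C).DH_eq o hv hv_bounded (hcl C) (h_retract C C.2) (h₁ C) φ
    simp only [e]
    exact ⟨hfin, hsum⟩
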